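/- Let $N\ge 2$, write $x=(x',x_N)\in\mathbb R^{N-1}\times\mathbb R$, let $\mathbb R^N_+=\{x_N>0\}$ and identify $\partial\mathbb R^N_+$ with $\mathbb R^{N-1}$. A local Radon measure on a $\sigma$-compact locally compact Hausdorff space $X$ is a continuous linear functional $\mu$ on $C_c(X)$; with its Jordan decomposition $\mu=\mu^+-\mu^-$ into positive Radon measures put $|\mu|=\mu^++\mu^-$ and $\int f\,d\mu=\int f\,d\mu^+-\int f\,d\mu^-$. Let $\mu$ be a local Radon measure on $\mathbb R^N_+$ with $\int_\Omega x_N\,d|\mu|<\infty$ for every bounded $\Omega\subset\mathbb R^N_+$, and let $\nu$ be a local Radon measure on $\partial\mathbb R^N_+$. Let $u$ be a weak solution of $\Delta u=\mu$ in $\mathbb R^N_+$, $u=\nu$ on $\partial\mathbb R^N_+$; that is, $u\in L^1(\Omega)$ for every bounded open $\Omega\subset\mathbb R^N_+$, and $$-\int_{\mathbb R^N_+}\varphi\,d\mu+\int_{\mathbb R^{N-1}}\partial_N\varphi(x',0)\,d\nu(x')=\int_{\mathbb R^N_+}u\,(-\Delta\varphi)\,dx$$ for every $\varphi\in C^2_c(\mathbb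 R^N)$ with $\varphi(x',0)=0$ for all $x'$. Then $u$ has a lim-trace on $\partial\mathbb R^N_+$ and $\mathrm{Tr}(u)=\nu$. That is, $u\in W^{1,p}_{loc}(\mathbb R^N_+)$ for some $p>1$, so that $u$ has a Sobolev trace $u(\cdot,\varepsilon)$ on each hyperplane $\{x_N=\varepsilon\}$, $\varepsilon>0$, and $$\lim_{\varepsilon\to0^+}\int_{\mathbb R^{N-1}}\psi(x')\,u(x',\varepsilon)\,dx'=\int_{\mathbb R^{N-1}}\psi\,d\nu\qquad\text{for every }\psi\in C^2_c(\mathbb R^{N-1}).$$ -/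

import Mathlib

open MeasureTheory Filter Topology CompactlySupported
open scoped NNReal ContDiff

/-! ### Local Radon measures -/

/-- A local Radon measure on `X`: a linear functional on `C_c(X)` that is continuous, i.e. bounded
for the sup norm on the functions supported in any given compact set. -/
structure LocalRadonMeasure (X : Type*) [TopologicalSpace X] where
  toLinearMap : C_c(X, ℝ) →ₗ[ℝ] ℝ
  continuous' : ∀ K : Set X, IsCompact K → ∃ C : ℝ, ∀ f : C_c(X, ℝ), tsupport f ⊆ K →
    ∀ M : ℝ, (∀ x, |f x| ≤ M) → |toLinearMap f| ≤ C * M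

namespace LocalRadonMeasure

section Functional

variable {X : Type*} [TopologicalSpace X]

instance : Neg (LocalRadonMeasure X) where
  neg μ :=
    { toLinearMap := -μ.toLinearMap
      continuous' := fun K hK => by simpa using μ.continuous' K hK }

protected theorem neg_neg (μ : LocalRadonMeasure X) : -(-μ) = μ := by
  cases μ
  simp only [Neg.neg, LocalRadonMeasure.mk.injEq]
  exact neg_neg _

/-- The set of values `μ(g)`, `0 ≤ g ≤ f`, whose supremum is `μ⁺(f)`. -/
def values (μ : LocalRadonMeasure X) (f : C_c(X, ℝ≥0)) : Set ℝ :=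
  {r | ∃ g : C_c(X, ℝ≥0), g ≤ f ∧ r = μ.toLinearMap g.toReal}

theorem values_nonempty (μ : LocalRadonMeasure X) (f : C_c(X, ℝ≥0)) : (μ.values f).Nonempty :=
  ⟨_, 0, fun x => by simp, rfl⟩

theorem values_bddAbove (μ : LocalRadonMeasure X) (f : C_c(X, ℝ≥0)) : BddAbove (μ.values f) := by
  obtain ⟨C, hC⟩ := μ.continuous' (tsupport f) f.hasCompactSupport
  obtain ⟨M, hM⟩ := (f.hasCompactSupport.isCompact_range f.continuous).bddAbove
  refine ⟨C * (M : ℝ), ?_⟩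
  rintro _ ⟨g, hg, rfl⟩
  refine (le_abs_self _).trans (hC _ (closure_mono ?_) _ fun x => ?_)
  · intro x hx hfx
    have h1 : g x ≤ f x := hg x
    rw [hfx] at h1
    exact hx (by simp [nonpos_iff_eq_zero.mp h1])
  · have h1 : g x ≤ M := (hg x).trans (hM ⟨x, rfl⟩)
    simpa using h1

theorem sSup_values_nonneg (μ : LocalRadonMeasure X) (f : C_c(X, ℝ≥0)) :
    0 ≤ sSup (μ.values f) := by
  refine le_csSup (μ.values_bddAbove f) ⟨0, fun x => by simp, ?_⟩
  have : (0 : C_c(X, ℝ≥0)).toReal = 0 := by ext; simp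
  rw [this, map_zero]

theorem sSup_values_add (μ : LocalRadonMeasure X) (f₁ f₂ : C_c(X, ℝ≥0)) :
    sSup (μ.values (f₁ + f₂)) = sSup (μ.values f₁) + sSup (μ.values f₂) := by
  apply le_antisymm
  · refine csSup_le (μ.values_nonempty _) ?_
    rintro _ ⟨g, hg, rfl⟩
    obtain ⟨h, hh⟩ := CompactlySupportedContinuousMap.exists_add_of_le
      (inf_le_left : g ⊓ f₁ ≤ g)
    rw [← hh, CompactlySupportedContinuousMap.toReal_add, map_add]
    refine add_le_add (le_csSup (μ.values_bddAbove _) ⟨_, inf_le_right, rfl⟩)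
      (le_csSup (μ.values_bddAbove _) ⟨h, fun x => ?_, rfl⟩)
    have h1 : (g x ⊓ f₁ x) + h x = g x := congrArg (fun k : C_c(X, ℝ≥0) => k x) hh
    have h2 : g x ≤ f₁ x + f₂ x := hg x
    rcases le_total (g x) (f₁ x) with h3 | h3
    · rw [inf_eq_left.mpr h3] at h1
      have h4 : h x = 0 := by simpa using h1
      change h x ≤ f₂ x
      rw [h4]
      exact zero_le
    · rw [inf_eq_right.mpr h3] at h1
      rw [← h1] at h2
      exact le_of_add_le_add_left h2
  · rw [← csSup_add (μ.values_nonempty _) (μ.values_bddAbove _) (μ.values_nonempty _)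
      (μ.values_bddAbove _)]
    refine csSup_le ((μ.values_nonempty _).add (μ.values_nonempty _)) ?_
    rintro _ ⟨_, ⟨g₁, hg₁, rfl⟩, _, ⟨g₂, hg₂, rfl⟩, rfl⟩
    refine le_csSup (μ.values_bddAbove _) ⟨g₁ + g₂, add_le_add hg₁ hg₂, ?_⟩
    simp

theorem sSup_values_smul_le (μ : LocalRadonMeasure X) {a : ℝ≥0} (ha : a ≠ 0) (f : C_c(X, ℝ≥0)) :
    a * sSup (μ.values f) ≤ sSup (μ.values (a • f)) := by
  have ha' : (0 : ℝ) < a := NNReal.coe_pos.mpr (pos_iff_ne_zero.mpr ha)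
  rw [← le_div_iff₀' ha']
  refine csSup_le (μ.values_nonempty _) ?_
  rintro _ ⟨g, hg, rfl⟩
  rw [le_div_iff₀' ha']
  refine le_csSup (μ.values_bddAbove _) ⟨a • g, fun x => ?_, ?_⟩
  · exact mul_le_mul_right (hg x) a
  · rw [CompactlySupportedContinuousMap.toReal_smul]
    exact ((μ.toLinearMap.map_smul (a : ℝ) g.toReal)).symm

theorem sSup_values_smul (μ : LocalRadonMeasure X) (a : ℝ≥0) (f : C_c(X, ℝ≥0)) :
    sSup (μ.values (a • f)) = a * sSup (μ.values f) := by
  rcases eq_or_ne a 0 with rfl | ha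
  · have h := μ.sSup_values_add 0 0
    simp only [add_zero] at h
    rw [zero_smul, NNReal.coe_zero, zero_mul]
    linarith
  · refine le_antisymm ?_ (μ.sSup_values_smul_le ha f)
    have h := μ.sSup_values_smul_le (inv_ne_zero ha) (a • f)
    rw [smul_smul, inv_mul_cancel₀ ha, one_smul, NNReal.coe_inv] at h
    have ha' : (0 : ℝ) < a := NNReal.coe_pos.mpr (pos_iff_ne_zero.mpr ha)
    rwa [inv_mul_le_iff₀ ha'] at h

/-- The positive part of `μ` as a positive functional: `μ⁺(f) = sup {μ(g) : 0 ≤ g ≤ f}`. -/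
noncomputable def posPart (μ : LocalRadonMeasure X) : C_c(X, ℝ≥0) →ₗ[ℝ≥0] ℝ≥0 where
  toFun f := ⟨sSup (μ.values f), μ.sSup_values_nonneg f⟩
  map_add' f₁ f₂ := NNReal.eq (μ.sSup_values_add f₁ f₂)
  map_smul' a f := NNReal.eq (μ.sSup_values_smul a f)

theorem posPart_apply (μ : LocalRadonMeasure X) (f : C_c(X, ℝ≥0)) :
    (μ.posPart f : ℝ) = sSup (μ.values f) := rfl

theorem apply_eq_posPart_sub (μ : LocalRadonMeasure X) (f : C_c(X, ℝ≥0)) :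
    μ.toLinearMap f.toReal = μ.posPart f - (-μ).posPart f := by
  have key : ∀ ν : LocalRadonMeasure X,
      ((-ν).posPart f : ℝ) ≤ ν.posPart f - ν.toLinearMap f.toReal := by
    intro ν
    refine csSup_le ((-ν).values_nonempty _) ?_
    rintro _ ⟨g, hg, rfl⟩
    obtain ⟨h, rfl⟩ := CompactlySupportedContinuousMap.exists_add_of_le hg
    have h1 : ν.toLinearMap h.toReal ≤ ν.posPart (g + h) := by
      refine le_csSup (ν.values_bddAbove _) ⟨h, fun x => ?_, rfl⟩
      exact le_add_of_nonneg_left zero_le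
    have h2 : (-ν).toLinearMap g.toReal = -ν.toLinearMap g.toReal := rfl
    rw [CompactlySupportedContinuousMap.toReal_add, map_add ν.toLinearMap, h2]
    linarith
  have h1 := key μ
  have h2 := key (-μ)
  have h3 := μ.neg_neg
  have h4 : (-μ).toLinearMap f.toReal = -μ.toLinearMap f.toReal := rfl
  rw [h3, h4] at h2
  linarith

end Functional

section Measure

variable {X : Type*} [TopologicalSpace X] [T2Space X] [LocallyCompactSpace X]
  [MeasurableSpace X] [BorelSpace X]

/-- The positive Radon measure `μ⁺` of the Jordan decomposition `μ = μ⁺ - μ⁻`. -/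
noncomputable def pos (μ : LocalRadonMeasure X) : Measure X := NNRealRMK.rieszMeasure μ.posPart

/-- The positive Radon measure `μ⁻` of the Jordan decomposition `μ = μ⁺ - μ⁻`. -/
noncomputable def neg (μ : LocalRadonMeasure X) : Measure X := NNRealRMK.rieszMeasure (-μ).posPart

/-- The total variation `|μ| = μ⁺ + μ⁻`. -/
noncomputable def abs (μ : LocalRadonMeasure X) : Measure X := μ.pos + μ.neg

/-- The integral `∫ f dμ = ∫ f dμ⁺ - ∫ f dμ⁻`. -/
noncomputable def integral (μ : LocalRadonMeasure X) (f : X → ℝ) : ℝ :=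
  ∫ x, f x ∂μ.pos - ∫ x, f x ∂μ.neg

instance (μ : LocalRadonMeasure X) : μ.pos.Regular :=
  inferInstanceAs (NNRealRMK.rieszMeasure μ.posPart).Regular

instance (μ : LocalRadonMeasure X) : μ.neg.Regular :=
  inferInstanceAs (NNRealRMK.rieszMeasure (-μ).posPart).Regular

theorem integral_neg (μ : LocalRadonMeasure X) (f : X → ℝ) :
    (-μ).integral f = -μ.integral f := by
  simp only [integral, pos, neg, μ.neg_neg, neg_sub]

/-- On `C_c(X)` the integral is the functional itself. -/
theorem integral_eq (μ : LocalRadonMeasure X) (f : C_c(X, ℝ)) :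
    μ.integral f = μ.toLinearMap f := by
  have h : ∀ g : C_c(X, ℝ≥0), μ.integral g.toReal = μ.toLinearMap g.toReal := by
    intro g
    simp only [integral, pos, neg, CompactlySupportedContinuousMap.toReal_apply,
      NNRealRMK.integral_rieszMeasure]
    exact (μ.apply_eq_posPart_sub g).symm
  have h1 := h f.nnrealPart
  have h2 := h (-f).nnrealPart
  have h3 := CompactlySupportedContinuousMap.nnrealPart_sub_nnrealPart_neg f
  have i1 : ∀ g : C_c(X, ℝ), Integrable g μ.pos := fun g =>
    g.continuous.integrable_of_hasCompactSupport g.hasCompactSupport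
  have i2 : ∀ g : C_c(X, ℝ), Integrable g μ.neg := fun g =>
    g.continuous.integrable_of_hasCompactSupport g.hasCompactSupport
  rw [← h3, map_sub, ← h1, ← h2]
  simp only [integral, CompactlySupportedContinuousMap.coe_sub, Pi.sub_apply]
  rw [integral_sub (i1 _) (i1 _), integral_sub (i2 _) (i2 _)]
  ring

end Measure

end LocalRadonMeasure

/-! ### The half-space `ℝ^N_+ = ℝ^n × (0, ∞)`, where `N = n + 1` -/

/-- The open half-space, as a subset of `ℝ^N = ℝ^n × ℝ`; points are written `x = (x', x_N)`. -/
def halfSpace (n : ℕ) : Set (EuclideanSpace ℝ (Fin n) × ℝ) := {x | 0 < x.2}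

theorem isOpen_halfSpace (n : ℕ) : IsOpen (halfSpace n) :=
  isOpen_lt continuous_const continuous_snd

instance (n : ℕ) : LocallyCompactSpace (halfSpace n) :=
  (isOpen_halfSpace n).locallyCompactSpace

/-- `μ ∈ M_loc(closure of ℝ^N_+, x_N)`: the local Radon measure `μ` on `ℝ^N_+` satisfies
`∫_Ω x_N d|μ| < ∞` for every bounded `Ω ⊆ ℝ^N_+`. -/
def LocalRadonMeasure.MemWeighted {n : ℕ} (μ : LocalRadonMeasure (halfSpace n)) : Prop :=
  ∀ Ω : Set (halfSpace n), Bornology.IsBounded Ω →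
    ∫⁻ x in Ω, ENNReal.ofReal (x : EuclideanSpace ℝ (Fin n) × ℝ).2 ∂μ.abs < ⊤

/-- `u ∈ L¹_loc(closure of ℝ^N_+)`: `u` is integrable on every bounded open subset of `ℝ^N_+`. -/
def MemL1LocUpToBoundary {n : ℕ} (u : EuclideanSpace ℝ (Fin n) × ℝ → ℝ) : Prop :=
  ∀ Ω : Set (EuclideanSpace ℝ (Fin n) × ℝ), IsOpen Ω → Bornology.IsBounded Ω →
    Ω ⊆ halfSpace n → IntegrableOn u Ω

/-- The Laplacian on `ℝ^N = ℝ^n × ℝ`: the Laplacian in `x'` plus `∂²/∂x_N²`. -/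
noncomputable def laplacianProd {n : ℕ} (φ : EuclideanSpace ℝ (Fin n) × ℝ → ℝ)
    (x : EuclideanSpace ℝ (Fin n) × ℝ) : ℝ :=
  Laplacian.laplacian (fun y : EuclideanSpace ℝ (Fin n) => φ (y, x.2)) x.1 +
    iteratedDeriv 2 (fun t : ℝ => φ (x.1, t)) x.2

/-- `φ` is a test function: `φ ∈ C²_c(ℝ^N)` and `φ(x', 0) = 0`. -/
def IsTestFunction {n : ℕ} (φ : EuclideanSpace ℝ (Fin n) × ℝ → ℝ) : Prop :=
  ContDiff ℝ 2 φ ∧ HasCompactSupport φ ∧ ∀ x' : EuclideanSpace ℝ (Fin n), φ (x', 0) = 0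

/-- `u` is a weak solution of `-Δu = μ` in `ℝ^N_+`, `u = ν` on `∂ℝ^N_+ = ℝ^n`. -/
def IsWeakSolution {n : ℕ} (μ : LocalRadonMeasure (halfSpace n))
    (ν : LocalRadonMeasure (EuclideanSpace ℝ (Fin n)))
    (u : EuclideanSpace ℝ (Fin n) × ℝ → ℝ) : Prop :=
  MemL1LocUpToBoundary u ∧ ∀ φ : EuclideanSpace ℝ (Fin n) × ℝ → ℝ, IsTestFunction φ →
    μ.integral (fun x => φ x) + ν.integral (fun x' => deriv (fun t : ℝ => φ (x', t)) 0) =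
      ∫ x in halfSpace n, u x * -laplacianProd φ x

/-! ### Sobolev functions, Sobolev traces and the lim-trace -/

/-- `G` is the weak (distributional) differential of `u` on `ℝ^N_+`. -/
def IsWeakFDeriv {n : ℕ} (u : EuclideanSpace ℝ (Fin n) × ℝ → ℝ)
    (G : EuclideanSpace ℝ (Fin n) × ℝ → (EuclideanSpace ℝ (Fin n) × ℝ →L[ℝ] ℝ)) : Prop :=
  LocallyIntegrableOn u (halfSpace n) ∧ LocallyIntegrableOn G (halfSpace n) ∧
    ∀ φ : EuclideanSpace ℝ (Fin n) × ℝ → ℝ, ContDiff ℝ ∞ φ → HasCompactSupport φ →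
      tsupport φ ⊆ halfSpace n → ∀ v : EuclideanSpace ℝ (Fin n) × ℝ,
        ∫ x in halfSpace n, u x * fderiv ℝ φ x v = -∫ x in halfSpace n, G x v * φ x

/-- `u ∈ W^{1,p}_loc(ℝ^N_+)`. -/
def MemW1Loc {n : ℕ} (p : ℝ≥0) (u : EuclideanSpace ℝ (Fin n) × ℝ → ℝ) : Prop :=
  ∃ G : EuclideanSpace ℝ (Fin n) × ℝ → (EuclideanSpace ℝ (Fin n) × ℝ →L[ℝ] ℝ),
    IsWeakFDeriv u G ∧ ∀ K : Set (EuclideanSpace ℝ (Fin n) × ℝ), IsCompact K → K ⊆ halfSpace n →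
      MemLp u p (volume.restrict K) ∧ MemLp G p (volume.restrict K)

/-- `w` is the Sobolev trace of `u ∈ W^{1,p}_loc(ℝ^N_+)` on the hyperplane `x_N = ε`: on each
cylinder `Q = B'_R × (ε, ε + 1)`, `w` is the `L^p(B'_R)` limit of the restrictions `v_k(·, ε)` of
smooth functions `v_k` that converge to `u` in `W^{1,p}(Q)`. -/
def IsSobolevTrace {n : ℕ} (p : ℝ≥0) (u : EuclideanSpace ℝ (Fin n) × ℝ → ℝ) (ε : ℝ)
    (w : EuclideanSpace ℝ (Fin n) → ℝ) : Prop :=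
  ∃ G : EuclideanSpace ℝ (Fin n) × ℝ → (EuclideanSpace ℝ (Fin n) × ℝ →L[ℝ] ℝ),
    IsWeakFDeriv u G ∧ ∀ R : ℝ, 0 < R →
      MemLp w p (volume.restrict (Metric.ball 0 R)) ∧
      ∃ v : ℕ → EuclideanSpace ℝ (Fin n) × ℝ → ℝ, (∀ k, ContDiff ℝ ∞ (v k)) ∧
        Tendsto (fun k => eLpNorm (fun x => v k x - u x) p
          (volume.restrict (Metric.ball 0 R ×ˢ Set.Ioo ε (ε + 1)))) atTop (𝓝 0) ∧
        Tendsto (fun k => eLpNorm (fun x => fderiv ℝ (v k) x - G x) p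
          (volume.restrict (Metric.ball 0 R ×ˢ Set.Ioo ε (ε + 1)))) atTop (𝓝 0) ∧
        Tendsto (fun k => eLpNorm (fun x' => v k (x', ε) - w x') p
          (volume.restrict (Metric.ball 0 R))) atTop (𝓝 0)

/-- `ν` is the lim-trace of `u` on `∂ℝ^N_+`, written `ν = Tr(u)`: `u ∈ W^{1,p}_loc(ℝ^N_+)` for some
`p > 1`, and the Sobolev traces `u(·, ε)` converge to `ν` as `ε → 0⁺` against `C²_c` functions. -/
def IsLimTrace {n : ℕ} (u : EuclideanSpace ℝ (Fin n) × ℝ → ℝ)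
    (ν : LocalRadonMeasure (EuclideanSpace ℝ (Fin n))) : Prop :=
  ∃ p : ℝ≥0, 1 < p ∧ MemW1Loc p u ∧
    ∃ w : ℝ → EuclideanSpace ℝ (Fin n) → ℝ, (∀ ε : ℝ, 0 < ε → IsSobolevTrace p u ε (w ε)) ∧
      ∀ ψ : EuclideanSpace ℝ (Fin n) → ℝ, ContDiff ℝ 2 ψ → HasCompactSupport ψ →
        Tendsto (fun ε : ℝ => ∫ x', ψ x' * w ε x') (𝓝[>] 0) (𝓝 (ν.integral ψ))

/-! Two facts are combined: regularity of `u` in the interior, and the weak equation tested with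
products `ψ(x') η(x_N)` concentrated near the boundary.

Interior. Away from the boundary `|μ|` is locally finite and `u` is locally integrable. Consider the
regularised, cut-off fundamental solution (up to a constant factor) whose gradient is `χ(|z|²) (|z|²
+ e)^(-N/2) z`. Its Laplacian is an approximate identity plus a remainder that lives where `χ' ≠ 0`.
Testing with its translates expresses the mollification of `u` through potentials of `μ⁺` and `μ⁻`
and a convolution of `u` with the remainder (`IsWeakSolution.measureConv_massKernel`). The potential
and remainder kernels and their gradients are dominated by `C |z|^(-n)`, `n = N - 1`, which is
locally in `L^p` for `p < (n + 1) / n`; by Young's inequality the mollifications converge in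
`W^{1,p}`, and the limit must be `u` (`IsWeakSolution.exists_local_approx`). Uniqueness of weak
gradients glues the local gradients (`IsWeakSolution.exists_gradient`).

Boundary. Let `θ ≥ 0` have integral one and support in `(0, b)`, and let `η` be a cut-off of the
function `h` with `h'' = θ`, `h(0) = 0`, `h'(0) = -1`. In the half-space `Δ(ψη) = ψθ + O(b)`, the
boundary term is `-∫ ψ dν`, and `|η| ≤ min(x_N, b)`, so the `μ`-term is at most a constant times `∫
min(x_N, b) d|μ|` over a ball, which tends to zero because `x_N` is `|μ|`-integrable there. Hence
the `θ`-average of `∫ ψ u(·, t) dx'` is close to `∫ ψ dν` (`IsWeakSolution.exists_average_bound`).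

Conclusion. For `θ` supported in `(ε, ε + δ)`, the trace on `x_N = ε` and this average differ by at
most `C ∫ |∇u|` over a cylinder of height `δ`
(`LocallyApproximable.abs_integral_trace_sub_average_le`). Since `δ` is chosen after `ε`, this error
can be made at most `ε` without any control of `∇u` up to the boundary. -/

section ConvolutionEstimates

/-! ### Jensen, Young and convolution with finite measures -/

open ENNReal

variable {α β : Type*} [MeasurableSpace α] [MeasurableSpace β]

theorem lintegral_rpow_le_measure_univ_mul {m : Measure β} {p : ℝ} (hp : 1 ≤ p) {f : β → ℝ≥0∞}
    (hf : AEMeasurable f m) :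
    (∫⁻ y, f y ∂m) ^ p ≤ m Set.univ ^ (p - 1) * ∫⁻ y, f y ^ p ∂m := by
  have hp0 : 0 < p := by linarith
  rcases hp.eq_or_lt with rfl | hp1
  · simp
  have h := ENNReal.lintegral_mul_le_Lp_mul_Lq m (Real.HolderConjugate.conjExponent hp1) hf
    (aemeasurable_const (b := (1 : ℝ≥0∞)))
  simp only [Pi.mul_apply, mul_one, ENNReal.one_rpow, lintegral_const, one_mul] at h
  refine (ENNReal.rpow_le_rpow h hp0.le).trans_eq ?_
  rw [ENNReal.mul_rpow_of_nonneg _ _ hp0.le, ← ENNReal.rpow_mul, ← ENNReal.rpow_mul,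
    one_div_mul_cancel hp0.ne', ENNReal.rpow_one, mul_comm]
  congr 2
  rw [Real.conjExponent]
  field_simp

/-- Hölder's inequality on almost every slice. Allowing `m` arbitrary total mass makes this serve
both averages over a probability measure and the measure `|f| dm` in Young's inequality. -/
theorem lintegral_lintegral_rpow_le {μ : Measure α} {m : Measure β} [SFinite m] {p : ℝ}
    (hp : 1 ≤ p) {f : α × β → ℝ≥0∞} (hf : AEMeasurable f (μ.prod m)) :
    ∫⁻ x, (∫⁻ y, f (x, y) ∂m) ^ p ∂μ ≤
      m Set.univ ^ (p - 1) * ∫⁻ x, ∫⁻ y, f (x, y) ^ p ∂m ∂μ := by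
  rcases eq_or_ne m 0 with rfl | hm
  · simp [show 0 < p by linarith]
  calc ∫⁻ x, (∫⁻ y, f (x, y) ∂m) ^ p ∂μ
      ≤ ∫⁻ x, m Set.univ ^ (p - 1) * ∫⁻ y, f (x, y) ^ p ∂m ∂μ := by
        refine lintegral_mono_ae ?_
        filter_upwards [Measure.ae_ae_of_ae_prod hf.ae_eq_mk] with x hx
        exact lintegral_rpow_le_measure_univ_mul hp
          ⟨fun y => hf.mk f (x, y), hf.measurable_mk.comp measurable_prodMk_left, hx⟩
    _ = _ := by
        rw [lintegral_const_mul'']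
        exact (hf.pow_const p).lintegral_prod_right'

/-- Jensen's inequality for the average of a function over the second variable. -/
theorem eLpNorm_integral_prod_le {F : Type*} [NormedAddCommGroup F] [NormedSpace ℝ F]
    {μ : Measure α} {m : Measure β} [SFinite μ] [IsProbabilityMeasure m] {p : ℝ≥0} (hp : 1 ≤ p)
    {f : α × β → F} (hf : AEStronglyMeasurable f (μ.prod m)) :
    eLpNorm (fun x => ∫ y, f (x, y) ∂m) p μ ≤ eLpNorm f p (μ.prod m) := by
  have hp0 : p ≠ 0 := (zero_lt_one.trans_le hp).ne'
  rw [← ENNReal.rpow_le_rpow_iff (z := p) (by positivity), eLpNorm_nnreal_pow_eq_lintegral hp0,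
    eLpNorm_nnreal_pow_eq_lintegral hp0, lintegral_prod _ (hf.enorm.pow_const _)]
  calc ∫⁻ x, ‖∫ y, f (x, y) ∂m‖ₑ ^ (p : ℝ) ∂μ
      ≤ ∫⁻ x, (∫⁻ y, ‖f (x, y)‖ₑ ∂m) ^ (p : ℝ) ∂μ :=
        lintegral_mono fun x => by gcongr; exact enorm_integral_le_lintegral_enorm _
    _ ≤ _ := by simpa using lintegral_lintegral_rpow_le (by exact_mod_cast hp) hf.enorm

variable {E F : Type*} [NormedAddCommGroup E] [NormedSpace ℝ E] [FiniteDimensional ℝ E]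
  [MeasurableSpace E] [BorelSpace E] [NormedAddCommGroup F] [NormedSpace ℝ F]

/-- The convolution of the kernel `g` with the measure `f dm`. -/
noncomputable def measureConv (m : Measure E) (f : E → ℝ) (g : E → F) (x : E) : F :=
  ∫ y, f y • g (x - y) ∂m

theorem integrable_measureConv {m : Measure E} {f : E → ℝ} (hf : Integrable f m) {g : E → F}
    (hg : Continuous g) (hgc : HasCompactSupport g) (x : E) :
    Integrable (fun y => f y • g (x - y)) m := by
  obtain ⟨C, hC⟩ := hgc.exists_bound_of_continuous hg
  refine hf.smul_bdd C (hg.comp (continuous_const.sub continuous_id)).aestronglyMeasurable ?_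
  filter_upwards with y using hC _

theorem measureConv_sub {m : Measure E} {f : E → ℝ} (hf : Integrable f m) {g₁ g₂ : E → F}
    (hg₁ : Continuous g₁) (hgc₁ : HasCompactSupport g₁) (hg₂ : Continuous g₂)
    (hgc₂ : HasCompactSupport g₂) :
    measureConv m f g₁ - measureConv m f g₂ = measureConv m f (g₁ - g₂) := by
  ext x
  simp only [measureConv, Pi.sub_apply, smul_sub]
  rw [integral_sub (integrable_measureConv hf hg₁ hgc₁ x) (integrable_measureConv hf hg₂ hgc₂ x)]

theorem hasFDerivAt_measureConv {m : Measure E} {f : E → ℝ} (hf : Integrable f m) {g : E → F}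
    (hg : ContDiff ℝ 1 g) (hgc : HasCompactSupport g) (x : E) :
    HasFDerivAt (measureConv m f g) (measureConv m f (fderiv ℝ g) x) x := by
  have hg' : Continuous (fderiv ℝ g) := hg.continuous_fderiv one_ne_zero
  obtain ⟨C, hC⟩ := (hgc.fderiv ℝ).exists_bound_of_continuous hg'
  refine hasFDerivAt_integral_of_dominated_of_fderiv_le (bound := fun y => ‖f y‖ * C)
    (F' := fun x y => f y • fderiv ℝ g (x - y)) Filter.univ_mem
    (Eventually.of_forall fun x => (integrable_measureConv hf hg.continuous hgc x).1)
    (integrable_measureConv hf hg.continuous hgc x)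
    (integrable_measureConv hf hg' (hgc.fderiv ℝ) x).1 ?_ (hf.norm.mul_const C) ?_
  · filter_upwards with y x _
    rw [norm_smul]
    gcongr
    exact hC _
  · filter_upwards with y x _
    refine HasFDerivAt.const_smul ?_ (f y)
    have h1 := ((hg.differentiable one_ne_zero) (x - y)).hasFDerivAt
    simpa using! h1.comp x ((hasFDerivAt_id x).sub (hasFDerivAt_const y x))

theorem continuous_measureConv {m : Measure E} {f : E → ℝ} (hf : Integrable f m) {g : E → F}
    (hg : Continuous g) (hgc : HasCompactSupport g) : Continuous (measureConv m f g) := by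
  obtain ⟨C, hC⟩ := hgc.exists_bound_of_continuous hg
  refine continuous_of_dominated (bound := fun y => ‖f y‖ * C)
    (fun x => (integrable_measureConv hf hg hgc x).1) (fun x => ?_) (hf.norm.mul_const C) ?_
  · filter_upwards with y
    rw [norm_smul]
    gcongr
    exact hC _
  · filter_upwards with y
    fun_prop

/-- Young's inequality for the convolution of a function with a finite measure. -/
theorem eLpNorm_measureConv_le {m : Measure E} [SFinite m] {f : E → ℝ} (hf : Integrable f m)
    {μ : Measure E} [μ.IsAddRightInvariant] [SFinite μ] {g : E → F} (hg : Continuous g) {p : ℝ≥0}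
    (hp : 1 ≤ p) :
    eLpNorm (measureConv m f g) p μ ≤ (∫⁻ y, ‖f y‖ₑ ∂m) * eLpNorm g p μ := by
  have hp0 : p ≠ 0 := (zero_lt_one.trans_le hp).ne'
  have hp1 : (1 : ℝ) ≤ p := by exact_mod_cast hp
  -- Absorbing `|f|` into the measure leaves Hölder on a space of mass `∫ |f| dm`, then Tonelli and
  -- translation invariance of `μ`. The powers `p - 1` and `1` of the mass add up to `p`.
  set m' := m.withDensity fun y => ‖f y‖ₑ
  have hu : m' Set.univ = ∫⁻ y, ‖f y‖ₑ ∂m := by simp [m']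
  have hmeas : ∀ x, Measurable fun y => ‖g (x - y)‖ₑ := fun x =>
    (hg.comp (continuous_const.sub continuous_id)).enorm.measurable
  have hmeas2 : Measurable fun z : E × E => ‖g (z.1 - z.2)‖ₑ :=
    (hg.comp (continuous_fst.sub continuous_snd)).enorm.measurable
  rw [← ENNReal.rpow_le_rpow_iff (z := p) (by positivity),
    ENNReal.mul_rpow_of_nonneg _ _ (by positivity), eLpNorm_nnreal_pow_eq_lintegral hp0,
    eLpNorm_nnreal_pow_eq_lintegral hp0]
  calc ∫⁻ x, ‖measureConv m f g x‖ₑ ^ (p : ℝ) ∂μ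
      ≤ ∫⁻ x, (∫⁻ y, ‖g (x - y)‖ₑ ∂m') ^ (p : ℝ) ∂μ := by
        refine lintegral_mono fun x => ?_
        gcongr
        refine (enorm_integral_le_lintegral_enorm _).trans_eq ?_
        rw [lintegral_withDensity_eq_lintegral_mul₀ hf.1.enorm (hmeas x).aemeasurable]
        simp only [enorm_smul, Pi.mul_apply]
    _ ≤ m' Set.univ ^ ((p : ℝ) - 1) * ∫⁻ x, ∫⁻ y, ‖g (x - y)‖ₑ ^ (p : ℝ) ∂m' ∂μ :=
        lintegral_lintegral_rpow_le hp1 (f := fun z => ‖g (z.1 - z.2)‖ₑ) hmeas2.aemeasurable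
    _ = m' Set.univ ^ ((p : ℝ) - 1) * ∫⁻ y, ∫⁻ x, ‖g (x - y)‖ₑ ^ (p : ℝ) ∂μ ∂m' := by
        rw [lintegral_lintegral_swap]
        exact (hmeas2.pow_const _).aemeasurable
    _ = (∫⁻ y, ‖f y‖ₑ ∂m) ^ (p : ℝ) * ∫⁻ x, ‖g x‖ₑ ^ (p : ℝ) ∂μ := by
        have : ∀ y, ∫⁻ x, ‖g (x - y)‖ₑ ^ (p : ℝ) ∂μ = ∫⁻ x, ‖g x‖ₑ ^ (p : ℝ) ∂μ := fun y =>
          lintegral_sub_right_eq_self (fun x => ‖g x‖ₑ ^ (p : ℝ)) y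
        simp only [this, lintegral_const, hu]
        rw [mul_comm (∫⁻ x, ‖g x‖ₑ ^ (p : ℝ) ∂μ), ← mul_assoc]
        congr 1
        nth_rewrite 2 [← ENNReal.rpow_one (∫⁻ y, ‖f y‖ₑ ∂m)]
        rw [← ENNReal.rpow_add_of_nonneg _ _ (by linarith) zero_le_one, sub_add_cancel]

/-- Dominated convergence in `L^p`. -/
theorem tendsto_eLpNorm_sub_of_dominated {F : Type*} [NormedAddCommGroup F] {μ : Measure α} {p : ℝ≥0} (hp : 1 ≤ p) {g : ℕ → α → F}
    {g' : α → F} (hg : ∀ k, AEStronglyMeasurable (g k) μ) {B : α → ℝ} (hB : MemLp B p μ)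
    (hgB : ∀ k, ∀ᵐ x ∂μ, ‖g k x‖ ≤ B x)
    (hlim : ∀ᵐ x ∂μ, Tendsto (fun k => g k x) atTop (𝓝 (g' x))) :
    Tendsto (fun k => eLpNorm (g k - g') p μ) atTop (𝓝 0) := by
  have hp0 : p ≠ 0 := (zero_lt_one.trans_le hp).ne'
  have hpr : (0 : ℝ) < p := by positivity
  have hg' : AEStronglyMeasurable g' μ := aestronglyMeasurable_of_tendsto_ae _ hg hlim
  have key : Tendsto (fun k => ∫⁻ x, ‖g k x - g' x‖ₑ ^ (p : ℝ) ∂μ) atTop (𝓝 0) := by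
    have h := tendsto_lintegral_of_dominated_convergence' (μ := μ)
      (F := fun k x => ‖g k x - g' x‖ₑ ^ (p : ℝ)) (f := fun _ => 0)
      (fun x => (2 * ‖B x‖ₑ) ^ (p : ℝ)) (fun k => ((hg k).sub hg').enorm.pow_const _) ?_ ?_ ?_
    · simpa using h
    · intro k
      filter_upwards [ae_all_iff.2 hgB, hlim] with x hx hx'
      have h1 : ‖g' x‖ ≤ B x := le_of_tendsto hx'.norm (Eventually.of_forall fun k => hx k)
      gcongr
      refine enorm_sub_le.trans ?_
      rw [two_mul]
      gcongr
      · exact enorm_le_iff_norm_le.2 ((hx k).trans (le_abs_self _))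
      · exact enorm_le_iff_norm_le.2 (h1.trans (le_abs_self _))
    · simp_rw [ENNReal.mul_rpow_of_nonneg _ _ hpr.le]
      rw [lintegral_const_mul' _ _ (by simp), ← eLpNorm_nnreal_pow_eq_lintegral hp0]
      exact ENNReal.mul_ne_top (by simp) (by simp [hB.2.ne])
    · filter_upwards [hlim] with x hx
      have h1 : Tendsto (fun k => ‖g k x - g' x‖ₑ) atTop (𝓝 0) := by
        have := (hx.sub_const (g' x)).enorm
        simpa using this
      have h2 := h1.ennrpow_const (p : ℝ)
      simpa [hpr] using h2
  have h3 := key.ennrpow_const (1 / (p : ℝ))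
  rw [ENNReal.zero_rpow_of_pos (by positivity)] at h3
  refine h3.congr fun k => ?_
  rw [eLpNorm_eq_lintegral_rpow_enorm_toReal (by exact_mod_cast hp0) ENNReal.coe_ne_top]
  simp

/-- Convolutions with kernels that converge in `L^p` converge in `L^p`. -/
theorem exists_tendsto_measureConv [CompleteSpace F] {m : Measure E} [SFinite m] {f : E → ℝ}
    (hf : Integrable f m) {μ : Measure E} [μ.IsAddHaarMeasure] {g : ℕ → E → F}
    {g' : E → F} (hg : ∀ k, Continuous (g k)) (hgc : ∀ k, HasCompactSupport (g k)) {p : ℝ≥0}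
    (hp : 1 ≤ p) (hlim : Tendsto (fun k => eLpNorm (g k - g') p μ) atTop (𝓝 0))
    (hg' : AEStronglyMeasurable g' μ) :
    ∃ L : E → F, MemLp L p μ ∧
      Tendsto (fun k => eLpNorm (measureConv m f (g k) - L) p μ) atTop (𝓝 0) := by
  have : Fact ((1 : ℝ≥0∞) ≤ p) := ⟨by exact_mod_cast hp⟩
  have hmem : ∀ k, MemLp (measureConv m f (g k)) p μ := fun k =>
    ⟨(continuous_measureConv hf (hg k) (hgc k)).aestronglyMeasurable,
      (eLpNorm_measureConv_le hf (hg k) hp).trans_lt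
        (ENNReal.mul_lt_top hf.2 ((hg k).memLp_of_hasCompactSupport (hgc k)).2)⟩
  have hA : (∫⁻ y, ‖f y‖ₑ ∂m) ≠ ⊤ := hf.2.ne
  -- The limit kernel is singular in the applications, so its convolution is never formed. Young's
  -- inequality for differences of kernels makes the convolutions Cauchy, and completeness supplies
  -- `L`.
  have hcau : CauchySeq fun k => (hmem k).toLp (measureConv m f (g k)) := by
    rw [Lp.cauchySeq_Lp_iff_cauchySeq_eLpNorm]
    have h1 : Tendsto (fun n : ℕ × ℕ => (∫⁻ y, ‖f y‖ₑ ∂m) *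
        (eLpNorm (g n.1 - g') p μ + eLpNorm (g n.2 - g') p μ)) atTop (𝓝 0) := by
      have h0 : Tendsto (Prod.fst : ℕ × ℕ → ℕ) atTop atTop := by
        rw [← prod_atTop_atTop_eq]; exact tendsto_fst
      have h0' : Tendsto (Prod.snd : ℕ × ℕ → ℕ) atTop atTop := by
        rw [← prod_atTop_atTop_eq]; exact tendsto_snd
      have h2 := (hlim.comp h0).add (hlim.comp h0')
      have h3 := ENNReal.Tendsto.const_mul h2 (Or.inr hA)
      simpa using h3
    refine tendsto_of_tendsto_of_tendsto_of_le_of_le tendsto_const_nhds h1 (fun _ => zero_le)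
      fun n => ?_
    have h4 : eLpNorm (⇑((hmem n.1).toLp _) - ⇑((hmem n.2).toLp _)) p μ =
        eLpNorm (measureConv m f (g n.1) - measureConv m f (g n.2)) p μ :=
      eLpNorm_congr_ae ((hmem n.1).coeFn_toLp.sub (hmem n.2).coeFn_toLp)
    simp only [h4]
    rw [measureConv_sub hf (hg _) (hgc _) (hg _) (hgc _)]
    refine (eLpNorm_measureConv_le hf ((hg _).sub (hg _)) hp).trans ?_
    gcongr
    have h5 : g n.1 - g n.2 = (g n.1 - g') - (g n.2 - g') := by abel
    rw [h5]
    exact eLpNorm_sub_le ((hg _).aestronglyMeasurable.sub hg')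
      ((hg _).aestronglyMeasurable.sub hg') (by exact_mod_cast hp)
  obtain ⟨L, hL⟩ := cauchySeq_tendsto_of_complete hcau
  refine ⟨L, Lp.memLp L, ?_⟩
  rw [Lp.tendsto_Lp_iff_tendsto_eLpNorm'] at hL
  refine hL.congr fun k => eLpNorm_congr_ae ((hmem k).coeFn_toLp.sub EventuallyEq.rfl)

end ConvolutionEstimates

/-! ### Functions of the Euclidean norm on `ℝ^n × ℝ` -/

section RadialFunctions

/-- The space `ℝ^N = ℝ^n × ℝ`. -/
abbrev AmbientSpace (n : ℕ) : Type := EuclideanSpace ℝ (Fin n) × ℝ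

variable {n : ℕ}

/-- The square of the Euclidean norm on `ℝ^n × ℝ`. -/
noncomputable def sqNorm (z : AmbientSpace n) : ℝ := ‖z.1‖ ^ 2 + z.2 ^ 2

/-- The Euclidean inner product with `z` on `ℝ^n × ℝ`. -/
noncomputable def prodInner (z : AmbientSpace n) : AmbientSpace n →L[ℝ] ℝ :=
  (innerSL ℝ z.1).comp (ContinuousLinearMap.fst ℝ _ _) + z.2 • ContinuousLinearMap.snd ℝ _ _

theorem sqNorm_nonneg (z : AmbientSpace n) : 0 ≤ sqNorm z := by
  unfold sqNorm; positivity

/-- The norm of a product space is the maximum norm, so this is only an inequality. It is the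
direction needed to bound negative powers of `sqNorm` by powers of `‖z‖`. -/
theorem norm_sq_le_sqNorm (z : AmbientSpace n) : ‖z‖ ^ 2 ≤ sqNorm z := by
  unfold sqNorm
  rw [Prod.norm_def]
  rcases le_total ‖z.1‖ ‖z.2‖ with h | h
  · rw [max_eq_right h, Real.norm_eq_abs, sq_abs]
    nlinarith [sq_nonneg ‖z.1‖]
  · rw [max_eq_left h]
    nlinarith [sq_nonneg z.2]

theorem sqNorm_pos {z : AmbientSpace n} (hz : z ≠ 0) : 0 < sqNorm z :=
  (by positivity : 0 < ‖z‖ ^ 2).trans_le (norm_sq_le_sqNorm z)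

theorem sqNorm_smul (c : ℝ) (z : AmbientSpace n) : sqNorm (c • z) = c ^ 2 * sqNorm z := by
  simp only [sqNorm, Prod.smul_fst, Prod.smul_snd, norm_smul, smul_eq_mul, Real.norm_eq_abs,
    mul_pow, sq_abs]
  ring

theorem norm_le_one_of_sqNorm_le {z : AmbientSpace n} (hz : sqNorm z ≤ 1) : ‖z‖ ≤ 1 := by
  have := norm_sq_le_sqNorm z
  nlinarith [norm_nonneg z]

theorem contDiff_sqNorm {m : WithTop ℕ∞} : ContDiff ℝ m (sqNorm : AmbientSpace n → ℝ) :=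
  (contDiff_fst.norm_sq ℝ).add (contDiff_snd.pow 2)

theorem hasFDerivAt_sqNorm (z : AmbientSpace n) :
    HasFDerivAt sqNorm ((2 : ℝ) • prodInner z) z := by
  have h1 : HasFDerivAt (fun z : AmbientSpace n => ‖z.1‖ ^ 2) _ z :=
    (hasStrictFDerivAt_norm_sq z.1).hasFDerivAt.comp z hasFDerivAt_fst
  have h2 : HasFDerivAt (fun z : AmbientSpace n => z.2 ^ 2) _ z :=
    (hasFDerivAt_snd (𝕜 := ℝ) (p := z)).pow 2
  refine (h1.add h2).congr_fderiv ?_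
  ext v <;> simp [prodInner]

theorem norm_prodInner_le (z : AmbientSpace n) : ‖prodInner z‖ ≤ 2 * ‖z‖ := by
  refine ContinuousLinearMap.opNorm_le_bound _ (by positivity) fun v => ?_
  have h1 : |inner ℝ z.1 v.1| ≤ ‖z‖ * ‖v‖ := (abs_real_inner_le_norm _ _).trans
    (mul_le_mul (norm_fst_le z) (norm_fst_le v) (norm_nonneg _) (norm_nonneg _))
  have h2 : |z.2 * v.2| ≤ ‖z‖ * ‖v‖ := by
    rw [abs_mul]
    exact mul_le_mul (norm_snd_le z) (norm_snd_le v) (abs_nonneg _) (norm_nonneg _)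
  calc ‖prodInner z v‖ = |inner ℝ z.1 v.1 + z.2 * v.2| := by simp [prodInner]
    _ ≤ |inner ℝ z.1 v.1| + |z.2 * v.2| := abs_add_le _ _
    _ ≤ 2 * ‖z‖ * ‖v‖ := by linarith

theorem hasFDerivAt_comp_sqNorm {f : ℝ → ℝ} {f' : ℝ} {z : AmbientSpace n}
    (hf : HasDerivAt f f' (sqNorm z)) :
    HasFDerivAt (fun z => f (sqNorm z)) ((2 * f') • prodInner z) z := by
  refine (hf.comp_hasFDerivAt z (hasFDerivAt_sqNorm z)).congr_fderiv ?_
  rw [smul_smul, mul_comm]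

theorem hasCompactSupport_comp_sqNorm {f : ℝ → ℝ} {ρ : ℝ} (hf : ∀ s, ρ ≤ s → f s = 0) :
    HasCompactSupport fun z : AmbientSpace n => f (sqNorm z) := by
  refine HasCompactSupport.of_support_subset_isCompact
    (isCompact_closedBall (0 : AmbientSpace n) (|ρ| + 1)) fun z hz => ?_
  have h1 : sqNorm z < ρ := by
    by_contra! h
    exact hz (hf _ h)
  have h2 := norm_sq_le_sqNorm z
  rw [mem_closedBall_zero_iff]
  nlinarith [abs_nonneg ρ, le_abs_self ρ, norm_nonneg z]

/-- The Laplacian on `ℝ^n` of a function of `‖y‖²`. -/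
theorem laplacian_comp_norm_sq {f f' : ℝ → ℝ} {f'' b : ℝ} {a x : EuclideanSpace ℝ (Fin n)}
    (hf : ∀ s, 0 ≤ s → HasDerivAt f (f' (s + b)) (s + b))
    (hf' : HasDerivAt f' f'' (‖x - a‖ ^ 2 + b)) :
    Laplacian.laplacian (fun y => f (‖y - a‖ ^ 2 + b)) x =
      4 * ‖x - a‖ ^ 2 * f'' + 2 * n * f' (‖x - a‖ ^ 2 + b) := by
  have hq : ∀ y : EuclideanSpace ℝ (Fin n), HasFDerivAt
      (fun y : EuclideanSpace ℝ (Fin n) => ‖y - a‖ ^ 2 + b) ((2 : ℝ) • innerSL ℝ (y - a)) y := by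
    intro y
    have := ((hasStrictFDerivAt_norm_sq (y - a)).hasFDerivAt.comp y
      ((hasFDerivAt_id y).sub_const a)).add_const b
    refine this.congr_fderiv ?_
    ext v
    simp
  have h1 : fderiv ℝ (fun y => f (‖y - a‖ ^ 2 + b)) =
      fun y => f' (‖y - a‖ ^ 2 + b) • (2 : ℝ) • innerSL ℝ (y - a) := by
    ext1 y
    exact ((hf (‖y - a‖ ^ 2) (by positivity)).comp_hasFDerivAt y (hq y)).fderiv
  have h2 : HasFDerivAt (fun y : EuclideanSpace ℝ (Fin n) => (2 : ℝ) • innerSL ℝ (y - a))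
      ((2 : ℝ) • (innerSL ℝ : EuclideanSpace ℝ (Fin n) →L[ℝ] _)) x :=
    (((innerSL ℝ : EuclideanSpace ℝ (Fin n) →L[ℝ] _).hasFDerivAt (x := x - a)).comp x
      ((hasFDerivAt_id x).sub_const a)).const_smul (2 : ℝ)
  have h3 := (hf'.comp_hasFDerivAt x (hq x)).smul h2
  rw [InnerProductSpace.laplacian_eq_iteratedFDeriv_orthonormalBasis _
    (EuclideanSpace.basisFun (Fin n) ℝ)]
  simp only [iteratedFDeriv_two_apply, h1]
  have h4 : fderiv ℝ (fun y => f' (‖y - a‖ ^ 2 + b) • (2 : ℝ) • innerSL ℝ (y - a)) x = _ :=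
    h3.fderiv
  rw [h4]
  have h5 : ‖x - a‖ ^ 2 = ∑ i, (x i - a i) ^ 2 := by
    simp [EuclideanSpace.norm_sq_eq]
  have h6 : ∀ i, (innerSL ℝ (EuclideanSpace.single i (1 : ℝ)) :
      EuclideanSpace ℝ (Fin n) →L[ℝ] ℝ) (EuclideanSpace.single i 1) = 1 := fun i =>
    (real_inner_self_eq_norm_sq (EuclideanSpace.single i (1 : ℝ))).trans (by simp)
  simp [Finset.sum_add_distrib, EuclideanSpace.inner_single_right, h6]
  rw [h5, Finset.mul_sum, Finset.sum_mul, add_comm]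
  congr 1
  · exact Finset.sum_congr rfl fun i _ => by ring
  · ring

/-- The radial formula `Δ f(|z|²) = 4 |z|² f'' + 2 N f'` with `N = n + 1`: the variables `x'`
contribute `2 n f'` and `x_N` contributes `2 f'`. -/
theorem laplacianProd_comp_sqNorm {f f' f'' : ℝ → ℝ}
    (hf : ∀ s, 0 ≤ s → HasDerivAt f (f' s) s) (hf' : ∀ s, 0 ≤ s → HasDerivAt f' (f'' s) s)
    (x y : AmbientSpace n) :
    laplacianProd (fun y => f (sqNorm (x - y))) y =
      4 * sqNorm (x - y) * f'' (sqNorm (x - y)) + 2 * (n + 1) * f' (sqNorm (x - y)) := by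
  have hd : ∀ t : ℝ, HasDerivAt (fun t => f (sqNorm (x - (y.1, t))))
      (f' (sqNorm (x - (y.1, t))) * (2 * (t - x.2))) t := by
    intro t
    have h1 : HasDerivAt (fun t => sqNorm (x - (y.1, t))) (2 * (t - x.2)) t := by
      have := (((hasDerivAt_id t).const_sub x.2).pow 2).const_add (‖x.1 - y.1‖ ^ 2)
      refine this.congr_deriv ?_
      simp; ring
    exact (hf _ (sqNorm_nonneg _)).comp t h1
  have h2 : iteratedDeriv 2 (fun t => f (sqNorm (x - (y.1, t)))) y.2 =
      f'' (sqNorm (x - y)) * (2 * (y.2 - x.2)) * (2 * (y.2 - x.2)) + f' (sqNorm (x - y)) * 2 := by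
    rw [iteratedDeriv_succ, iteratedDeriv_one]
    have : deriv (fun t => f (sqNorm (x - (y.1, t)))) =
        fun t => f' (sqNorm (x - (y.1, t))) * (2 * (t - x.2)) := funext fun t => (hd t).deriv
    rw [this]
    have h1 : HasDerivAt (fun t => sqNorm (x - (y.1, t))) (2 * (y.2 - x.2)) y.2 := by
      have := (((hasDerivAt_id y.2).const_sub x.2).pow 2).const_add (‖x.1 - y.1‖ ^ 2)
      refine this.congr_deriv ?_
      simp; ring
    have h3 := (hf' _ (sqNorm_nonneg (x - (y.1, y.2)))).comp y.2 h1
    have h4 := h3.mul (((hasDerivAt_id y.2).sub_const x.2).const_mul 2)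
    refine h4.deriv.trans ?_
    simp
  -- With `y_N` frozen, the last coordinate enters the tangential Laplacian only through the
  -- additive constant `b`.
  have h3 := laplacian_comp_norm_sq (f := f) (f' := f') (b := (x.2 - y.2) ^ 2) (a := x.1)
    (x := y.1) (fun s hs => hf _ (by positivity)) (hf' _ (by positivity))
  have h4 : ∀ z : EuclideanSpace ℝ (Fin n), sqNorm (x - (z, y.2)) =
      ‖z - x.1‖ ^ 2 + (x.2 - y.2) ^ 2 := fun z => by
    rw [norm_sub_rev]; rfl
  unfold laplacianProd
  simp only [h4, h3, h2]
  have h5 : sqNorm (x - y) = ‖y.1 - x.1‖ ^ 2 + (x.2 - y.2) ^ 2 := h4 y.1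
  rw [← h5]
  have h6 : ‖y.1 - x.1‖ ^ 2 = sqNorm (x - y) - (x.2 - y.2) ^ 2 := by rw [h5]; ring
  rw [h6]
  ring

end RadialFunctions

/-! ### The regularised fundamental solution, its gradient and its Laplacian -/

section Kernels

/-- `χ` is a smooth cutoff function on `ℝ` that vanishes on `[ρ, ∞)` and equals `1` at `0`. -/
structure IsCutoff (χ : ℝ → ℝ) (ρ : ℝ) : Prop where
  pos : 0 < ρ
  le_one : ρ ≤ 1
  contDiff : ContDiff ℝ ∞ χ
  hasCompactSupport : HasCompactSupport χ
  eq_zero : ∀ s, ρ ≤ s → χ s = 0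
  apply_zero : χ 0 = 1

theorem exists_isCutoff {ρ : ℝ} (hρ : 0 < ρ) (hρ1 : ρ ≤ 1) : ∃ χ, IsCutoff χ ρ := by
  let b : ContDiffBump (0 : ℝ) := ⟨ρ / 2, ρ, by positivity, by linarith⟩
  refine ⟨b, hρ, hρ1, b.contDiff, b.hasCompactSupport, fun s hs => b.zero_of_le_dist ?_,
    b.one_of_mem_closedBall (Metric.mem_closedBall_self (by positivity))⟩
  simpa [b, Real.dist_eq] using hs.trans (le_abs_self s)

variable {χ : ℝ → ℝ} {ρ : ℝ} {n : ℕ} {e s : ℝ}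

/-- The exponent `-N/2`, where `N = n + 1`. -/
noncomputable def kernelExponent (n : ℕ) : ℝ := -((n : ℝ) + 1) / 2

/-- The radial profile of the gradient of the regularised fundamental solution. -/
noncomputable def gradProfile (χ : ℝ → ℝ) (n : ℕ) (e s : ℝ) : ℝ :=
  χ s * (s + e) ^ kernelExponent n

/-- The derivative of `gradProfile`. -/
noncomputable def gradProfileDeriv (χ : ℝ → ℝ) (n : ℕ) (e s : ℝ) : ℝ :=
  deriv χ s * (s + e) ^ kernelExponent n +
    χ s * (kernelExponent n * (s + e) ^ (kernelExponent n - 1))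

/-- The radial profile of the regularised fundamental solution, cut off at `ρ`. -/
noncomputable def potProfile (χ : ℝ → ℝ) (ρ : ℝ) (n : ℕ) (e s : ℝ) : ℝ :=
  ∫ t in ρ..s, gradProfile χ n e t / 2

/-- The radial profile of the remainder due to the cutoff. -/
noncomputable def remProfile (χ : ℝ → ℝ) (n : ℕ) (e s : ℝ) : ℝ :=
  2 * s * deriv χ s * (s + e) ^ kernelExponent n

/-- The derivative of `remProfile`. -/
noncomputable def remProfileDeriv (χ : ℝ → ℝ) (n : ℕ) (e s : ℝ) : ℝ :=
  (2 * deriv χ s + 2 * s * deriv (deriv χ) s) * (s + e) ^ kernelExponent n +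
    2 * s * deriv χ s * (kernelExponent n * (s + e) ^ (kernelExponent n - 1))

/-- The radial profile of the approximate identity. -/
noncomputable def massProfile (χ : ℝ → ℝ) (n : ℕ) (e s : ℝ) : ℝ :=
  (n + 1) * e * χ s * (s + e) ^ (kernelExponent n - 1)

theorem hasDerivAt_add_rpow (b : ℝ) (hs : 0 < s + e) :
    HasDerivAt (fun s => (s + e) ^ b) (b * (s + e) ^ (b - 1)) s := by
  have := ((hasDerivAt_id s).add_const e).rpow_const (p := b) (Or.inl hs.ne')
  simpa using! this

theorem contDiffOn_add_rpow (b : ℝ) (e : ℝ) {m : WithTop ℕ∞} :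
    ContDiffOn ℝ m (fun s : ℝ => (s + e) ^ b) (Set.Ioi (-e)) :=
  (contDiff_id.add contDiff_const).contDiffOn.rpow_const_of_ne fun s hs => by
    have : -e < s := hs
    simp only [id]; linarith

namespace IsCutoff

theorem contDiff_deriv (h : IsCutoff χ ρ) : ContDiff ℝ ∞ (deriv χ) :=
  (contDiff_infty_iff_deriv.1 h.contDiff).2

theorem contDiff_deriv_deriv (h : IsCutoff χ ρ) : ContDiff ℝ ∞ (deriv (deriv χ)) :=
  (contDiff_infty_iff_deriv.1 h.contDiff_deriv).2

/-- Beyond `ρ` the function is locally zero; the endpoint `ρ` itself is reached by continuity of the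
derivative. -/
theorem deriv_eq_zero_of_forall_le {f : ℝ → ℝ} (hf : Continuous (deriv f))
    (h : ∀ s, ρ ≤ s → f s = 0) (hs : ρ ≤ s) : deriv f s = 0 := by
  have h1 : ∀ t ∈ Set.Ioi ρ, deriv f t = 0 := fun t ht => by
    have : f =ᶠ[𝓝 t] fun _ => 0 := by
      filter_upwards [Ioi_mem_nhds ht] with r hr using h r (le_of_lt hr)
    rw [this.deriv_eq, deriv_const]
  have h2 : Set.Ici ρ ⊆ {t | deriv f t = 0} := by
    rw [← closure_Ioi]
    exact closure_minimal h1 (isClosed_eq hf continuous_const)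
  exact h2 hs

theorem deriv_eq_zero (h : IsCutoff χ ρ) (hs : ρ ≤ s) : deriv χ s = 0 :=
  deriv_eq_zero_of_forall_le h.contDiff_deriv.continuous h.eq_zero hs

theorem deriv_deriv_eq_zero (h : IsCutoff χ ρ) (hs : ρ ≤ s) : deriv (deriv χ) s = 0 :=
  deriv_eq_zero_of_forall_le h.contDiff_deriv_deriv.continuous (fun _ => h.deriv_eq_zero) hs

theorem exists_bound (h : IsCutoff χ ρ) : ∃ C : ℝ, 0 ≤ C ∧ ∀ s, |χ s| ≤ C ∧ |deriv χ s| ≤ C ∧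
    |deriv (deriv χ) s| ≤ C := by
  obtain ⟨A, hA⟩ := h.hasCompactSupport.exists_bound_of_continuous h.contDiff.continuous
  obtain ⟨B, hB⟩ := h.hasCompactSupport.deriv.exists_bound_of_continuous
    h.contDiff_deriv.continuous
  obtain ⟨D, hD⟩ := h.hasCompactSupport.deriv.deriv.exists_bound_of_continuous
    h.contDiff_deriv_deriv.continuous
  have hA0 := (norm_nonneg _).trans (hA 0)
  have hB0 := (norm_nonneg _).trans (hB 0)
  have hD0 := (norm_nonneg _).trans (hD 0)
  refine ⟨A + B + D, by positivity, fun s => ⟨?_, ?_, ?_⟩⟩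
  · have := hA s; rw [Real.norm_eq_abs] at this; linarith
  · have := hB s; rw [Real.norm_eq_abs] at this; linarith
  · have := hD s; rw [Real.norm_eq_abs] at this; linarith

theorem hasDerivAt (h : IsCutoff χ ρ) (s : ℝ) : HasDerivAt χ (deriv χ s) s :=
  ((h.contDiff.differentiable (by simp)) s).hasDerivAt

theorem contDiffOn_gradProfile (h : IsCutoff χ ρ) :
    ContDiffOn ℝ ∞ (gradProfile χ n e) (Set.Ioi (-e)) :=
  h.contDiff.contDiffOn.mul (contDiffOn_add_rpow _ _)

theorem contDiffOn_remProfile (h : IsCutoff χ ρ) :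
    ContDiffOn ℝ ∞ (remProfile χ n e) (Set.Ioi (-e)) :=
  ((contDiff_const.mul contDiff_id).mul h.contDiff_deriv).contDiffOn.mul (contDiffOn_add_rpow _ _)

theorem contDiffOn_massProfile (h : IsCutoff χ ρ) :
    ContDiffOn ℝ ∞ (massProfile χ n e) (Set.Ioi (-e)) :=
  (contDiff_const.mul h.contDiff).contDiffOn.mul (contDiffOn_add_rpow _ _)

theorem hasDerivAt_gradProfile (h : IsCutoff χ ρ) (hs : 0 < s + e) :
    HasDerivAt (gradProfile χ n e) (gradProfileDeriv χ n e s) s :=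
  (h.hasDerivAt s).mul (hasDerivAt_add_rpow _ hs)

theorem hasDerivAt_remProfile (h : IsCutoff χ ρ) (hs : 0 < s + e) :
    HasDerivAt (remProfile χ n e) (remProfileDeriv χ n e s) s := by
  have h1 : HasDerivAt (deriv χ) (deriv (deriv χ) s) s :=
    ((h.contDiff_deriv.differentiable (by simp)) s).hasDerivAt
  have h2 := (((hasDerivAt_id s).const_mul 2).mul h1).mul
    (hasDerivAt_add_rpow (kernelExponent n) hs)
  refine h2.congr_deriv ?_
  simp [remProfileDeriv]

theorem intervalIntegrable_gradProfile (h : IsCutoff χ ρ) (he : 0 ≤ e) (hs : 0 < s + e) :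
    IntervalIntegrable (fun t => gradProfile χ n e t / 2) volume ρ s := by
  refine ContinuousOn.intervalIntegrable ((h.contDiffOn_gradProfile.continuousOn.div_const 2).mono
    fun t ht => ?_)
  rw [Set.mem_Ioi]
  have h1 : min ρ s ≤ t := ht.1
  rcases min_le_iff.1 h1 with h2 | h2
  · linarith [h.pos]
  · linarith

/-- Defining the potential through its gradient avoids separating the logarithm of `N = 2` from the
powers of `N ≥ 3`. Integration starts at `ρ`, so the potential vanishes beyond `ρ`. The factor `1/2`
cancels the `2` in the gradient of `|z|²`. -/
theorem hasDerivAt_potProfile (h : IsCutoff χ ρ) (he : 0 ≤ e) (hs : 0 < s + e) :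
    HasDerivAt (potProfile χ ρ n e) (gradProfile χ n e s / 2) s := by
  have hopen : Set.Ioi (-e) ∈ 𝓝 s := Ioi_mem_nhds (by linarith)
  have hc : ContinuousOn (fun t => gradProfile χ n e t / 2) (Set.Ioi (-e)) :=
    h.contDiffOn_gradProfile.continuousOn.div_const 2
  exact intervalIntegral.integral_hasDerivAt_right (h.intervalIntegrable_gradProfile he hs)
    (hc.stronglyMeasurableAtFilter isOpen_Ioi s (by rw [Set.mem_Ioi]; linarith))
    (hc.continuousAt hopen)

theorem gradProfile_eq_zero (h : IsCutoff χ ρ) (hs : ρ ≤ s) : gradProfile χ n e s = 0 := by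
  simp [gradProfile, h.eq_zero s hs]

theorem potProfile_eq_zero (h : IsCutoff χ ρ) (hs : ρ ≤ s) : potProfile χ ρ n e s = 0 := by
  unfold potProfile
  rw [intervalIntegral.integral_congr (g := fun _ => (0 : ℝ)), intervalIntegral.integral_zero]
  intro t ht
  rw [Set.uIcc_of_le hs] at ht
  simp [h.gradProfile_eq_zero ht.1]

theorem remProfile_eq_zero (h : IsCutoff χ ρ) (hs : ρ ≤ s) : remProfile χ n e s = 0 := by
  simp [remProfile, h.deriv_eq_zero hs]

theorem remProfileDeriv_eq_zero (h : IsCutoff χ ρ) (hs : ρ ≤ s) :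
    remProfileDeriv χ n e s = 0 := by
  simp [remProfileDeriv, h.deriv_eq_zero hs, h.deriv_deriv_eq_zero hs]

theorem massProfile_eq_zero (h : IsCutoff χ ρ) (hs : ρ ≤ s) : massProfile χ n e s = 0 := by
  simp [massProfile, h.eq_zero s hs]

theorem contDiffOn_potProfile (h : IsCutoff χ ρ) (he : 0 ≤ e) :
    ContDiffOn ℝ ∞ (potProfile χ ρ n e) (Set.Ioi (-e)) := by
  rw [contDiffOn_infty_iff_deriv_of_isOpen isOpen_Ioi]
  have h1 : ∀ t ∈ Set.Ioi (-e), HasDerivAt (potProfile χ ρ n e) (gradProfile χ n e t / 2) t :=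
    fun t ht => h.hasDerivAt_potProfile he (by rw [Set.mem_Ioi] at ht; linarith)
  exact ⟨fun t ht => (h1 t ht).differentiableAt.differentiableWithinAt,
    (h.contDiffOn_gradProfile.div_const 2).congr fun t ht => (h1 t ht).deriv⟩

/-- The identity behind the method. The term with `χ'` is the remainder; in the others, `N (s + e) -
N s = N e` leaves the factor `e` that makes `massProfile` an approximate identity. -/
theorem gradProfileDeriv_add (hs : 0 < s + e) :
    4 * s * (gradProfileDeriv χ n e s / 2) + 2 * (n + 1) * (gradProfile χ n e s / 2) =
      remProfile χ n e s + massProfile χ n e s := by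
  have h1 : (s + e) ^ kernelExponent n = (s + e) * (s + e) ^ (kernelExponent n - 1) := by
    rw [Real.rpow_sub_one hs.ne']
    field_simp
  unfold gradProfileDeriv gradProfile remProfile massProfile
  rw [h1]
  unfold kernelExponent
  ring

theorem contDiff_comp_sqNorm {f : ℝ → ℝ} {m : WithTop ℕ∞} (he : 0 < e)
    (hf : ContDiffOn ℝ m f (Set.Ioi (-e))) :
    ContDiff ℝ m fun z : AmbientSpace n => f (sqNorm z) :=
  hf.comp_contDiff contDiff_sqNorm fun z => by
    have := sqNorm_nonneg z
    rw [Set.mem_Ioi]; linarith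

theorem laplacianProd_potProfile (h : IsCutoff χ ρ) (he : 0 < e) (x y : AmbientSpace n) :
    laplacianProd (fun y => potProfile χ ρ n e (sqNorm (x - y))) y =
      remProfile χ n e (sqNorm (x - y)) + massProfile χ n e (sqNorm (x - y)) := by
  rw [← gradProfileDeriv_add (by linarith [sqNorm_nonneg (x - y)])]
  exact laplacianProd_comp_sqNorm (f' := fun s => gradProfile χ n e s / 2)
    (f'' := fun s => gradProfileDeriv χ n e s / 2)
    (fun s hs => h.hasDerivAt_potProfile he.le (by linarith))
    (fun s hs => (h.hasDerivAt_gradProfile (by linarith)).div_const 2) x y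

theorem fderiv_potProfile (h : IsCutoff χ ρ) (he : 0 < e) :
    fderiv ℝ (fun z : AmbientSpace n => potProfile χ ρ n e (sqNorm z)) =
      fun z => gradProfile χ n e (sqNorm z) • prodInner z := by
  ext1 z
  rw [(hasFDerivAt_comp_sqNorm (h.hasDerivAt_potProfile he.le
    (by linarith [sqNorm_nonneg z]))).fderiv]
  congr 1
  ring

theorem fderiv_remProfile (h : IsCutoff χ ρ) (he : 0 < e) :
    fderiv ℝ (fun z : AmbientSpace n => remProfile χ n e (sqNorm z)) =
      fun z => (2 * remProfileDeriv χ n e (sqNorm z)) • prodInner z := by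
  ext1 z
  exact (hasFDerivAt_comp_sqNorm (h.hasDerivAt_remProfile (by linarith [sqNorm_nonneg z]))).fderiv

end IsCutoff

end Kernels

/-! ### Bounds on the kernels, uniform in the regularisation -/

section KernelBounds

variable {χ : ℝ → ℝ} {ρ : ℝ} {n : ℕ} {e s : ℝ}

/-- The function `C |z|^{-n}` on the unit ball, extended by zero. -/
noncomputable def kernelBound (n : ℕ) (C : ℝ) : AmbientSpace n → ℝ :=
  (Metric.closedBall 0 1).indicator fun z => C * ‖z‖ ^ (-(n : ℝ))

instance : (volume : Measure (AmbientSpace n)).IsAddHaarMeasure := by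
  rw [Measure.volume_eq_prod]
  infer_instance

/-- In polar coordinates the `p`-th power becomes `r^(n - n p)`, integrable at `0` exactly when `n p
< n + 1`. This is the origin of the restriction on `p`. -/
theorem memLp_kernelBound (C : ℝ) {p : ℝ≥0} (hp : 1 ≤ p) (hpn : (p : ℝ) * n < n + 1) :
    MemLp (kernelBound n C) p volume := by
  have hp0 : (0 : ℝ) < p := lt_of_lt_of_le one_pos (by exact_mod_cast hp)
  unfold kernelBound
  rw [memLp_indicator_iff_restrict measurableSet_closedBall]
  refine MemLp.const_mul ?_ C
  have hm : Measurable fun z : AmbientSpace n => ‖z‖ ^ (-(n : ℝ)) := by fun_prop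
  rw [← integrable_norm_rpow_iff hm.aestronglyMeasurable (by exact_mod_cast (zero_lt_one.trans_le hp).ne')
    ENNReal.coe_ne_top]
  have h1 : IntegrableOn (fun z : AmbientSpace n => (fun r : ℝ => r ^ (-(n : ℝ) * p)) ‖z‖)
      (Metric.ball 0 2) := by
    refine (integrableOn_fun_norm_addHaar (f := fun r : ℝ => r ^ (-(n : ℝ) * p)) (r := 2) volume).2 ?_
    have hdim : Module.finrank ℝ (AmbientSpace n) = n + 1 := by simp
    rw [hdim]
    refine (integrableOn_congr_fun (g := fun y : ℝ => y ^ ((n : ℝ) - n * p)) (fun y hy => ?_)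
      measurableSet_Ioo).2 ?_
    · simp only [add_tsub_cancel_right, smul_eq_mul]
      rw [← Real.rpow_natCast, ← Real.rpow_add hy.1]
      ring_nf
    · rw [intervalIntegral.integrableOn_Ioo_rpow_iff two_pos]
      linarith
  refine (h1.mono_set (Metric.closedBall_subset_ball one_lt_two)).congr_fun (fun z _ => ?_)
    measurableSet_closedBall
  rw [Real.norm_of_nonneg (by positivity), ← Real.rpow_mul (norm_nonneg _)]
  rfl

theorem kernelExponent_nonpos : kernelExponent n ≤ 0 := by
  unfold kernelExponent
  have : (0 : ℝ) ≤ n := n.cast_nonneg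
  linarith

theorem rpow_sqNorm_le {z : AmbientSpace n} (hz : z ≠ 0) {b : ℝ} (hb : 0 ≤ b) :
    sqNorm z ^ (-b / 2) ≤ ‖z‖ ^ (-b) := by
  have hz' : 0 < ‖z‖ := norm_pos_iff.2 hz
  have h1 : sqNorm z ^ (-b / 2) ≤ (‖z‖ ^ 2) ^ (-b / 2) :=
    Real.rpow_le_rpow_of_nonpos (by positivity) (norm_sq_le_sqNorm z) (by linarith)
  refine h1.trans_eq ?_
  rw [← Real.rpow_natCast, ← Real.rpow_mul hz'.le]
  congr 1
  push_cast
  ring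

theorem norm_mul_rpow_sqNorm_le {z : AmbientSpace n} (hz : z ≠ 0) :
    ‖z‖ * sqNorm z ^ kernelExponent n ≤ ‖z‖ ^ (-(n : ℝ)) := by
  have hz' : 0 < ‖z‖ := norm_pos_iff.2 hz
  have h1 := rpow_sqNorm_le hz (b := (n : ℝ) + 1) (by positivity)
  calc ‖z‖ * sqNorm z ^ kernelExponent n ≤ ‖z‖ * ‖z‖ ^ (-((n : ℝ) + 1)) := by
        gcongr; exact h1
    _ = ‖z‖ ^ (-(n : ℝ)) := by
        rw [neg_add, ← sub_eq_add_neg, Real.rpow_sub_one hz'.ne']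
        field_simp

theorem add_rpow_le (hs : 0 < s) (he : 0 ≤ e) {b : ℝ} (hb : b ≤ 0) : (s + e) ^ b ≤ s ^ b :=
  Real.rpow_le_rpow_of_nonpos hs (by linarith) hb

/-- The origin is excluded because `0 ^ (-n)` is `0` for `n ≥ 1`, so the bound can fail there. A
single point is negligible for the `L^p` limits. -/
theorem le_kernelBound {F : Type*} [NormedAddCommGroup F] {g : AmbientSpace n → F} {C : ℝ}
    (hC : 0 ≤ C) (hg : ∀ z, 1 ≤ sqNorm z → g z = 0)
    (hb : ∀ z, z ≠ 0 → sqNorm z ≤ 1 → ‖g z‖ ≤ C * ‖z‖ ^ (-(n : ℝ))) :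
    ∀ z, z ≠ 0 → ‖g z‖ ≤ kernelBound n C z := by
  intro z hz
  have h0 : 0 ≤ kernelBound n C z := Set.indicator_nonneg (fun _ _ => by positivity) z
  rcases le_or_gt 1 (sqNorm z) with h | h
  · rw [hg z h, norm_zero]
    exact h0
  · unfold kernelBound
    rw [Set.indicator_of_mem (mem_closedBall_zero_iff.2 (norm_le_one_of_sqNorm_le h.le))]
    exact hb z hz h.le

namespace IsCutoff

/-- Since `(s + e)^(-N/2) ≤ s^(-N/2)`, the constant does not depend on `e`, and the bound can serve
as a dominating function as `e → 0`. -/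
theorem exists_bound_gradKernel (h : IsCutoff χ ρ) : ∃ C : ℝ, ∀ e, 0 ≤ e → ∀ z : AmbientSpace n,
    z ≠ 0 → ‖gradProfile χ n e (sqNorm z) • prodInner z‖ ≤ kernelBound n C z := by
  obtain ⟨C, hC0, hC⟩ := h.exists_bound
  refine ⟨2 * C, fun e he => le_kernelBound (by positivity) (fun z hz => ?_) fun z hz hz1 => ?_⟩
  · rw [h.gradProfile_eq_zero (h.le_one.trans hz), zero_smul]
  · have hq := sqNorm_pos hz
    rw [norm_smul, gradProfile, norm_mul, Real.norm_eq_abs, Real.norm_eq_abs,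
      abs_of_nonneg (a := (sqNorm z + e) ^ kernelExponent n) (by positivity)]
    have hle := add_rpow_le hq he (kernelExponent_nonpos (n := n))
    calc |χ (sqNorm z)| * (sqNorm z + e) ^ kernelExponent n * ‖prodInner z‖
        ≤ C * sqNorm z ^ kernelExponent n * (2 * ‖z‖) := by
          gcongr
          · exact (hC _).1
          · exact norm_prodInner_le z
      _ = 2 * C * (‖z‖ * sqNorm z ^ kernelExponent n) := by ring
      _ ≤ _ := by gcongr; exact norm_mul_rpow_sqNorm_le hz

/-- Differentiating the power costs a factor `(s + e)⁻¹`, which the explicit factor `s` of the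
remainder absorbs. -/
theorem abs_remProfileDeriv_le {C : ℝ} (hC0 : 0 ≤ C) (hC : ∀ s, |χ s| ≤ C ∧ |deriv χ s| ≤ C ∧
    |deriv (deriv χ) s| ≤ C) (hs : 0 < s) (hs1 : s ≤ 1) (he : 0 ≤ e) :
    |remProfileDeriv χ n e s| ≤ (4 + 2 * |kernelExponent n|) * C * s ^ kernelExponent n := by
  unfold remProfileDeriv
  have h1 : (s + e) ^ kernelExponent n ≤ s ^ kernelExponent n :=
    add_rpow_le hs he kernelExponent_nonpos
  have h2 : s * (s + e) ^ (kernelExponent n - 1) ≤ s ^ kernelExponent n := by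
    have : (s + e) ^ (kernelExponent n - 1) ≤ s ^ (kernelExponent n - 1) :=
      add_rpow_le hs he (by linarith [kernelExponent_nonpos (n := n)])
    calc _ ≤ s * s ^ (kernelExponent n - 1) := by gcongr
      _ = _ := by rw [Real.rpow_sub_one hs.ne']; field_simp
  have h3 : |2 * deriv χ s + 2 * s * deriv (deriv χ) s| ≤ 4 * C := by
    calc _ ≤ |2 * deriv χ s| + |2 * s * deriv (deriv χ) s| := abs_add_le _ _
      _ = 2 * |deriv χ s| + 2 * s * |deriv (deriv χ) s| := by
        rw [abs_mul, abs_mul, abs_mul, abs_two, abs_of_pos hs]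
      _ ≤ 2 * C + 2 * 1 * C := by
        gcongr
        · exact (hC s).2.1
        · exact (hC s).2.2
      _ = _ := by ring
  have hp : 0 ≤ (s + e) ^ kernelExponent n := by positivity
  have hp' : 0 ≤ (s + e) ^ (kernelExponent n - 1) := by positivity
  calc _ ≤ |(2 * deriv χ s + 2 * s * deriv (deriv χ) s) * (s + e) ^ kernelExponent n| +
        |2 * s * deriv χ s * (kernelExponent n * (s + e) ^ (kernelExponent n - 1))| :=
        abs_add_le _ _
    _ = |2 * deriv χ s + 2 * s * deriv (deriv χ) s| * (s + e) ^ kernelExponent n +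
        2 * |kernelExponent n| * |deriv χ s| * (s * (s + e) ^ (kernelExponent n - 1)) := by
        rw [abs_mul, abs_mul, abs_mul, abs_mul, abs_mul, abs_two, abs_of_pos hs, abs_of_nonneg hp,
          abs_of_nonneg hp']
        ring
    _ ≤ 4 * C * s ^ kernelExponent n + 2 * |kernelExponent n| * C * s ^ kernelExponent n := by
        gcongr
        exact (hC s).2.1
    _ = _ := by ring

theorem exists_bound_fderiv_remKernel (h : IsCutoff χ ρ) : ∃ C : ℝ, ∀ e, 0 ≤ e →
    ∀ z : AmbientSpace n, z ≠ 0 →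
      ‖(2 * remProfileDeriv χ n e (sqNorm z)) • prodInner z‖ ≤ kernelBound n C z := by
  obtain ⟨C, hC0, hC⟩ := h.exists_bound
  refine ⟨4 * ((4 + 2 * |kernelExponent n|) * C), fun e he =>
    le_kernelBound (by positivity) (fun z hz => ?_) fun z hz hz1 => ?_⟩
  · rw [h.remProfileDeriv_eq_zero (h.le_one.trans hz), mul_zero, zero_smul]
  · have hq := sqNorm_pos hz
    rw [norm_smul, norm_mul, Real.norm_eq_abs, Real.norm_eq_abs, abs_two]
    calc 2 * |remProfileDeriv χ n e (sqNorm z)| * ‖prodInner z‖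
        ≤ 2 * ((4 + 2 * |kernelExponent n|) * C * sqNorm z ^ kernelExponent n) * (2 * ‖z‖) := by
          gcongr
          · exact abs_remProfileDeriv_le hC0 hC hq hz1 he
          · exact norm_prodInner_le z
      _ = 4 * ((4 + 2 * |kernelExponent n|) * C) * (‖z‖ * sqNorm z ^ kernelExponent n) := by ring
      _ ≤ _ := by gcongr; exact norm_mul_rpow_sqNorm_le hz

theorem exists_bound_remKernel (h : IsCutoff χ ρ) : ∃ C : ℝ, ∀ e, 0 ≤ e →
    ∀ z : AmbientSpace n, z ≠ 0 → ‖remProfile χ n e (sqNorm z)‖ ≤ kernelBound n C z := by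
  obtain ⟨C, hC0, hC⟩ := h.exists_bound
  refine ⟨2 * C, fun e he => le_kernelBound (by positivity) (fun z hz => ?_) fun z hz hz1 => ?_⟩
  · exact h.remProfile_eq_zero (h.le_one.trans hz)
  · have hq := sqNorm_pos hz
    have h1 : sqNorm z * sqNorm z ^ kernelExponent n ≤ ‖z‖ ^ (-(n : ℝ)) := by
      refine le_trans ?_ (rpow_sqNorm_le hz n.cast_nonneg)
      calc sqNorm z * sqNorm z ^ kernelExponent n = sqNorm z ^ (1 + kernelExponent n) := by
            rw [Real.rpow_add hq, Real.rpow_one]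
        _ ≤ sqNorm z ^ (-(n : ℝ) / 2) :=
            Real.rpow_le_rpow_of_exponent_ge hq hz1 (by unfold kernelExponent; linarith)
    unfold remProfile
    rw [Real.norm_eq_abs, abs_mul, abs_mul, abs_mul, abs_two, abs_of_pos hq,
      abs_of_nonneg (a := (sqNorm z + e) ^ kernelExponent n) (by positivity)]
    have hle := add_rpow_le hq he (kernelExponent_nonpos (n := n))
    calc 2 * sqNorm z * |deriv χ (sqNorm z)| * (sqNorm z + e) ^ kernelExponent n
        ≤ 2 * sqNorm z * C * sqNorm z ^ kernelExponent n := by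
          gcongr
          exact (hC _).2.1
      _ = 2 * C * (sqNorm z * sqNorm z ^ kernelExponent n) := by ring
      _ ≤ _ := by gcongr

theorem exists_bound_potKernel (hn : 1 ≤ n) (h : IsCutoff χ ρ) : ∃ C : ℝ, ∀ e, 0 ≤ e →
    ∀ z : AmbientSpace n, z ≠ 0 → ‖potProfile χ ρ n e (sqNorm z)‖ ≤ kernelBound n C z := by
  obtain ⟨C, hC0, hC⟩ := h.exists_bound
  refine ⟨C, fun e he => le_kernelBound (by positivity) (fun z hz => ?_) fun z hz hz1 => ?_⟩
  · exact h.potProfile_eq_zero (h.le_one.trans hz)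
  have hn' : (1 : ℝ) ≤ n := by exact_mod_cast hn
  have hq := sqNorm_pos hz
  rcases le_or_gt ρ (sqNorm z) with hρ | hρ
  · rw [h.potProfile_eq_zero hρ, norm_zero]
    positivity
  have hpos : ∀ t ∈ Set.Icc (sqNorm z) ρ, 0 < t := fun t ht => hq.trans_le ht.1
  have h1 : ‖potProfile χ ρ n e (sqNorm z)‖ ≤
      ∫ t in sqNorm z..ρ, C * ((n : ℝ) / 2 * t ^ (-(n : ℝ) / 2 - 1)) := by
    unfold potProfile
    rw [intervalIntegral.integral_symm, norm_neg]
    refine intervalIntegral.norm_integral_le_of_norm_le hρ.le ?_ ?_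
    · filter_upwards with t ht
      have ht0 : 0 < t := hq.trans ht.1
      have ht1 : t ≤ 1 := ht.2.trans h.le_one
      rw [gradProfile, norm_div, norm_mul, Real.norm_eq_abs, Real.norm_eq_abs, Real.norm_two,
        abs_of_nonneg (a := (t + e) ^ kernelExponent n) (by positivity)]
      have hle := add_rpow_le ht0 he (kernelExponent_nonpos (n := n))
      -- Half a power is given away, which is harmless for `t ≤ 1`: the primitive is then `t^(-n/2)`
      -- for every `n ≥ 1`, with no logarithm when `n = 1`. The hypothesis `1 ≤ n` also allows the
      -- factor `n` needed for this primitive to be inserted.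
      have hle' : t ^ kernelExponent n ≤ t ^ (-(n : ℝ) / 2 - 1) :=
        Real.rpow_le_rpow_of_exponent_ge ht0 ht1 (by unfold kernelExponent; linarith)
      calc |χ t| * (t + e) ^ kernelExponent n / 2 ≤ C * t ^ kernelExponent n / 2 := by
            gcongr
            exact (hC t).1
        _ ≤ C * (1 * t ^ (-(n : ℝ) / 2 - 1)) / 2 := by
            rw [one_mul]
            gcongr
        _ ≤ C * (n * t ^ (-(n : ℝ) / 2 - 1)) / 2 := by gcongr
        _ = _ := by ring
    · refine ContinuousOn.intervalIntegrable fun t ht => ?_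
      rw [Set.uIcc_of_le hρ.le] at ht
      have := hpos t ht
      exact ((Real.continuousAt_rpow_const _ _ (Or.inl this.ne')).const_mul _ |>.const_mul
        _).continuousWithinAt
  refine h1.trans ?_
  have h0 : (0 : ℝ) ∉ Set.uIcc (sqNorm z) ρ := by
    rw [Set.uIcc_of_le hρ.le]
    exact fun h0 => (hpos 0 h0).ne' rfl
  rw [intervalIntegral.integral_const_mul, intervalIntegral.integral_const_mul,
    integral_rpow (Or.inr ⟨by linarith, h0⟩)]
  have h2 : (n : ℝ) / 2 * ((ρ ^ (-(n : ℝ) / 2 - 1 + 1) - sqNorm z ^ (-(n : ℝ) / 2 - 1 + 1)) /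
      (-(n : ℝ) / 2 - 1 + 1)) = sqNorm z ^ (-(n : ℝ) / 2) - ρ ^ (-(n : ℝ) / 2) := by
    rw [sub_add_cancel]
    field_simp
    ring
  rw [h2]
  gcongr
  have h3 := rpow_sqNorm_le hz (b := n) (by positivity)
  have h4 : 0 ≤ ρ ^ (-(n : ℝ) / 2) := Real.rpow_nonneg h.pos.le _
  linarith

/-! Convergence of the kernels as the regularisation tends to zero. -/

theorem tendsto_add_rpow {e : ℕ → ℝ} (he : Tendsto e atTop (𝓝 0)) (hs : 0 < s) (b : ℝ) :
    Tendsto (fun k => (s + e k) ^ b) atTop (𝓝 ((s + 0) ^ b)) :=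
  (tendsto_const_nhds.add he).rpow_const (Or.inl (by simpa using hs.ne'))

theorem tendsto_gradProfile {e : ℕ → ℝ} (he : Tendsto e atTop (𝓝 0)) (hs : 0 < s) :
    Tendsto (fun k => gradProfile χ n (e k) s) atTop (𝓝 (gradProfile χ n 0 s)) :=
  (tendsto_add_rpow he hs _).const_mul _

theorem tendsto_remProfile {e : ℕ → ℝ} (he : Tendsto e atTop (𝓝 0)) (hs : 0 < s) :
    Tendsto (fun k => remProfile χ n (e k) s) atTop (𝓝 (remProfile χ n 0 s)) :=
  (tendsto_add_rpow he hs _).const_mul _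

theorem tendsto_remProfileDeriv {e : ℕ → ℝ} (he : Tendsto e atTop (𝓝 0)) (hs : 0 < s) :
    Tendsto (fun k => remProfileDeriv χ n (e k) s) atTop (𝓝 (remProfileDeriv χ n 0 s)) :=
  ((tendsto_add_rpow he hs _).const_mul _).add
    (((tendsto_add_rpow he hs _).const_mul _).const_mul _)

/-- Between `s` and `ρ` the variable stays above `min ρ s > 0`, so the integrands are bounded
uniformly in `k`. -/
theorem tendsto_potProfile (h : IsCutoff χ ρ) {e : ℕ → ℝ} (he0 : ∀ k, 0 ≤ e k)
    (he : Tendsto e atTop (𝓝 0)) (hs : 0 < s) :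
    Tendsto (fun k => potProfile χ ρ n (e k) s) atTop (𝓝 (potProfile χ ρ n 0 s)) := by
  obtain ⟨C, hC0, hC⟩ := h.exists_bound
  have hpos : ∀ t ∈ Set.uIoc ρ s, 0 < t := fun t ht => (lt_min h.pos hs).trans ht.1
  refine intervalIntegral.tendsto_integral_filter_of_dominated_convergence
    (fun t => C * min ρ s ^ kernelExponent n / 2) ?_ ?_ (by simp) ?_
  · filter_upwards with k
    exact (h.intervalIntegrable_gradProfile (he0 k) (by linarith [he0 k])).aestronglyMeasurable_restrict_uIoc
  · filter_upwards with k
    filter_upwards with t ht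
    have ht0 := hpos t ht
    have hm : 0 < min ρ s := lt_min h.pos hs
    rw [gradProfile, norm_div, norm_mul, Real.norm_eq_abs, Real.norm_eq_abs, Real.norm_two,
        abs_of_nonneg (a := (t + e k) ^ kernelExponent n)
          (Real.rpow_nonneg (add_nonneg ht0.le (he0 k)) _)]
    have hle : (t + e k) ^ kernelExponent n ≤ min ρ s ^ kernelExponent n :=
      Real.rpow_le_rpow_of_nonpos hm (ht.1.le.trans (le_add_of_nonneg_right (he0 k)))
        kernelExponent_nonpos
    have h0 : 0 ≤ (t + e k) ^ kernelExponent n := Real.rpow_nonneg (add_nonneg ht0.le (he0 k)) _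
    gcongr
    exact (hC t).1
  · filter_upwards with t ht
    exact (tendsto_gradProfile he (hpos t ht)).div_const 2

end IsCutoff

end KernelBounds

/-! ### Limits in `L^p` and convergence of integrals -/

section LpLimits

variable {α : Type*} [MeasurableSpace α]

/-- Linear combinations of sequences that converge in `L^p`. -/
theorem tendsto_eLpNorm_combination {F : Type*} [NormedAddCommGroup F] [NormedSpace ℝ F]
    {μ : Measure α} {U : Set α} (hU : MeasurableSet U) {p : ℝ≥0} (hp : 1 ≤ p) (c : ℝ)
    {V A B C : ℕ → α → F} {A' B' C' : α → F} (hA : ∀ k, AEStronglyMeasurable (A k - A') μ)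
    (hB : ∀ k, AEStronglyMeasurable (B k - B') μ) (hC : ∀ k, AEStronglyMeasurable (C k - C') μ)
    (hV : ∀ k, ∀ x ∈ U, V k x = c • (A k x - B k x - C k x))
    (tA : Tendsto (fun k => eLpNorm (A k - A') p μ) atTop (𝓝 0))
    (tB : Tendsto (fun k => eLpNorm (B k - B') p μ) atTop (𝓝 0))
    (tC : Tendsto (fun k => eLpNorm (C k - C') p μ) atTop (𝓝 0)) :
    Tendsto (fun k => eLpNorm (V k - c • (A' - B' - C')) p (μ.restrict U)) atTop (𝓝 0) := by
  have hp' : (1 : ENNReal) ≤ p := by exact_mod_cast hp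
  have h := ENNReal.Tendsto.const_mul (a := ‖c‖ₑ) ((tA.add tB).add tC) (Or.inr (by simp))
  simp only [add_zero, mul_zero] at h
  refine tendsto_of_tendsto_of_tendsto_of_le_of_le tendsto_const_nhds h (fun _ => zero_le)
    fun k => ?_
  have h1 : eLpNorm (V k - c • (A' - B' - C')) p (μ.restrict U) =
      eLpNorm (c • ((A k - A') - (B k - B') - (C k - C'))) p (μ.restrict U) := by
    refine eLpNorm_congr_ae ?_
    filter_upwards [ae_restrict_mem hU] with x hx
    simp only [Pi.sub_apply, Pi.smul_apply, hV k x hx]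
    rw [← smul_sub]
    congr 1
    abel
  simp only
  rw [h1]
  refine (eLpNorm_mono_measure _ Measure.restrict_le_self).trans ?_
  rw [eLpNorm_const_smul]
  gcongr
  refine (eLpNorm_sub_le ((hA k).sub (hB k)) (hC k) hp').trans ?_
  gcongr
  exact eLpNorm_sub_le (hA k) (hB k) hp'

/-- Convergence in `L^p` of a finite measure implies convergence against bounded functions. -/
theorem tendsto_integral_mul_of_tendsto_eLpNorm {μ : Measure α} [IsFiniteMeasure μ] {p : ℝ≥0}
    (hp : 1 ≤ p) {v : ℕ → α → ℝ} {w φ : α → ℝ} (hv : ∀ k, MemLp (v k) p μ) (hw : MemLp w p μ)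
    (hφ : AEStronglyMeasurable φ μ) {C : ℝ} (hC : ∀ x, ‖φ x‖ ≤ C)
    (hlim : Tendsto (fun k => eLpNorm (v k - w) p μ) atTop (𝓝 0)) :
    Tendsto (fun k => ∫ x, φ x * v k x ∂μ) atTop (𝓝 (∫ x, φ x * w x ∂μ)) := by
  have hp' : (1 : ENNReal) ≤ p := by exact_mod_cast hp
  have hi : ∀ f : α → ℝ, MemLp f p μ → Integrable (fun x => φ x * f x) μ := fun f hf =>
    (hf.integrable hp').bdd_mul hφ (Eventually.of_forall hC)
  refine tendsto_integral_of_L1' _ (hi w hw).1 (Eventually.of_forall fun k => hi _ (hv k)) ?_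
  -- The constant is the bound of `φ` times the Hölder factor for passing from `L^p` to `L^1` on a
  -- finite measure space.
  have h := ENNReal.Tendsto.const_mul (a := ENNReal.ofReal C *
    μ Set.univ ^ (1 - 1 / (p : ℝ))) hlim (Or.inr ?_)
  · rw [mul_zero] at h
    refine tendsto_of_tendsto_of_tendsto_of_le_of_le tendsto_const_nhds h (fun _ => zero_le)
      fun k => ?_
    have h1 : eLpNorm ((fun x => φ x * v k x) - fun x => φ x * w x) 1 μ ≤
        ENNReal.ofReal C * eLpNorm (v k - w) 1 μ := by
      refine eLpNorm_le_mul_eLpNorm_of_ae_le_mul (Eventually.of_forall fun x => ?_) 1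
      simp only [Pi.sub_apply]
      rw [← mul_sub, norm_mul]
      gcongr
      exact hC x
    refine h1.trans ?_
    rw [mul_assoc]
    gcongr
    refine (eLpNorm_le_eLpNorm_mul_rpow_measure_univ hp' ((hv k).1.sub hw.1)).trans_eq ?_
    rw [mul_comm]
    simp
  · refine ENNReal.mul_ne_top (by simp) (ENNReal.rpow_ne_top_of_nonneg ?_ (measure_ne_top _ _))
    have : (1 : ℝ) ≤ p := by exact_mod_cast hp
    rw [sub_nonneg, div_le_one (by positivity)]
    exact this

end LpLimits

/-! ### The main part of the Laplacian as an approximate identity -/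

section ApproximateIdentity

variable {χ : ℝ → ℝ} {ρ : ℝ} {n : ℕ}

/-- The Laplacian of the regularised fundamental solution at scale one. -/
noncomputable def bubble (n : ℕ) (z : AmbientSpace n) : ℝ :=
  (n + 1) * (sqNorm z + 1) ^ (kernelExponent n - 1)

theorem bubble_pos (z : AmbientSpace n) : 0 < bubble n z := by
  have := sqNorm_nonneg z
  unfold bubble
  positivity

theorem continuous_bubble : Continuous (bubble n) := by
  have h : Continuous (sqNorm : AmbientSpace n → ℝ) := (contDiff_sqNorm (m := 0)).continuous
  refine continuous_const.mul ((h.add continuous_const).rpow_const fun z => Or.inl ?_)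
  exact (add_pos_of_nonneg_of_pos (sqNorm_nonneg z) one_pos).ne'

theorem finrank_ambientSpace : Module.finrank ℝ (AmbientSpace n) = n + 1 := by simp

theorem integrable_bubble : Integrable (bubble n) volume := by
  have h : Integrable (fun x : AmbientSpace n => ((1 : ℝ) + ‖x‖ ^ 2) ^ (-((n : ℝ) + 3) / 2)) volume :=
    integrable_rpow_neg_one_add_norm_sq (by rw [finrank_ambientSpace]; push_cast; linarith)
  refine (h.const_mul ((n : ℝ) + 1)).mono' continuous_bubble.aestronglyMeasurable
    (Eventually.of_forall fun z => ?_)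
  rw [Real.norm_of_nonneg (bubble_pos z).le, bubble]
  gcongr
  have h1 : kernelExponent n - 1 = -((n : ℝ) + 3) / 2 := by unfold kernelExponent; ring
  rw [h1]
  refine Real.rpow_le_rpow_of_nonpos (by positivity) ?_ ?_
  · linarith [norm_sq_le_sqNorm z]
  · have : (0 : ℝ) ≤ n := n.cast_nonneg
    linarith

/-- The mass is only used as a normalising divisor, so positivity suffices and its value is never
computed. -/
theorem integral_bubble_pos : 0 < ∫ z, bubble n z := by
  rw [integral_pos_iff_support_of_nonneg (fun z => (bubble_pos z).le) integrable_bubble]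
  have : Function.support (bubble n) = Set.univ :=
    Set.eq_univ_of_forall fun z => (bubble_pos z).ne'
  rw [this]
  simp

theorem tendsto_norm_pow_mul_bubble :
    Tendsto (fun z : AmbientSpace n => ‖z‖ ^ (n + 1) * bubble n z) (Bornology.cobounded _)
      (𝓝 0) := by
  have h1 : Tendsto (fun z : AmbientSpace n => ((n : ℝ) + 1) * ‖z‖ ^ (-2 : ℝ))
      (Bornology.cobounded _) (𝓝 0) := by
    have := ((tendsto_rpow_neg_atTop two_pos).comp
      (tendsto_norm_cobounded_atTop (E := AmbientSpace n))).const_mul ((n : ℝ) + 1)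
    simpa using! this
  refine tendsto_of_tendsto_of_tendsto_of_le_of_le' tendsto_const_nhds h1
    (Eventually.of_forall fun z => mul_nonneg (by positivity) (bubble_pos z).le) ?_
  filter_upwards [(tendsto_norm_cobounded_atTop (E := AmbientSpace n)).eventually_gt_atTop 0]
    with z hz
  have hz0 : z ≠ 0 := norm_pos_iff.1 hz
  have h2 : kernelExponent n - 1 = -((n : ℝ) + 3) / 2 := by unfold kernelExponent; ring
  have h3 : (sqNorm z + 1) ^ (kernelExponent n - 1) ≤ ‖z‖ ^ (-((n : ℝ) + 3)) := by
    refine (add_rpow_le (sqNorm_pos hz0) zero_le_one (by linarith [kernelExponent_nonpos (n := n)])).trans ?_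
    rw [h2]
    exact rpow_sqNorm_le hz0 (by positivity)
  calc ‖z‖ ^ (n + 1) * bubble n z
      ≤ ‖z‖ ^ (n + 1) * ((n + 1) * ‖z‖ ^ (-((n : ℝ) + 3))) := by
        unfold bubble; gcongr
    _ = (n + 1) * (‖z‖ ^ ((n : ℝ) + 1) * ‖z‖ ^ (-((n : ℝ) + 3))) := by
        rw [← Real.rpow_natCast]; push_cast; ring
    _ = _ := by rw [← Real.rpow_add hz]; ring_nf

/-- The scale parameters of the regularisation. -/
noncomputable def regParam (k : ℕ) : ℝ := (((k : ℝ) + 1) ^ 2)⁻¹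

theorem regParam_pos (k : ℕ) : 0 < regParam k := by unfold regParam; positivity

theorem tendsto_regParam : Tendsto regParam atTop (𝓝 0) := by
  have h1 : Tendsto (fun k : ℕ => (k : ℝ) + 1) atTop atTop :=
    tendsto_atTop_add_const_right _ _ tendsto_natCast_atTop_atTop
  exact ((tendsto_pow_atTop two_ne_zero).comp h1).inv_tendsto_atTop

/-- The choice `e = t⁻²` with `t = k + 1` makes the kernel exactly the rescaled bubble `t^N bubble(t
z)` times the cutoff. -/
theorem massProfile_regParam (k : ℕ) (z : AmbientSpace n) :
    massProfile χ n (regParam k) (sqNorm z) =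
      (((k : ℝ) + 1) ^ (n + 1) * bubble n (((k : ℝ) + 1) • z)) * χ (sqNorm z) := by
  unfold massProfile bubble regParam
  set t : ℝ := (k : ℝ) + 1
  have ht : 0 < t := by positivity
  have hq := sqNorm_nonneg z
  rw [sqNorm_smul]
  have h1 : sqNorm z + (t ^ 2)⁻¹ = (t ^ 2)⁻¹ * (t ^ 2 * sqNorm z + 1) := by
    field_simp
  have h2 : ((t ^ 2)⁻¹ : ℝ) ^ (kernelExponent n - 1) = t ^ (n + 3) := by
    rw [← Real.rpow_natCast t 2, ← Real.rpow_neg ht.le, ← Real.rpow_mul ht.le, ← Real.rpow_natCast]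
    congr 1
    unfold kernelExponent
    push_cast
    ring
  rw [h1, Real.mul_rpow (by positivity) (by positivity), h2]
  have h3 : t ^ (n + 3) = t ^ (n + 1) * t ^ 2 := by ring
  rw [h3]
  field_simp

theorem tendsto_integral_bubble_mul {g : AmbientSpace n → ℝ} (hg : Integrable g)
    (hg0 : ContinuousAt g 0) :
    Tendsto (fun k : ℕ => ∫ z, (((k : ℝ) + 1) ^ (n + 1) * bubble n (((k : ℝ) + 1) • z)) * g z)
      atTop (𝓝 ((∫ z, bubble n z) * g 0)) := by
  set c := ∫ z, bubble n z
  have hc : 0 < c := integral_bubble_pos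
  -- Peak functions must have mass one, hence the division by `c`, undone at the end. Their decay
  -- condition is `tendsto_norm_pow_mul_bubble`.
  have h := tendsto_integral_comp_smul_smul_of_integrable (μ := volume)
    (φ := fun z => c⁻¹ * bubble n z) (fun z => mul_nonneg (inv_nonneg.2 hc.le) (bubble_pos z).le)
    (by rw [integral_const_mul]; exact inv_mul_cancel₀ hc.ne')
    (by
      have := (tendsto_norm_pow_mul_bubble (n := n)).const_mul c⁻¹
      rw [mul_zero] at this
      refine this.congr fun z => ?_
      rw [finrank_ambientSpace]; ring) hg hg0
  have h1 : Tendsto (fun k : ℕ => (k : ℝ) + 1) atTop atTop :=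
    tendsto_atTop_add_const_right _ _ tendsto_natCast_atTop_atTop
  have h2 := (h.comp h1).const_mul c
  refine h2.congr fun k => ?_
  simp only [Function.comp_apply, finrank_ambientSpace, smul_eq_mul]
  rw [← integral_const_mul]
  congr 1
  ext z
  field_simp

namespace IsCutoff

theorem continuous_comp_sqNorm (h : IsCutoff χ ρ) :
    Continuous fun z : AmbientSpace n => χ (sqNorm z) :=
  h.contDiff.continuous.comp (contDiff_sqNorm (m := 0)).continuous

theorem tendsto_integral_massProfile_mul (h : IsCutoff χ ρ) {A : AmbientSpace n → ℝ}
    (hA : Continuous A) :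
    Tendsto (fun k => ∫ z, massProfile χ n (regParam k) (sqNorm z) * A z) atTop
      (𝓝 ((∫ z, bubble n z) * A 0)) := by
  have hc : Continuous fun z : AmbientSpace n => χ (sqNorm z) * A z :=
    h.continuous_comp_sqNorm.mul hA
  have h1 := tendsto_integral_bubble_mul (hc.integrable_of_hasCompactSupport
    (hasCompactSupport_comp_sqNorm h.eq_zero).mul_right) hc.continuousAt
  have h2 : χ (sqNorm (0 : AmbientSpace n)) = 1 := by simp [sqNorm, h.apply_zero]
  rw [h2, one_mul] at h1
  refine h1.congr fun k => ?_
  simp only [massProfile_regParam, mul_assoc]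

theorem contDiff_massKernel (h : IsCutoff χ ρ) {e : ℝ} (he : 0 < e) :
    ContDiff ℝ ∞ fun z : AmbientSpace n => massProfile χ n e (sqNorm z) :=
  contDiff_comp_sqNorm he h.contDiffOn_massProfile

theorem hasCompactSupport_massKernel (h : IsCutoff χ ρ) (e : ℝ) :
    HasCompactSupport fun z : AmbientSpace n => massProfile χ n e (sqNorm z) :=
  hasCompactSupport_comp_sqNorm fun _ => h.massProfile_eq_zero

/-- The bubble is positive, so these integrals are its integrals against `|χ(|z|²)|`; they converge
and are therefore bounded. -/
theorem exists_bound_integral_massKernel (h : IsCutoff χ ρ) : ∃ M : ℝ, ∀ k,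
    ∫ z : AmbientSpace n, |massProfile χ n (regParam k) (sqNorm z)| ≤ M := by
  have hc : Continuous fun z : AmbientSpace n => |χ (sqNorm z)| := h.continuous_comp_sqNorm.abs
  have h1 := tendsto_integral_bubble_mul (hc.integrable_of_hasCompactSupport
    ((hasCompactSupport_comp_sqNorm h.eq_zero).comp_left abs_zero)) hc.continuousAt
  obtain ⟨M, hM⟩ := h1.bddAbove_range
  refine ⟨M, fun k => le_trans (le_of_eq ?_) (hM ⟨k, rfl⟩)⟩
  congr 1
  ext z
  rw [massProfile_regParam, abs_mul, abs_of_nonneg (mul_nonneg (by positivity) (bubble_pos _).le)]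

/-- The regularisations of an integrable function converge to it in the sense of distributions. -/
theorem tendsto_integral_measureConv_massKernel (h : IsCutoff χ ρ) {f : AmbientSpace n → ℝ}
    (hf : Integrable f) {φ : AmbientSpace n → ℝ} (hφ : Continuous φ) (hφc : HasCompactSupport φ) :
    Tendsto (fun k => ∫ x, φ x *
      measureConv volume f (fun z => massProfile χ n (regParam k) (sqNorm z)) x) atTop
      (𝓝 ((∫ z, bubble n z) * ∫ x, φ x * f x)) := by
  obtain ⟨D, hD⟩ := hφc.exists_bound_of_continuous hφ
  obtain ⟨M, hM⟩ := h.exists_bound_integral_massKernel (n := n)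
  have hD0 : 0 ≤ D := (norm_nonneg _).trans (hD 0)
  have hcont : ∀ k, Continuous fun z : AmbientSpace n => massProfile χ n (regParam k) (sqNorm z) :=
    fun k => (h.contDiff_massKernel (regParam_pos k)).continuous
  have hint : ∀ k, Integrable fun z : AmbientSpace n => massProfile χ n (regParam k) (sqNorm z) :=
    fun k => (hcont k).integrable_of_hasCompactSupport (h.hasCompactSupport_massKernel _)
  -- Fubini moves the mollification from `f` to the continuous `φ`, where it converges pointwise;
  -- `|f|` times a constant then dominates.
  have hswap : ∀ k, ∫ x, φ x *
      measureConv volume f (fun z => massProfile χ n (regParam k) (sqNorm z)) x =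
      ∫ y, f y * ∫ z, massProfile χ n (regParam k) (sqNorm z) * φ (z + y) := by
    intro k
    obtain ⟨B, hB⟩ := (h.hasCompactSupport_massKernel (n := n)
      (regParam k)).exists_bound_of_continuous (hcont k)
    have hI : Integrable (Function.uncurry fun x y : AmbientSpace n =>
        φ x * (f y * massProfile χ n (regParam k) (sqNorm (x - y)))) (volume.prod volume) := by
      have h1 : Integrable (fun q : AmbientSpace n × AmbientSpace n => φ q.1 * f q.2)
          (volume.prod volume) := (hφ.integrable_of_hasCompactSupport hφc).mul_prod hf
      have h2 := h1.mul_bdd (g := fun q : AmbientSpace n × AmbientSpace n =>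
        massProfile χ n (regParam k) (sqNorm (q.1 - q.2))) (c := B)
        ((hcont k).comp (continuous_fst.sub continuous_snd)).aestronglyMeasurable
        (Eventually.of_forall fun q => hB _)
      refine h2.congr (Eventually.of_forall fun q => ?_)
      simp only [Function.uncurry, mul_assoc]
    calc ∫ x, φ x * measureConv volume f (fun z => massProfile χ n (regParam k) (sqNorm z)) x
        = ∫ x, ∫ y, φ x * (f y * massProfile χ n (regParam k) (sqNorm (x - y))) := by
          simp only [measureConv, integral_const_mul, smul_eq_mul]
      _ = ∫ y, ∫ x, φ x * (f y * massProfile χ n (regParam k) (sqNorm (x - y))) :=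
          integral_integral_swap hI
      _ = _ := by
          congr 1
          ext y
          rw [← integral_const_mul, ← integral_add_right_eq_self _ y]
          congr 1
          ext z
          rw [add_sub_cancel_right]
          ring
  simp only [hswap]
  have h3 : (∫ z, bubble n z) * ∫ x, φ x * f x = ∫ y, f y * ((∫ z, bubble n z) * φ y) := by
    rw [← integral_const_mul]
    congr 1
    ext y
    ring
  rw [h3]
  refine tendsto_integral_of_dominated_convergence (fun y => ‖f y‖ * (D * M)) (fun k => ?_)
    (hf.norm.mul_const _) (fun k => ?_) (Eventually.of_forall fun y => ?_)
  · refine hf.1.mul (Continuous.aestronglyMeasurable ?_)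
    refine continuous_of_dominated (bound := fun z => |massProfile χ n (regParam k) (sqNorm z)| * D)
      (fun y => ((hcont k).mul (hφ.comp (continuous_id.add continuous_const))).aestronglyMeasurable)
      (fun y => Eventually.of_forall fun z => ?_) ((hint k).abs.mul_const D)
      (Eventually.of_forall fun z => by fun_prop)
    rw [norm_mul, Real.norm_eq_abs]
    gcongr
    exact hD _
  · refine Eventually.of_forall fun y => ?_
    rw [norm_mul]
    gcongr
    calc ‖∫ z, massProfile χ n (regParam k) (sqNorm z) * φ (z + y)‖
        ≤ ∫ z, |massProfile χ n (regParam k) (sqNorm z)| * D := by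
          refine norm_integral_le_of_norm_le ((hint k).abs.mul_const D)
            (Eventually.of_forall fun z => ?_)
          rw [norm_mul, Real.norm_eq_abs]
          gcongr
          exact hD _
      _ ≤ D * M := by
          rw [integral_mul_const, mul_comm]
          gcongr
          exact hM k
  · have h4 := h.tendsto_integral_massProfile_mul (A := fun z => φ (z + y)) (by fun_prop)
    rw [zero_add] at h4
    exact h4.const_mul (f y)

end IsCutoff

end ApproximateIdentity

/-! ### Smooth approximation of a weak solution in `W^{1,p}` away from the boundary -/

section LocalApproximation

variable {χ : ℝ → ℝ} {ρ : ℝ} {n : ℕ}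

/-- A bounded piece of the half-space at distance at least `a` from the boundary. -/
def halfBall (n : ℕ) (R a : ℝ) : Set (AmbientSpace n) := {x | ‖x‖ < R ∧ a < x.2}

theorem isOpen_halfBall (R a : ℝ) : IsOpen (halfBall n R a) :=
  (isOpen_lt continuous_norm continuous_const).inter (isOpen_lt continuous_const continuous_snd)

theorem isBounded_halfBall (R a : ℝ) : Bornology.IsBounded (halfBall n R a) :=
  (Metric.isBounded_ball (x := 0) (r := R)).subset fun _ hx => mem_ball_zero_iff.2 hx.1

theorem volume_halfBall_lt_top (R a : ℝ) : volume (halfBall n R a) < ⊤ :=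
  (isBounded_halfBall R a).measure_lt_top

instance (R a : ℝ) : IsFiniteMeasure ((volume : Measure (AmbientSpace n)).restrict (halfBall n R a)) :=
  ⟨by simpa using volume_halfBall_lt_top R a⟩

theorem halfBall_subset_halfSpace {R a : ℝ} (ha : 0 ≤ a) : halfBall n R a ⊆ halfSpace n :=
  fun _ hx => ha.trans_lt hx.2

theorem halfBall_mono {R R' a a' : ℝ} (hR : R ≤ R') (ha : a' ≤ a) :
    halfBall n R a ⊆ halfBall n R' a' :=
  fun _ hx => ⟨hx.1.trans_le hR, ha.trans_lt hx.2⟩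

theorem MemL1LocUpToBoundary.integrableOn_halfBall {u : AmbientSpace n → ℝ}
    (hu : MemL1LocUpToBoundary u) {R a : ℝ} (ha : 0 ≤ a) : IntegrableOn u (halfBall n R a) :=
  hu _ (isOpen_halfBall R a) (isBounded_halfBall R a) (halfBall_subset_halfSpace ha)

namespace IsCutoff

theorem tendsto_eLpNorm_kernel {F : Type*} [NormedAddCommGroup F] {C : ℝ} {p : ℝ≥0} (hp : 1 ≤ p)
    (hpn : (p : ℝ) * n < n + 1) {g : ℕ → AmbientSpace n → F} {g' : AmbientSpace n → F}
    (hg : ∀ k, Continuous (g k)) (hC : ∀ k z, z ≠ 0 → ‖g k z‖ ≤ kernelBound n C z)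
    (hlim : ∀ z, z ≠ 0 → Tendsto (fun k => g k z) atTop (𝓝 (g' z))) :
    AEStronglyMeasurable g' volume ∧
      Tendsto (fun k => eLpNorm (g k - g') p volume) atTop (𝓝 0) := by
  have h0 : ∀ᵐ z : AmbientSpace n, z ≠ 0 := Measure.ae_ne volume 0
  have hl : ∀ᵐ z : AmbientSpace n, Tendsto (fun k => g k z) atTop (𝓝 (g' z)) := by
    filter_upwards [h0] with z hz using hlim z hz
  refine ⟨aestronglyMeasurable_of_tendsto_ae _ (fun k => (hg k).aestronglyMeasurable) hl,
    tendsto_eLpNorm_sub_of_dominated hp (fun k => (hg k).aestronglyMeasurable)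
      (memLp_kernelBound C hp hpn) (fun k => ?_) hl⟩
  filter_upwards [h0] with z hz using hC k z hz

theorem contDiff_potKernel (h : IsCutoff χ ρ) {e : ℝ} (he : 0 < e) :
    ContDiff ℝ ∞ fun z : AmbientSpace n => potProfile χ ρ n e (sqNorm z) :=
  contDiff_comp_sqNorm he (h.contDiffOn_potProfile he.le)

theorem hasCompactSupport_potKernel (h : IsCutoff χ ρ) (e : ℝ) :
    HasCompactSupport fun z : AmbientSpace n => potProfile χ ρ n e (sqNorm z) :=
  hasCompactSupport_comp_sqNorm fun _ => h.potProfile_eq_zero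

theorem contDiff_remKernel (h : IsCutoff χ ρ) {e : ℝ} (he : 0 < e) :
    ContDiff ℝ ∞ fun z : AmbientSpace n => remProfile χ n e (sqNorm z) :=
  contDiff_comp_sqNorm he h.contDiffOn_remProfile

theorem hasCompactSupport_remKernel (h : IsCutoff χ ρ) (e : ℝ) :
    HasCompactSupport fun z : AmbientSpace n => remProfile χ n e (sqNorm z) :=
  hasCompactSupport_comp_sqNorm fun _ => h.remProfile_eq_zero

/-- Potentials of finite measures: the regularisations converge in `W^{1,p}`. -/
theorem exists_tendsto_potKernel (hn : 1 ≤ n) (h : IsCutoff χ ρ) {p : ℝ≥0} (hp : 1 ≤ p)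
    (hpn : (p : ℝ) * n < n + 1) {m : Measure (AmbientSpace n)} [SFinite m] {f : AmbientSpace n → ℝ}
    (hf : Integrable f m) :
    ∃ (L : AmbientSpace n → ℝ) (L' : AmbientSpace n → AmbientSpace n →L[ℝ] ℝ),
      MemLp L p volume ∧ MemLp L' p volume ∧
      Tendsto (fun k => eLpNorm (measureConv m f
        (fun z => potProfile χ ρ n (regParam k) (sqNorm z)) - L) p volume) atTop (𝓝 0) ∧
      Tendsto (fun k => eLpNorm (measureConv m f (fderiv ℝ
        (fun z => potProfile χ ρ n (regParam k) (sqNorm z))) - L') p volume) atTop (𝓝 0) := by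
  obtain ⟨C, hC⟩ := exists_bound_potKernel hn h
  obtain ⟨C', hC'⟩ := h.exists_bound_gradKernel (n := n)
  have hcd := fun k => h.contDiff_potKernel (n := n) (regParam_pos k)
  have hcs := fun k => h.hasCompactSupport_potKernel (n := n) (regParam k)
  have h1 := tendsto_eLpNorm_kernel hp hpn (fun k => (hcd k).continuous)
    (fun k z hz => hC _ (regParam_pos k).le z hz)
    (fun z hz => h.tendsto_potProfile (fun k => (regParam_pos k).le) tendsto_regParam (sqNorm_pos hz))
  have h2 := tendsto_eLpNorm_kernel (g' := fun z => gradProfile χ n 0 (sqNorm z) • prodInner z)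
    hp hpn (fun k => (hcd k).continuous_fderiv (by simp))
    (fun k z hz => by
      rw [h.fderiv_potProfile (regParam_pos k)]
      exact hC' _ (regParam_pos k).le z hz)
    (fun z hz => by
      simp only [h.fderiv_potProfile (regParam_pos _)]
      exact (tendsto_gradProfile tendsto_regParam (sqNorm_pos hz)).smul_const _)
  obtain ⟨L, hL, tL⟩ := exists_tendsto_measureConv hf (fun k => (hcd k).continuous) hcs hp h1.2 h1.1
  obtain ⟨L', hL', tL'⟩ := exists_tendsto_measureConv hf
    (fun k => (hcd k).continuous_fderiv (by simp)) (fun k => (hcs k).fderiv ℝ) hp h2.2 h2.1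
  exact ⟨L, L', hL, hL', tL, tL'⟩

theorem exists_tendsto_remKernel (h : IsCutoff χ ρ) {p : ℝ≥0} (hp : 1 ≤ p)
    (hpn : (p : ℝ) * n < n + 1) {m : Measure (AmbientSpace n)} [SFinite m] {f : AmbientSpace n → ℝ}
    (hf : Integrable f m) :
    ∃ (L : AmbientSpace n → ℝ) (L' : AmbientSpace n → AmbientSpace n →L[ℝ] ℝ),
      MemLp L p volume ∧ MemLp L' p volume ∧
      Tendsto (fun k => eLpNorm (measureConv m f
        (fun z => remProfile χ n (regParam k) (sqNorm z)) - L) p volume) atTop (𝓝 0) ∧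
      Tendsto (fun k => eLpNorm (measureConv m f (fderiv ℝ
        (fun z => remProfile χ n (regParam k) (sqNorm z))) - L') p volume) atTop (𝓝 0) := by
  obtain ⟨C, hC⟩ := h.exists_bound_remKernel (n := n)
  obtain ⟨C', hC'⟩ := h.exists_bound_fderiv_remKernel (n := n)
  have hcd := fun k => h.contDiff_remKernel (n := n) (regParam_pos k)
  have hcs := fun k => h.hasCompactSupport_remKernel (n := n) (regParam k)
  have h1 := tendsto_eLpNorm_kernel hp hpn (fun k => (hcd k).continuous)
    (fun k z hz => hC _ (regParam_pos k).le z hz)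
    (fun z hz => tendsto_remProfile tendsto_regParam (sqNorm_pos hz))
  have h2 := tendsto_eLpNorm_kernel
    (g' := fun z => (2 * remProfileDeriv χ n 0 (sqNorm z)) • prodInner z)
    hp hpn (fun k => (hcd k).continuous_fderiv (by simp))
    (fun k z hz => by
      rw [h.fderiv_remProfile (regParam_pos k)]
      exact hC' _ (regParam_pos k).le z hz)
    (fun z hz => by
      simp only [h.fderiv_remProfile (regParam_pos _)]
      exact ((tendsto_remProfileDeriv tendsto_regParam (sqNorm_pos hz)).const_mul 2).smul_const _)
  obtain ⟨L, hL, tL⟩ := exists_tendsto_measureConv hf (fun k => (hcd k).continuous) hcs hp h1.2 h1.1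
  obtain ⟨L', hL', tL'⟩ := exists_tendsto_measureConv hf
    (fun k => (hcd k).continuous_fderiv (by simp)) (fun k => (hcs k).fderiv ℝ) hp h2.2 h2.1
  exact ⟨L, L', hL, hL', tL, tL'⟩

end IsCutoff

/-- The restriction to `W` of a measure on the half-space, as a measure on `ℝ^N`. -/
noncomputable def restrictToAmbient (m : Measure (halfSpace n)) (W : Set (AmbientSpace n)) :
    Measure (AmbientSpace n) :=
  (m.map Subtype.val).restrict W

/-- On this set `x_N > a`, so `a |μ|` is bounded by the weighted integral. -/
theorem LocalRadonMeasure.MemWeighted.isFiniteMeasure {μ : LocalRadonMeasure (halfSpace n)}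
    (hμ : μ.MemWeighted) {m : Measure (halfSpace n)} (hm : m ≤ μ.abs) {R a : ℝ} (ha : 0 < a) :
    IsFiniteMeasure (restrictToAmbient m (halfBall n R a)) := by
  constructor
  have hW := (isOpen_halfBall (n := n) R a).measurableSet
  rw [restrictToAmbient, Measure.restrict_apply_univ, Measure.map_apply measurable_subtype_coe hW]
  refine (hm _).trans_lt ?_
  set Ω : Set (halfSpace n) := Subtype.val ⁻¹' halfBall n R a
  have hΩ : Bornology.IsBounded Ω := by
    rw [← Bornology.isBounded_image_subtype_val]
    exact (isBounded_halfBall R a).subset (Set.image_preimage_subset _ _)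
  have h1 := hμ Ω hΩ
  have h2 : ENNReal.ofReal a * μ.abs Ω ≤
      ∫⁻ x in Ω, ENNReal.ofReal (x : AmbientSpace n).2 ∂μ.abs := by
    rw [← setLIntegral_const]
    exact setLIntegral_mono (by fun_prop) fun x hx => ENNReal.ofReal_le_ofReal hx.2.le
  by_contra h3
  rw [not_lt, top_le_iff] at h3
  rw [h3, ENNReal.mul_top (by simpa using ha), top_le_iff] at h2
  exact h1.ne h2

theorem integral_eq_measureConv (m : Measure (halfSpace n)) {W : Set (AmbientSpace n)}
    {g : AmbientSpace n → ℝ} {x : AmbientSpace n}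
    (hg : ∀ y, y ∉ W → g (x - y) = 0) :
    ∫ y : halfSpace n, g (x - y) ∂m = measureConv (restrictToAmbient m W) (fun _ => 1) g x := by
  unfold measureConv restrictToAmbient
  simp only [one_smul]
  rw [setIntegral_eq_integral_of_forall_compl_eq_zero hg,
    (MeasurableEmbedding.subtype_coe (isOpen_halfSpace n).measurableSet).integral_map]

/-- The kernels have radius `√ρ ≤ min(1, a/2)`, so centred at height above `a` they stay above `a/2`
and enlarge the ball by at most `1`. -/
theorem mem_halfBall_of_sqNorm_lt {R a : ℝ} (ha : 0 < a) (hρ : ρ ≤ 1) (hρa : ρ ≤ (a / 2) ^ 2)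
    {x y : AmbientSpace n} (hx : x ∈ halfBall n R a) (hxy : sqNorm (x - y) < ρ) :
    y ∈ halfBall n (R + 1) (a / 2) := by
  have h1 : ‖x - y‖ ≤ 1 := norm_le_one_of_sqNorm_le (hxy.le.trans hρ)
  have h2 : (x.2 - y.2) ^ 2 < (a / 2) ^ 2 := by
    refine lt_of_le_of_lt ?_ (hxy.trans_le hρa)
    simp only [sqNorm, Prod.snd_sub]
    nlinarith [sq_nonneg ‖(x - y).1‖]
  have h3 := abs_lt_of_sq_lt_sq h2 (by positivity)
  refine ⟨?_, ?_⟩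
  · have h4 : ‖y‖ ≤ ‖x‖ + ‖x - y‖ := by
      have := norm_sub_le x (x - y)
      rwa [sub_sub_cancel] at this
    linarith [hx.1]
  · linarith [hx.2, (abs_lt.1 h3).2]

theorem LocalRadonMeasure.pos_le_abs {X : Type*} [TopologicalSpace X] [T2Space X]
    [LocallyCompactSpace X] [MeasurableSpace X] [BorelSpace X] (μ : LocalRadonMeasure X) :
    μ.pos ≤ μ.abs := Measure.le_add_right le_rfl

theorem LocalRadonMeasure.neg_le_abs {X : Type*} [TopologicalSpace X] [T2Space X]
    [LocallyCompactSpace X] [MeasurableSpace X] [BorelSpace X] (μ : LocalRadonMeasure X) :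
    μ.neg ≤ μ.abs := Measure.le_add_left le_rfl

/-- The weak equation, tested with translates of the regularised fundamental solution. -/
theorem IsWeakSolution.measureConv_massKernel {μ : LocalRadonMeasure (halfSpace n)}
    {ν : LocalRadonMeasure (EuclideanSpace ℝ (Fin n))} {u : AmbientSpace n → ℝ}
    (hu : IsWeakSolution (-μ) ν u) (h : IsCutoff χ ρ) {R a : ℝ} (ha : 0 < a)
    (hρa : ρ ≤ (a / 2) ^ 2) {e : ℝ} (he : 0 < e) {x : AmbientSpace n} (hx : x ∈ halfBall n R a) :
    measureConv volume ((halfBall n (R + 1) 0).indicator u)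
      (fun z => massProfile χ n e (sqNorm z)) x =
    measureConv (restrictToAmbient μ.pos (halfBall n (R + 1) (a / 2))) (fun _ => 1)
      (fun z => potProfile χ ρ n e (sqNorm z)) x -
    measureConv (restrictToAmbient μ.neg (halfBall n (R + 1) (a / 2))) (fun _ => 1)
      (fun z => potProfile χ ρ n e (sqNorm z)) x -
    measureConv volume ((halfBall n (R + 1) 0).indicator u)
      (fun z => remProfile χ n e (sqNorm z)) x := by
  have hout : ∀ y, y ∉ halfBall n (R + 1) (a / 2) → ρ ≤ sqNorm (x - y) := fun y hy => by
    by_contra! hlt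
    exact hy (mem_halfBall_of_sqNorm_lt ha h.le_one hρa hx hlt)
  -- This test function vanishes for `y_N ≤ a/2`, so the boundary measure `ν` drops out and only the
  -- interior equation is used.
  set φ : AmbientSpace n → ℝ := fun y => potProfile χ ρ n e (sqNorm (x - y)) with hφ
  have hφ0 : ∀ y : AmbientSpace n, y.2 ≤ a / 2 → φ y = 0 := fun y hy =>
    h.potProfile_eq_zero (hout y fun hy' => not_lt.2 hy hy'.2)
  have htest : IsTestFunction φ := by
    refine ⟨?_, ?_, fun x' => hφ0 _ (by positivity)⟩
    · exact ((h.contDiff_potKernel he).of_le (by norm_cast)).comp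
        (contDiff_const.sub contDiff_id)
    · exact (h.hasCompactSupport_potKernel e).comp_homeomorph (Homeomorph.subLeft x)
  have hw := hu.2 φ htest
  have hν : ν.integral (fun x' => deriv (fun t : ℝ => φ (x', t)) 0) = 0 := by
    have : (fun x' => deriv (fun t : ℝ => φ (x', t)) 0) = fun _ => 0 := by
      ext x'
      have h1 : (fun t : ℝ => φ (x', t)) =ᶠ[𝓝 0] fun _ => 0 := by
        filter_upwards [Iio_mem_nhds (show (0 : ℝ) < a / 2 by positivity)] with t ht
        exact hφ0 _ (le_of_lt ht)
      rw [h1.deriv_eq, deriv_const]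
    rw [this]
    simp [LocalRadonMeasure.integral]
  have hint : Integrable ((halfBall n (R + 1) 0).indicator u) :=
    (integrable_indicator_iff (isOpen_halfBall _ _).measurableSet).2
      (hu.1.integrableOn_halfBall le_rfl)
  have hlap : ∫ y in halfSpace n, u y * -laplacianProd φ y =
      -(measureConv volume ((halfBall n (R + 1) 0).indicator u)
        (fun z => remProfile χ n e (sqNorm z)) x +
      measureConv volume ((halfBall n (R + 1) 0).indicator u)
        (fun z => massProfile χ n e (sqNorm z)) x) := by
    unfold measureConv
    rw [← integral_add (integrable_measureConv hint (h.contDiff_remKernel he).continuous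
        (h.hasCompactSupport_remKernel e) x)
      (integrable_measureConv hint (h.contDiff_massKernel he).continuous
        (h.hasCompactSupport_massKernel e) x), ← integral_neg,
      ← integral_indicator (isOpen_halfSpace n).measurableSet]
    congr 1
    ext y
    by_cases hy : y ∈ halfBall n (R + 1) (a / 2)
    · rw [Set.indicator_of_mem (halfBall_subset_halfSpace (by positivity) hy),
        Set.indicator_of_mem (halfBall_mono le_rfl (by positivity) hy), hφ,
        h.laplacianProd_potProfile he]
      simp only [smul_eq_mul]
      ring
    · have h1 := h.remProfile_eq_zero (n := n) (e := e) (hout y hy)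
      have h2 := h.massProfile_eq_zero (n := n) (e := e) (hout y hy)
      rw [h1, h2]
      simp only [Set.indicator, hφ, h.laplacianProd_potProfile he, h1, h2]
      simp
  rw [hν, hlap, LocalRadonMeasure.integral_neg, LocalRadonMeasure.integral] at hw
  have hg : ∀ y, y ∉ halfBall n (R + 1) (a / 2) → potProfile χ ρ n e (sqNorm (x - y)) = 0 :=
    fun y hy => h.potProfile_eq_zero (hout y hy)
  rw [← integral_eq_measureConv μ.pos (g := fun z => potProfile χ ρ n e (sqNorm z)) hg,
    ← integral_eq_measureConv μ.neg (g := fun z => potProfile χ ρ n e (sqNorm z)) hg]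
  linarith

theorem memLp_halfBall_of_continuous {F : Type*} [NormedAddCommGroup F]
    {g : AmbientSpace n → F} (hg : Continuous g) (R a : ℝ) (p : ENNReal) :
    MemLp g p (volume.restrict (halfBall n R a)) := by
  obtain ⟨C, hC⟩ := (isCompact_closedBall (0 : AmbientSpace n) R).exists_bound_of_continuousOn
    hg.continuousOn
  refine MemLp.of_bound hg.aestronglyMeasurable C ?_
  filter_upwards [ae_restrict_mem (isOpen_halfBall R a).measurableSet] with x hx
  exact hC x (mem_closedBall_zero_iff.2 hx.1.le)

/-- A weak solution is locally a limit of smooth functions in `W^{1,p}`. -/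
theorem IsWeakSolution.exists_local_approx (hn : 1 ≤ n) {μ : LocalRadonMeasure (halfSpace n)}
    (hμ : μ.MemWeighted) {ν : LocalRadonMeasure (EuclideanSpace ℝ (Fin n))}
    {u : AmbientSpace n → ℝ} (hu : IsWeakSolution (-μ) ν u) {p : ℝ≥0} (hp : 1 ≤ p)
    (hpn : (p : ℝ) * n < n + 1) (R : ℝ) {a : ℝ} (ha : 0 < a) :
    ∃ (G : AmbientSpace n → AmbientSpace n →L[ℝ] ℝ) (v : ℕ → AmbientSpace n → ℝ),
      (∀ k, ContDiff ℝ ∞ (v k)) ∧ MemLp u p (volume.restrict (halfBall n R a)) ∧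
      MemLp G p (volume.restrict (halfBall n R a)) ∧
      Tendsto (fun k => eLpNorm (v k - u) p (volume.restrict (halfBall n R a))) atTop (𝓝 0) ∧
      Tendsto (fun k => eLpNorm (fderiv ℝ (v k) - G) p (volume.restrict (halfBall n R a)))
        atTop (𝓝 0) := by
  -- The two entries of the minimum are the two conditions on `ρ` in `mem_halfBall_of_sqNorm_lt`.
  obtain ⟨χ, h⟩ := exists_isCutoff (ρ := min 1 ((a / 2) ^ 2)) (by positivity) (min_le_left _ _)
  set U := halfBall n R a with hU
  have hUo : IsOpen U := isOpen_halfBall R a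
  set W := halfBall n (R + 1) (a / 2)
  set f : AmbientSpace n → ℝ := (halfBall n (R + 1) 0).indicator u with hf
  have hfint : Integrable f := (integrable_indicator_iff (isOpen_halfBall _ _).measurableSet).2
    (hu.1.integrableOn_halfBall le_rfl)
  set m₁ := restrictToAmbient μ.pos W
  set m₂ := restrictToAmbient μ.neg W
  have : IsFiniteMeasure m₁ := hμ.isFiniteMeasure μ.pos_le_abs (by positivity)
  have : IsFiniteMeasure m₂ := hμ.isFiniteMeasure μ.neg_le_abs (by positivity)
  have i₁ : Integrable (fun _ : AmbientSpace n => (1 : ℝ)) m₁ := integrable_const 1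
  have i₂ : Integrable (fun _ : AmbientSpace n => (1 : ℝ)) m₂ := integrable_const 1
  obtain ⟨A, A', hA, hA', tA, tA'⟩ := h.exists_tendsto_potKernel hn hp hpn i₁
  obtain ⟨B, B', hB, hB', tB, tB'⟩ := h.exists_tendsto_potKernel hn hp hpn i₂
  obtain ⟨C, C', hC, hC', tC, tC'⟩ := h.exists_tendsto_remKernel hp hpn hfint
  set c := ∫ z, bubble n z
  have hc : 0 < c := integral_bubble_pos
  have hpcd := fun k => h.contDiff_potKernel (n := n) (regParam_pos k)
  have hpcs := fun k => h.hasCompactSupport_potKernel (n := n) (regParam k)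
  have hrcd := fun k => h.contDiff_remKernel (n := n) (regParam_pos k)
  have hrcs := fun k => h.hasCompactSupport_remKernel (n := n) (regParam k)
  have hmcd := fun k => h.contDiff_massKernel (n := n) (regParam_pos k)
  have hmcs := fun k => h.hasCompactSupport_massKernel (n := n) (regParam k)
  -- The approximations are normalised mollifications of `u` cut off to a larger half-ball. They are
  -- smooth on the whole space, while on `U` the weak equation rewrites them through kernels
  -- converging in `W^{1,p}`.
  set v : ℕ → AmbientSpace n → ℝ := fun k => c⁻¹ • measureConv volume f
    (fun z => massProfile χ n (regParam k) (sqNorm z)) with hv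
  have hvcd : ∀ k, ContDiff ℝ ∞ (v k) := fun k =>
    contDiff_const.smul ((hmcs k).contDiff_convolution_right (ContinuousLinearMap.lsmul ℝ ℝ)
      hfint.locallyIntegrable (hmcd k))
  have hvU : ∀ k, ∀ x ∈ U, v k x = c⁻¹ • (measureConv m₁ (fun _ => 1)
      (fun z => potProfile χ (min 1 ((a / 2) ^ 2)) n (regParam k) (sqNorm z)) x -
      measureConv m₂ (fun _ => 1)
      (fun z => potProfile χ (min 1 ((a / 2) ^ 2)) n (regParam k) (sqNorm z)) x -
      measureConv volume f (fun z => remProfile χ n (regParam k) (sqNorm z)) x) := by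
    intro k x hx
    rw [← hu.measureConv_massKernel h ha (min_le_right _ _) (regParam_pos k) hx]
    rfl
  have hvU' : ∀ k, ∀ x ∈ U, fderiv ℝ (v k) x = c⁻¹ • (measureConv m₁ (fun _ => 1) (fderiv ℝ
      (fun z => potProfile χ (min 1 ((a / 2) ^ 2)) n (regParam k) (sqNorm z))) x -
      measureConv m₂ (fun _ => 1) (fderiv ℝ
      (fun z => potProfile χ (min 1 ((a / 2) ^ 2)) n (regParam k) (sqNorm z))) x -
      measureConv volume f (fderiv ℝ (fun z => remProfile χ n (regParam k) (sqNorm z))) x) := by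
    intro k x hx
    have h1 := (((hasFDerivAt_measureConv i₁ ((hpcd k).of_le (by simp)) (hpcs k) x).sub
      (hasFDerivAt_measureConv i₂ ((hpcd k).of_le (by simp)) (hpcs k) x)).sub
      (hasFDerivAt_measureConv hfint ((hrcd k).of_le (by simp)) (hrcs k) x)).const_smul c⁻¹
    refine HasFDerivAt.fderiv (h1.congr_of_eventuallyEq ?_)
    filter_upwards [hUo.mem_nhds hx] with y hy
    exact hvU k y hy
  have cont₁ := fun k => continuous_measureConv i₁ (hpcd k).continuous (hpcs k)
  have cont₂ := fun k => continuous_measureConv i₂ (hpcd k).continuous (hpcs k)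
  have cont₃ := fun k => continuous_measureConv hfint (hrcd k).continuous (hrcs k)
  have cont₁' := fun k => continuous_measureConv i₁ ((hpcd k).continuous_fderiv (by simp))
    ((hpcs k).fderiv ℝ)
  have cont₂' := fun k => continuous_measureConv i₂ ((hpcd k).continuous_fderiv (by simp))
    ((hpcs k).fderiv ℝ)
  have cont₃' := fun k => continuous_measureConv hfint ((hrcd k).continuous_fderiv (by simp))
    ((hrcs k).fderiv ℝ)
  have hlim := tendsto_eLpNorm_combination hUo.measurableSet hp c⁻¹
    (fun k => (cont₁ k).aestronglyMeasurable.sub hA.1)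
    (fun k => (cont₂ k).aestronglyMeasurable.sub hB.1)
    (fun k => (cont₃ k).aestronglyMeasurable.sub hC.1) hvU tA tB tC
  have hlim' := tendsto_eLpNorm_combination hUo.measurableSet hp c⁻¹
    (fun k => (cont₁' k).aestronglyMeasurable.sub hA'.1)
    (fun k => (cont₂' k).aestronglyMeasurable.sub hB'.1)
    (fun k => (cont₃' k).aestronglyMeasurable.sub hC'.1) hvU' tA' tB' tC'
  set ℓ := c⁻¹ • (A - B - C) with hℓ
  have hℓp : MemLp ℓ p (volume.restrict U) := (((hA.sub hB).sub hC).const_smul _).restrict U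
  have hvp : ∀ k, MemLp (v k) p (volume.restrict U) := fun k =>
    memLp_halfBall_of_continuous (hvcd k).continuous R a p
  have huint : IntegrableOn u U := hu.1.integrableOn_halfBall ha.le
  -- The mollifications converge to `ℓ` in `L^p` and to `u` as distributions, so the two limits
  -- agree almost everywhere on `U`.
  have hae : u =ᵐ[volume.restrict U] ℓ := by
    have h1 : ∀ᵐ x, x ∈ U → ℓ x - u x = 0 := by
      refine hUo.ae_eq_zero_of_integral_contDiff_smul_eq_zero (f := fun x => ℓ x - u x) ?_ ?_
      · have hi : IntegrableOn (fun x => ℓ x - u x) U :=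
          (hℓp.integrable (by exact_mod_cast hp)).sub huint
        exact hi.locallyIntegrableOn
      · intro g hg hgc hgU
        obtain ⟨D, hD⟩ := hgc.exists_bound_of_continuous hg.continuous
        have hgz : ∀ w : AmbientSpace n → ℝ, ∫ x in U, g x * w x = ∫ x, g x * w x := fun w =>
          setIntegral_eq_integral_of_forall_compl_eq_zero fun x hx => by
            rw [image_eq_zero_of_notMem_tsupport fun hx' => hx (hgU hx'), zero_mul]
        have t1 := tendsto_integral_mul_of_tendsto_eLpNorm hp hvp hℓp
          hg.continuous.aestronglyMeasurable hD hlim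
        have t2 := (h.tendsto_integral_measureConv_massKernel hfint hg.continuous hgc).const_mul c⁻¹
        have t3 : ∫ x, g x * f x = ∫ x in U, g x * u x := by
          rw [← hgz f]
          refine setIntegral_congr_fun hUo.measurableSet fun x hx => ?_
          simp only [hf]
          rw [Set.indicator_of_mem (halfBall_mono (by linarith) ha.le hx)]
        have t4 : ∫ x in U, g x * ℓ x = ∫ x in U, g x * u x := by
          refine tendsto_nhds_unique t1 ?_
          rw [← t3]
          convert t2 using 1
          · ext k
            rw [hgz, ← integral_const_mul]
            congr 1
            ext x
            simp only [hv, Pi.smul_apply, smul_eq_mul]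
            ring
          · rw [← mul_assoc, inv_mul_cancel₀ hc.ne', one_mul]
        have e1 : ∫ x, g x • (ℓ x - u x) = ∫ x in U, g x * (ℓ x - u x) := (hgz _).symm
        rw [e1]
        simp only [mul_sub]
        rw [integral_sub, t4, sub_self]
        · exact (hℓp.integrable (by exact_mod_cast hp)).bdd_mul
            hg.continuous.aestronglyMeasurable (Eventually.of_forall hD)
        · exact huint.bdd_mul hg.continuous.aestronglyMeasurable (Eventually.of_forall hD)
    rw [EventuallyEq, ae_restrict_iff' hUo.measurableSet]
    filter_upwards [h1] with x hx hxU
    linarith [hx hxU]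
  refine ⟨c⁻¹ • (A' - B' - C'), v, hvcd, hℓp.ae_eq hae.symm,
    (((hA'.sub hB').sub hC').const_smul _).restrict U, ?_, hlim'⟩
  refine hlim.congr fun k => eLpNorm_congr_ae ?_
  filter_upwards [hae] with x hx
  simp only [Pi.sub_apply, hx]

end LocalApproximation

/-! ### Gluing the local gradients into a weak gradient on the half-space -/

section WeakGradient

variable {n : ℕ}

/-- An exhaustion of the half-space by bounded open sets. -/
def halfExhaustion (n j : ℕ) : Set (AmbientSpace n) := halfBall n (j + 1) ((j : ℝ) + 1)⁻¹

theorem halfExhaustion_mono : Monotone (halfExhaustion n) := fun i j hij => by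
  have h : (i : ℝ) ≤ j := by exact_mod_cast hij
  exact halfBall_mono (by linarith) (by gcongr)

theorem isOpen_halfExhaustion (j : ℕ) : IsOpen (halfExhaustion n j) := isOpen_halfBall _ _

theorem halfBall_subset_halfExhaustion (R : ℝ) {a : ℝ} (ha : 0 < a) :
    ∃ j, halfBall n R a ⊆ halfExhaustion n j := by
  obtain ⟨j, hj⟩ := exists_nat_ge (max R a⁻¹)
  have h1 : R ≤ (j : ℝ) + 1 := by linarith [le_max_left R a⁻¹]
  have h2 : a⁻¹ ≤ (j : ℝ) + 1 := by linarith [le_max_right R a⁻¹]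
  exact ⟨j, halfBall_mono h1 (inv_le_of_inv_le₀ ha h2)⟩

theorem exists_mem_halfExhaustion {x : AmbientSpace n} (hx : x ∈ halfSpace n) :
    ∃ j, x ∈ halfExhaustion n j := by
  have hx' : 0 < x.2 := hx
  obtain ⟨j, hj⟩ := halfBall_subset_halfExhaustion (n := n) (‖x‖ + 1) (half_pos hx')
  exact ⟨j, hj ⟨by linarith, by linarith⟩⟩

theorem IsCompact.subset_halfExhaustion {K : Set (AmbientSpace n)} (hK : IsCompact K)
    (hKs : K ⊆ halfSpace n) : ∃ j, K ⊆ halfExhaustion n j :=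
  hK.elim_directed_cover _ isOpen_halfExhaustion
    (fun _ hx => Set.mem_iUnion.2 (exists_mem_halfExhaustion (hKs hx)))
    halfExhaustion_mono.directed_le

theorem tendsto_eLpNorm_apply {μ : Measure (AmbientSpace n)} {p : ENNReal}
    {g : ℕ → AmbientSpace n → AmbientSpace n →L[ℝ] ℝ} {G : AmbientSpace n → AmbientSpace n →L[ℝ] ℝ}
    (h : Tendsto (fun k => eLpNorm (g k - G) p μ) atTop (𝓝 0)) (v : AmbientSpace n) :
    Tendsto (fun k => eLpNorm ((fun x => g k x v) - fun x => G x v) p μ) atTop (𝓝 0) := by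
  have h1 := ENNReal.Tendsto.const_mul (a := ENNReal.ofReal ‖v‖) h (Or.inr (by simp))
  rw [mul_zero] at h1
  refine tendsto_of_tendsto_of_tendsto_of_le_of_le tendsto_const_nhds h1 (fun _ => zero_le)
    fun k => eLpNorm_le_mul_eLpNorm_of_ae_le_mul (Eventually.of_forall fun x => ?_) p
  rw [mul_comm]
  exact (g k x - G x).le_opNorm v

theorem setIntegral_eq_integral_of_tsupport_subset {φ w : AmbientSpace n → ℝ}
    {U : Set (AmbientSpace n)} (hφ : tsupport φ ⊆ U) : ∫ x in U, w x * φ x = ∫ x, w x * φ x :=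
  setIntegral_eq_integral_of_forall_compl_eq_zero fun x hx => by
    rw [image_eq_zero_of_notMem_tsupport fun hx' => hx (hφ hx'), mul_zero]

/-- Limits in `W^{1,p}` of smooth functions have a weak gradient. -/
theorem integral_mul_fderiv_of_approx {R a : ℝ} {p : ℝ≥0} (hp : 1 ≤ p) {u : AmbientSpace n → ℝ}
    {G : AmbientSpace n → AmbientSpace n →L[ℝ] ℝ} {w : ℕ → AmbientSpace n → ℝ}
    (hw : ∀ k, ContDiff ℝ ∞ (w k)) (hu : MemLp u p (volume.restrict (halfBall n R a)))
    (hG : MemLp G p (volume.restrict (halfBall n R a)))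
    (tu : Tendsto (fun k => eLpNorm (w k - u) p (volume.restrict (halfBall n R a))) atTop (𝓝 0))
    (tG : Tendsto (fun k => eLpNorm (fderiv ℝ (w k) - G) p (volume.restrict (halfBall n R a)))
      atTop (𝓝 0)) {φ : AmbientSpace n → ℝ} (hφ : ContDiff ℝ ∞ φ) (hφc : HasCompactSupport φ)
    (hφU : tsupport φ ⊆ halfBall n R a) (v : AmbientSpace n) :
    ∫ x, u x * fderiv ℝ φ x v = -∫ x, G x v * φ x := by
  have hφ' : Continuous fun x => fderiv ℝ φ x v := (hφ.continuous_fderiv (by simp)).clm_apply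
    continuous_const
  have hφc' : HasCompactSupport fun x => fderiv ℝ φ x v :=
    hφc.mono' ((subset_tsupport _).trans (tsupport_fderiv_apply_subset ℝ v))
  obtain ⟨C, hC⟩ := hφc.exists_bound_of_continuous hφ.continuous
  obtain ⟨C', hC'⟩ := hφc'.exists_bound_of_continuous hφ'
  have hwv : ∀ k, Continuous fun x => fderiv ℝ (w k) x v := fun k =>
    ((hw k).continuous_fderiv (by simp)).clm_apply continuous_const
  have hGv : MemLp (fun x => G x v) p (volume.restrict (halfBall n R a)) :=
    (ContinuousLinearMap.apply ℝ ℝ v).comp_memLp' hG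
  have t1 := tendsto_integral_mul_of_tendsto_eLpNorm hp
    (fun k => memLp_halfBall_of_continuous (hw k).continuous R a p) hu
    hφ'.aestronglyMeasurable hC' tu
  have t2 := tendsto_integral_mul_of_tendsto_eLpNorm hp
    (fun k => memLp_halfBall_of_continuous (hwv k) R a p) hGv
    hφ.continuous.aestronglyMeasurable hC (tendsto_eLpNorm_apply tG v)
  simp only [mul_comm (fderiv ℝ φ _ v), mul_comm (φ _)] at t1 t2
  have hφU' := (tsupport_fderiv_apply_subset (f := φ) ℝ v).trans hφU
  simp only [setIntegral_eq_integral_of_tsupport_subset hφU,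
    setIntegral_eq_integral_of_tsupport_subset hφU'] at t1 t2
  -- Classical integration by parts for `w k` passes to the limit on both sides.
  refine tendsto_nhds_unique (t1.congr fun k => ?_) t2.neg
  refine integral_mul_fderiv_eq_neg_fderiv_mul_of_integrable ?_ ?_ ?_
    (fun x _ => (hw k).differentiable (by simp) x) (fun x _ => hφ.differentiable (by simp) x)
  · exact ((hwv k).mul hφ.continuous).integrable_of_hasCompactSupport hφc.mul_left
  · exact ((hw k).continuous.mul hφ').integrable_of_hasCompactSupport hφc'.mul_left
  · exact ((hw k).continuous.mul hφ.continuous).integrable_of_hasCompactSupport hφc.mul_left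

/-- The fundamental lemma of the calculus of variations, applied to the operator-valued difference;
evaluation at `v` commutes with the integral. -/
theorem weakGradient_unique {U : Set (AmbientSpace n)} (hU : IsOpen U)
    {G G' : AmbientSpace n → AmbientSpace n →L[ℝ] ℝ} (hG : IntegrableOn G U)
    (hG' : IntegrableOn G' U)
    (h : ∀ φ : AmbientSpace n → ℝ, ContDiff ℝ ∞ φ → HasCompactSupport φ → tsupport φ ⊆ U →
      ∀ v, ∫ x in U, G x v * φ x = ∫ x in U, G' x v * φ x) :
    ∀ᵐ x, x ∈ U → G x = G' x := by
  have key := hU.ae_eq_zero_of_integral_contDiff_smul_eq_zero (μ := volume)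
    (f := fun x => G x - G' x) (IntegrableOn.locallyIntegrableOn (hG.sub hG')) ?_
  · filter_upwards [key] with x hx hxU using sub_eq_zero.1 (hx hxU)
  · intro φ hφ hφc hφU
    obtain ⟨C, hC⟩ := hφc.exists_bound_of_continuous hφ.continuous
    have hi : ∀ H : AmbientSpace n → AmbientSpace n →L[ℝ] ℝ, IntegrableOn H U →
        IntegrableOn (fun x => φ x • H x) U := fun H hH =>
      hH.bdd_smul C hφ.continuous.aestronglyMeasurable (Eventually.of_forall hC)
    have e1 : ∫ x, φ x • (G x - G' x) = ∫ x in U, φ x • (G x - G' x) :=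
      (setIntegral_eq_integral_of_forall_compl_eq_zero fun x hx => by
        rw [image_eq_zero_of_notMem_tsupport fun hx' => hx (hφU hx'), zero_smul]).symm
    rw [e1]
    simp only [smul_sub]
    rw [integral_sub (hi G hG) (hi G' hG'), sub_eq_zero]
    refine ContinuousLinearMap.ext fun v => ?_
    rw [ContinuousLinearMap.integral_apply (hi G hG), ContinuousLinearMap.integral_apply (hi G' hG')]
    simpa only [smul_apply, smul_eq_mul, mul_comm] using h φ hφ hφc hφU v

/-- The pair `(u, G)` is locally, away from the boundary, a limit of smooth functions in
`W^{1,p}`. -/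
def LocallyApproximable (p : ℝ≥0) (u : AmbientSpace n → ℝ)
    (G : AmbientSpace n → AmbientSpace n →L[ℝ] ℝ) : Prop :=
  ∀ (R a : ℝ), 0 < a → ∃ v : ℕ → AmbientSpace n → ℝ, (∀ k, ContDiff ℝ ∞ (v k)) ∧
    MemLp u p (volume.restrict (halfBall n R a)) ∧
    MemLp G p (volume.restrict (halfBall n R a)) ∧
    Tendsto (fun k => eLpNorm (v k - u) p (volume.restrict (halfBall n R a))) atTop (𝓝 0) ∧
    Tendsto (fun k => eLpNorm (fderiv ℝ (v k) - G) p (volume.restrict (halfBall n R a)))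
      atTop (𝓝 0)

/-- A weak solution has a weak gradient `G` on the half-space such that `(u, G)` is locally the
limit of smooth functions in `W^{1,p}`. -/
theorem IsWeakSolution.exists_gradient (hn : 1 ≤ n) {μ : LocalRadonMeasure (halfSpace n)}
    (hμ : μ.MemWeighted) {ν : LocalRadonMeasure (EuclideanSpace ℝ (Fin n))}
    {u : AmbientSpace n → ℝ} (hu : IsWeakSolution (-μ) ν u) {p : ℝ≥0} (hp : 1 ≤ p)
    (hpn : (p : ℝ) * n < n + 1) :
    ∃ G : AmbientSpace n → AmbientSpace n →L[ℝ] ℝ, LocallyApproximable p u G := by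
  classical
  have hp' : (1 : ENNReal) ≤ p := by exact_mod_cast hp
  choose Gs vs hvs hus hGs tus tGs using fun j : ℕ =>
    hu.exists_local_approx hn hμ hp hpn (j + 1) (a := ((j : ℝ) + 1)⁻¹) (by positivity)
  have hagree : ∀ i j, i ≤ j → ∀ᵐ x, x ∈ halfExhaustion n i → Gs i x = Gs j x := by
    intro i j hij
    have hsub := halfExhaustion_mono (n := n) hij
    refine weakGradient_unique (isOpen_halfExhaustion i) ((hGs i).integrable hp')
      (IntegrableOn.mono_set ((hGs j).integrable hp') hsub) fun φ hφ hφc hφU v => ?_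
    have h1 := integral_mul_fderiv_of_approx hp (hvs i) (hus i) (hGs i) (tus i) (tGs i) hφ hφc
      hφU v
    have h2 := integral_mul_fderiv_of_approx hp (hvs j) (hus j) (hGs j) (tus j) (tGs j) hφ hφc
      (hφU.trans hsub) v
    rw [setIntegral_eq_integral_of_tsupport_subset hφU,
      setIntegral_eq_integral_of_tsupport_subset hφU]
    linarith
  -- Each point uses the first set of the exhaustion that contains it. As the exhaustion is
  -- countable, the pairwise agreements hold simultaneously outside one null set.
  let G : AmbientSpace n → AmbientSpace n →L[ℝ] ℝ := fun x =>
    if h : ∃ j, x ∈ halfExhaustion n j then Gs (Nat.find h) x else 0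
  have hG : ∀ j, G =ᵐ[volume.restrict (halfExhaustion n j)] Gs j := by
    intro j
    rw [EventuallyEq, ae_restrict_iff' (isOpen_halfExhaustion j).measurableSet]
    have h1 : ∀ᵐ x, ∀ i, i ≤ j → x ∈ halfExhaustion n i → Gs i x = Gs j x := by
      rw [ae_all_iff]
      intro i
      by_cases hij : i ≤ j
      · filter_upwards [hagree i j hij] with x hx _ using hx
      · exact Eventually.of_forall fun x h => absurd h hij
    filter_upwards [h1] with x hx hxj
    have h2 : ∃ j, x ∈ halfExhaustion n j := ⟨j, hxj⟩
    simp only [G, dif_pos h2]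
    exact hx _ (Nat.find_min' h2 hxj) (Nat.find_spec h2)
  refine ⟨G, fun R a ha => ?_⟩
  obtain ⟨j, hj⟩ := halfBall_subset_halfExhaustion (n := n) R ha
  have hle : volume.restrict (halfBall n R a) ≤ volume.restrict (halfExhaustion n j) :=
    Measure.restrict_mono hj le_rfl
  refine ⟨vs j, hvs j, (hus j).mono_measure hle, ((hGs j).ae_eq (hG j).symm).mono_measure hle,
    ?_, ?_⟩
  · exact tendsto_of_tendsto_of_tendsto_of_le_of_le tendsto_const_nhds (tus j) (fun _ => zero_le)
      fun k => eLpNorm_mono_measure _ hle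
  · refine tendsto_of_tendsto_of_tendsto_of_le_of_le tendsto_const_nhds (tGs j) (fun _ => zero_le)
      fun k => (eLpNorm_mono_measure _ hle).trans_eq (eLpNorm_congr_ae ?_)
    filter_upwards [hG j] with x hx
    simp only [Pi.sub_apply, hx]

namespace LocallyApproximable

variable {p : ℝ≥0} {u : AmbientSpace n → ℝ} {G : AmbientSpace n → AmbientSpace n →L[ℝ] ℝ}

theorem memLp_restrict (h : LocallyApproximable p u G) {K : Set (AmbientSpace n)}
    (hK : IsCompact K) (hKs : K ⊆ halfSpace n) :
    MemLp u p (volume.restrict K) ∧ MemLp G p (volume.restrict K) := by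
  obtain ⟨j, hj⟩ := hK.subset_halfExhaustion hKs
  obtain ⟨v, -, hu, hG, -⟩ := h (j + 1) ((j : ℝ) + 1)⁻¹ (by positivity)
  exact ⟨hu.mono_measure (Measure.restrict_mono hj le_rfl),
    hG.mono_measure (Measure.restrict_mono hj le_rfl)⟩

theorem isWeakFDeriv (h : LocallyApproximable p u G) (hp : 1 ≤ p) : IsWeakFDeriv u G := by
  have hp' : (1 : ENNReal) ≤ p := by exact_mod_cast hp
  refine ⟨?_, ?_, fun φ hφ hφc hφU v => ?_⟩
  · rw [locallyIntegrableOn_iff (isOpen_halfSpace n).isLocallyClosed]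
    intro K hKs hK
    have : IsFiniteMeasure (volume.restrict K) := ⟨by simpa using hK.measure_lt_top⟩
    exact (h.memLp_restrict hK hKs).1.integrable hp'
  · rw [locallyIntegrableOn_iff (isOpen_halfSpace n).isLocallyClosed]
    intro K hKs hK
    have : IsFiniteMeasure (volume.restrict K) := ⟨by simpa using hK.measure_lt_top⟩
    exact (h.memLp_restrict hK hKs).2.integrable hp'
  · obtain ⟨j, hj⟩ := IsCompact.subset_halfExhaustion hφc hφU
    obtain ⟨w, hw, hu, hG, tu, tG⟩ := h (j + 1) ((j : ℝ) + 1)⁻¹ (by positivity)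
    rw [setIntegral_eq_integral_of_tsupport_subset
        ((tsupport_fderiv_apply_subset (f := φ) ℝ v).trans hφU),
      setIntegral_eq_integral_of_tsupport_subset hφU]
    exact integral_mul_fderiv_of_approx hp hw hu hG tu tG hφ hφc hj v

theorem memW1Loc (h : LocallyApproximable p u G) (hp : 1 ≤ p) : MemW1Loc p u :=
  ⟨G, h.isWeakFDeriv hp, fun _ hK hKs => h.memLp_restrict hK hKs⟩

end LocallyApproximable

end WeakGradient

/-! ### An explicit formula for the trace on `x_N = ε` -/

section SobolevTrace

variable {n : ℕ}

/-- The integrand of the representation of the trace on `x_N = ε`. -/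
noncomputable def traceIntegrand (u : AmbientSpace n → ℝ)
    (G : AmbientSpace n → AmbientSpace n →L[ℝ] ℝ) (ε : ℝ) (z : AmbientSpace n) : ℝ :=
  u (z.1, ε + z.2) - (1 - z.2) * G (z.1, ε + z.2) (0, 1)

/-- The trace on `x_N = ε` of a function `u` with weak gradient `G`. -/
noncomputable def sobolevTrace (u : AmbientSpace n → ℝ)
    (G : AmbientSpace n → AmbientSpace n →L[ℝ] ℝ) (ε : ℝ) (x' : EuclideanSpace ℝ (Fin n)) : ℝ :=
  ∫ s in Set.Ioo (0 : ℝ) 1, traceIntegrand u G ε (x', s)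

instance : IsProbabilityMeasure ((volume : Measure ℝ).restrict (Set.Ioo 0 1)) := ⟨by simp⟩

/-- The cylinder `B'_R × (ε, ε + 1)`. -/
def unitCylinder (n : ℕ) (R ε : ℝ) : Set (AmbientSpace n) := Metric.ball 0 R ×ˢ Set.Ioo ε (ε + 1)

theorem measurePreserving_shift (R ε : ℝ) :
    MeasurePreserving (fun z : AmbientSpace n => (z.1, ε + z.2))
      ((volume.restrict (Metric.ball 0 R)).prod (volume.restrict (Set.Ioo 0 1)))
      (volume.restrict (unitCylinder n R ε)) := by
  have h1 : MeasurePreserving (fun s : ℝ => ε + s) (volume.restrict (Set.Ioo 0 1))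
      (volume.restrict (Set.Ioo ε (ε + 1))) := by
    have := (measurePreserving_add_left (volume : Measure ℝ) ε).restrict_preimage
      (measurableSet_Ioo (a := ε) (b := ε + 1))
    rwa [Set.preimage_const_add_Ioo, sub_self, add_sub_cancel_left] at this
  have h2 := (MeasurePreserving.id
    ((volume : Measure (EuclideanSpace ℝ (Fin n))).restrict (Metric.ball 0 R))).prod h1
  rw [Measure.prod_restrict (Metric.ball 0 R) (Set.Ioo ε (ε + 1)), ← Measure.volume_eq_prod] at h2
  exact h2

variable {u : AmbientSpace n → ℝ} {G : AmbientSpace n → AmbientSpace n →L[ℝ] ℝ} {R ε : ℝ}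
  {p : ℝ≥0}

/-- The weight `1 - s` and the vector `(0, 1)` have norm at most one, which gives continuity of the
trace operator on the cylinder with constant `1`. -/
theorem memLp_traceIntegrand (hp : 1 ≤ p) (hu : MemLp u p (volume.restrict (unitCylinder n R ε)))
    (hG : MemLp G p (volume.restrict (unitCylinder n R ε))) :
    MemLp (traceIntegrand u G ε) p
      ((volume.restrict (Metric.ball 0 R)).prod (volume.restrict (Set.Ioo 0 1))) ∧
    eLpNorm (traceIntegrand u G ε) p
      ((volume.restrict (Metric.ball 0 R)).prod (volume.restrict (Set.Ioo 0 1))) ≤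
      eLpNorm u p (volume.restrict (unitCylinder n R ε)) +
        eLpNorm G p (volume.restrict (unitCylinder n R ε)) := by
  have hp' : (1 : ENNReal) ≤ p := by exact_mod_cast hp
  have hmp := measurePreserving_shift (n := n) R ε
  have hu' := hu.comp_measurePreserving hmp
  have hG' := hG.comp_measurePreserving hmp
  have hm : AEStronglyMeasurable
      (fun z : AmbientSpace n => (1 - z.2) * G (z.1, ε + z.2) (0, 1))
      ((volume.restrict (Metric.ball 0 R)).prod (volume.restrict (Set.Ioo 0 1))) := by
    refine AEStronglyMeasurable.mul (by fun_prop) ?_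
    exact (ContinuousLinearMap.apply ℝ ℝ ((0, 1) : AmbientSpace n)).continuous.comp_aestronglyMeasurable
      hG'.1
  have hb : eLpNorm (fun z : AmbientSpace n => (1 - z.2) * G (z.1, ε + z.2) (0, 1)) p
      ((volume.restrict (Metric.ball 0 R)).prod (volume.restrict (Set.Ioo 0 1))) ≤
      eLpNorm G p (volume.restrict (unitCylinder n R ε)) := by
    rw [← eLpNorm_comp_measurePreserving hG.1 hmp]
    refine eLpNorm_mono_ae ?_
    have h1 : ∀ᵐ z : AmbientSpace n ∂((volume.restrict (Metric.ball 0 R)).prod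
        (volume.restrict (Set.Ioo 0 1))), z ∈ Metric.ball 0 R ×ˢ Set.Ioo (0 : ℝ) 1 := by
      rw [Measure.prod_restrict]
      exact ae_restrict_mem (measurableSet_ball.prod measurableSet_Ioo)
    filter_upwards [h1] with z hz
    have h2 : ‖(1 : ℝ) - z.2‖ ≤ 1 := by
      rw [Real.norm_eq_abs, abs_le]
      constructor <;> linarith [hz.2.1, hz.2.2]
    have h3 : ‖((0, 1) : AmbientSpace n)‖ ≤ 1 := by simp [Prod.norm_def]
    calc _ = ‖(1 : ℝ) - z.2‖ * ‖G (z.1, ε + z.2) (0, 1)‖ := norm_mul _ _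
      _ ≤ 1 * (‖G (z.1, ε + z.2)‖ * 1) := by
          gcongr
          exact (G (z.1, ε + z.2)).le_of_opNorm_le_of_le le_rfl h3
      _ = _ := by simp
  have hsub : eLpNorm (traceIntegrand u G ε) p
      ((volume.restrict (Metric.ball 0 R)).prod (volume.restrict (Set.Ioo 0 1))) ≤
      eLpNorm u p (volume.restrict (unitCylinder n R ε)) +
        eLpNorm G p (volume.restrict (unitCylinder n R ε)) := by
    refine (eLpNorm_sub_le hu'.1 hm hp').trans ?_
    rw [eLpNorm_comp_measurePreserving hu.1 hmp]
    gcongr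
  exact ⟨⟨hu'.1.sub hm, hsub.trans_lt (ENNReal.add_lt_top.2 ⟨hu.2, hG.2⟩)⟩, hsub⟩

theorem memLp_sobolevTrace (hp : 1 ≤ p) (hu : MemLp u p (volume.restrict (unitCylinder n R ε)))
    (hG : MemLp G p (volume.restrict (unitCylinder n R ε))) :
    MemLp (sobolevTrace u G ε) p (volume.restrict (Metric.ball 0 R)) ∧
    eLpNorm (sobolevTrace u G ε) p (volume.restrict (Metric.ball 0 R)) ≤
      eLpNorm u p (volume.restrict (unitCylinder n R ε)) +
        eLpNorm G p (volume.restrict (unitCylinder n R ε)) := by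
  obtain ⟨h1, h2⟩ := memLp_traceIntegrand hp hu hG
  have h3 := (eLpNorm_integral_prod_le hp h1.1).trans h2
  exact ⟨⟨h1.1.integral_prod_right', h3.trans_lt (ENNReal.add_lt_top.2 ⟨hu.2, hG.2⟩)⟩, h3⟩

/-- Only almost everywhere, because slices of an integrable function are integrable only for almost
every `x'`. -/
theorem sobolevTrace_sub (hp : 1 ≤ p) {u' : AmbientSpace n → ℝ}
    {G' : AmbientSpace n → AmbientSpace n →L[ℝ] ℝ}
    (hu : MemLp u p (volume.restrict (unitCylinder n R ε)))
    (hG : MemLp G p (volume.restrict (unitCylinder n R ε)))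
    (hu' : MemLp u' p (volume.restrict (unitCylinder n R ε)))
    (hG' : MemLp G' p (volume.restrict (unitCylinder n R ε))) :
    sobolevTrace u G ε - sobolevTrace u' G' ε =ᵐ[volume.restrict (Metric.ball 0 R)]
      sobolevTrace (u - u') (G - G') ε := by
  have hp' : (1 : ENNReal) ≤ p := by exact_mod_cast hp
  have : IsFiniteMeasure ((volume : Measure (EuclideanSpace ℝ (Fin n))).restrict
    (Metric.ball 0 R)) := ⟨by simpa using measure_ball_lt_top⟩
  have i1 := (memLp_traceIntegrand hp hu hG).1.integrable hp'
  have i2 := (memLp_traceIntegrand hp hu' hG').1.integrable hp'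
  filter_upwards [i1.prod_right_ae, i2.prod_right_ae] with x' h1 h2
  simp only [Pi.sub_apply, sobolevTrace]
  rw [← integral_sub h1 h2]
  congr 1
  ext s
  simp only [traceIntegrand, Pi.sub_apply, sub_apply]
  ring

/-- The integrand is the derivative in `s` of `-(1 - s) v(x', ε + s)`. The weight removes the
endpoint `s = 1`, and `s = 0` leaves the value on the hyperplane. This justifies the formula that
defines the trace. -/
theorem sobolevTrace_of_contDiff {v : AmbientSpace n → ℝ} (hv : ContDiff ℝ 1 v) (ε : ℝ)
    (x' : EuclideanSpace ℝ (Fin n)) : sobolevTrace v (fderiv ℝ v) ε x' = v (x', ε) := by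
  have hd : ∀ s : ℝ, HasDerivAt (fun s => v (x', ε + s)) (fderiv ℝ v (x', ε + s) (0, 1)) s := by
    intro s
    have h1 : HasDerivAt (fun s : ℝ => ((x', ε + s) : AmbientSpace n)) (0, 1) s :=
      (hasDerivAt_const s x').prodMk ((hasDerivAt_id s).const_add ε)
    exact ((hv.differentiable one_ne_zero _).hasFDerivAt).comp_hasDerivAt s h1
  have hd' : ∀ s : ℝ, HasDerivAt (fun s => -((1 - s) * v (x', ε + s)))
      (traceIntegrand v (fderiv ℝ v) ε (x', s)) s := by
    intro s
    have h1 := (((hasDerivAt_id s).const_sub 1).mul (hd s)).neg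
    refine h1.congr_deriv ?_
    simp only [traceIntegrand, id]
    ring
  have hc : Continuous fun s : ℝ => traceIntegrand v (fderiv ℝ v) ε (x', s) := by
    have h1 : Continuous fun s : ℝ => ((x', ε + s) : AmbientSpace n) := by fun_prop
    exact (hv.continuous.comp h1).sub ((continuous_const.sub continuous_id).mul
      (((hv.continuous_fderiv one_ne_zero).comp h1).clm_apply continuous_const))
  have h := intervalIntegral.integral_eq_sub_of_hasDerivAt (fun s _ => hd' s)
    (hc.intervalIntegrable 0 1)
  rw [intervalIntegral.integral_of_le zero_le_one, integral_Ioc_eq_integral_Ioo] at h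
  rw [sobolevTrace, h]
  simp

theorem cylinder_subset_halfBall (hε : 0 < ε) :
    unitCylinder n R ε ⊆ halfBall n (|R| + ε + 1) (ε / 2) := by
  rintro ⟨x', t⟩ ⟨hx, ht⟩
  rw [mem_ball_zero_iff] at hx
  refine ⟨?_, by simp only; linarith [ht.1]⟩
  rw [Prod.norm_def, max_lt_iff]
  have h1 : |t| = t := abs_of_pos (hε.trans ht.1)
  refine ⟨by simp only; linarith [le_abs_self R], ?_⟩
  simp only [Real.norm_eq_abs, h1]
  linarith [ht.2, abs_nonneg R]

theorem LocallyApproximable.exists_cylinder_approx (h : LocallyApproximable p u G) (hε : 0 < ε)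
    (R : ℝ) :
    ∃ v : ℕ → AmbientSpace n → ℝ, (∀ k, ContDiff ℝ ∞ (v k)) ∧
      (∀ k, MemLp (v k) p (volume.restrict (unitCylinder n R ε))) ∧
      (∀ k, MemLp (fderiv ℝ (v k)) p (volume.restrict (unitCylinder n R ε))) ∧
      MemLp u p (volume.restrict (unitCylinder n R ε)) ∧
      MemLp G p (volume.restrict (unitCylinder n R ε)) ∧
      Tendsto (fun k => eLpNorm (v k - u) p (volume.restrict (unitCylinder n R ε))) atTop (𝓝 0) ∧
      Tendsto (fun k => eLpNorm (fderiv ℝ (v k) - G) p (volume.restrict (unitCylinder n R ε)))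
        atTop (𝓝 0) := by
  obtain ⟨v, hv, hu, hG, tu, tG⟩ := h (|R| + ε + 1) (ε / 2) (half_pos hε)
  have hle : volume.restrict (unitCylinder n R ε) ≤
      volume.restrict (halfBall n (|R| + ε + 1) (ε / 2)) :=
    Measure.restrict_mono (cylinder_subset_halfBall hε) le_rfl
  exact ⟨v, hv,
    fun k => (memLp_halfBall_of_continuous (hv k).continuous _ _ _).mono_measure hle,
    fun k => (memLp_halfBall_of_continuous ((hv k).continuous_fderiv (by simp)) _ _ _).mono_measure
      hle, hu.mono_measure hle, hG.mono_measure hle,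
    tendsto_of_tendsto_of_tendsto_of_le_of_le tendsto_const_nhds tu (fun _ => zero_le)
      fun k => eLpNorm_mono_measure _ hle,
    tendsto_of_tendsto_of_tendsto_of_le_of_le tendsto_const_nhds tG (fun _ => zero_le)
      fun k => eLpNorm_mono_measure _ hle⟩

/-- The traces of the approximations converge. -/
theorem tendsto_eLpNorm_sobolevTrace (hp : 1 ≤ p) {v : ℕ → AmbientSpace n → ℝ}
    (hv : ∀ k, ContDiff ℝ ∞ (v k))
    (hvp : ∀ k, MemLp (v k) p (volume.restrict (unitCylinder n R ε)))
    (hvp' : ∀ k, MemLp (fderiv ℝ (v k)) p (volume.restrict (unitCylinder n R ε)))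
    (hu : MemLp u p (volume.restrict (unitCylinder n R ε)))
    (hG : MemLp G p (volume.restrict (unitCylinder n R ε)))
    (tu : Tendsto (fun k => eLpNorm (v k - u) p (volume.restrict (unitCylinder n R ε))) atTop (𝓝 0))
    (tG : Tendsto (fun k => eLpNorm (fderiv ℝ (v k) - G) p (volume.restrict (unitCylinder n R ε)))
      atTop (𝓝 0)) :
    Tendsto (fun k => eLpNorm ((fun x' => v k (x', ε)) - sobolevTrace u G ε) p
      (volume.restrict (Metric.ball 0 R))) atTop (𝓝 0) := by
  have h := tu.add tG
  rw [add_zero] at h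
  refine tendsto_of_tendsto_of_tendsto_of_le_of_le tendsto_const_nhds h (fun _ => zero_le)
    fun k => ?_
  have h1 : (fun x' => v k (x', ε)) = sobolevTrace (v k) (fderiv ℝ (v k)) ε :=
    funext fun x' => (sobolevTrace_of_contDiff ((hv k).of_le (by simp)) ε x').symm
  simp only
  rw [h1, eLpNorm_congr_ae (sobolevTrace_sub hp (hvp k) (hvp' k) hu hG)]
  exact (memLp_sobolevTrace hp ((hvp k).sub hu) ((hvp' k).sub hG)).2

theorem LocallyApproximable.isSobolevTrace (h : LocallyApproximable p u G) (hp : 1 ≤ p)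
    (hε : 0 < ε) : IsSobolevTrace p u ε (sobolevTrace u G ε) := by
  refine ⟨G, h.isWeakFDeriv hp, fun R _ => ?_⟩
  obtain ⟨v, hv, hvp, hvp', hu, hG, tu, tG⟩ := h.exists_cylinder_approx hε R
  exact ⟨(memLp_sobolevTrace hp hu hG).1, v, hv, tu, tG,
    tendsto_eLpNorm_sobolevTrace hp hv hvp hvp' hu hG tu tG⟩

end SobolevTrace

/-! ### Comparing the trace with an average over a thin layer -/

section TraceVersusAverage

variable {n : ℕ} {u : AmbientSpace n → ℝ} {G : AmbientSpace n → AmbientSpace n →L[ℝ] ℝ} {R ε : ℝ}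
  {p : ℝ≥0}

/-- The thin cylinder `B'_R × (ε, ε + δ)`. -/
def thinCylinder (n : ℕ) (R ε δ : ℝ) : Set (AmbientSpace n) :=
  Metric.ball 0 R ×ˢ Set.Ioo ε (ε + δ)

theorem measurableSet_thinCylinder (R ε δ : ℝ) : MeasurableSet (thinCylinder n R ε δ) :=
  measurableSet_ball.prod measurableSet_Ioo

theorem volume_restrict_cylinder (R ε : ℝ) :
    (volume : Measure (AmbientSpace n)).restrict (unitCylinder n R ε) =
      (volume.restrict (Metric.ball 0 R)).prod (volume.restrict (Set.Ioo ε (ε + 1))) := by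
  rw [Measure.prod_restrict, ← Measure.volume_eq_prod]
  rfl

instance (R : ℝ) : IsFiniteMeasure ((volume : Measure (EuclideanSpace ℝ (Fin n))).restrict
    (Metric.ball 0 R)) := ⟨by simpa using measure_ball_lt_top⟩

instance (R ε : ℝ) : IsFiniteMeasure ((volume : Measure (AmbientSpace n)).restrict
    (unitCylinder n R ε)) := by
  rw [volume_restrict_cylinder]
  infer_instance

theorem integrableOn_cylinder_of_continuous {F : Type*} [NormedAddCommGroup F]
    {g : AmbientSpace n → F} (hg : Continuous g) (R ε : ℝ) : IntegrableOn g (unitCylinder n R ε) := by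
  have h1 : unitCylinder n R ε ⊆ Metric.closedBall 0 R ×ˢ Set.Icc ε (ε + 1) :=
    Set.prod_mono Metric.ball_subset_closedBall Set.Ioo_subset_Icc_self
  exact (hg.continuousOn.integrableOn_compact
    ((isCompact_closedBall _ _).prod isCompact_Icc)).mono_set h1

/-- The value of a smooth function on `x_N = ε` compared with an average over `x_N > ε`. -/
theorem abs_integral_sub_average_le {ψ : EuclideanSpace ℝ (Fin n) → ℝ} (hψ : Continuous ψ) {C : ℝ}
    (hC : ∀ x, ‖ψ x‖ ≤ C) {θ : ℝ → ℝ} (hθ : Continuous θ) (hθ0 : ∀ t, 0 ≤ θ t) {δ : ℝ}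
    (hδ1 : δ ≤ 1) (hθs : ∀ t, t ∉ Set.Ioo ε (ε + δ) → θ t = 0) (hθi : ∫ t, θ t = 1)
    {v : AmbientSpace n → ℝ} (hv : ContDiff ℝ 1 v) :
    |(∫ x' in Metric.ball 0 R, ψ x' * v (x', ε)) -
        ∫ x in unitCylinder n R ε, ψ x.1 * θ x.2 * v x| ≤
      C * ∫ x in unitCylinder n R ε, (thinCylinder n R ε δ).indicator 1 x * ‖fderiv ℝ v x‖ := by
  have hC0 : 0 ≤ C := (norm_nonneg _).trans (hC 0)
  have hfd : Continuous (fderiv ℝ v) := hv.continuous_fderiv one_ne_zero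
  have hθi' : ∫ t in Set.Ioo ε (ε + 1), θ t = 1 := by
    rw [← hθi]
    refine setIntegral_eq_integral_of_forall_compl_eq_zero fun t ht => hθs t fun ht' => ht ?_
    exact ⟨ht'.1, ht'.2.trans_le (by linarith)⟩
  have hi : Integrable (fun x : AmbientSpace n => ψ x.1 * θ x.2 * v x)
      ((volume.restrict (Metric.ball 0 R)).prod (volume.restrict (Set.Ioo ε (ε + 1)))) := by
    rw [← volume_restrict_cylinder]
    exact integrableOn_cylinder_of_continuous (by have := hv.continuous; fun_prop) R ε
  have hi' : Integrable (fun x : AmbientSpace n => ψ x.1 * θ x.2 * v (x.1, ε))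
      ((volume.restrict (Metric.ball 0 R)).prod (volume.restrict (Set.Ioo ε (ε + 1)))) := by
    rw [← volume_restrict_cylinder]
    exact integrableOn_cylinder_of_continuous (by have := hv.continuous; fun_prop) R ε
  have hN : Integrable (fun x : AmbientSpace n =>
      (thinCylinder n R ε δ).indicator 1 x * ‖fderiv ℝ v x‖)
      ((volume.restrict (Metric.ball 0 R)).prod (volume.restrict (Set.Ioo ε (ε + 1)))) := by
    rw [← volume_restrict_cylinder]
    refine (integrableOn_cylinder_of_continuous hfd.norm R ε).bdd_mul (c := 1)
      ((measurable_one.indicator (measurableSet_thinCylinder R ε δ)).aestronglyMeasurable)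
      (Eventually.of_forall fun x => ?_)
    refine (norm_indicator_le_norm_self _ _).trans (by simp)
  -- Inserting the weight of mass one puts the trace and the average under the same integral, so
  -- that only `v (x', ε) - v (x', t)` remains to be estimated.
  have e1 : ∫ x' in Metric.ball 0 R, ψ x' * v (x', ε) =
      ∫ x' in Metric.ball 0 R, ∫ t in Set.Ioo ε (ε + 1), ψ x' * θ t * v (x', ε) := by
    congr 1
    ext x'
    rw [integral_mul_const, integral_const_mul, hθi', mul_one]
  rw [volume_restrict_cylinder, integral_prod _ hi, integral_prod _ hN, e1,
    ← integral_sub hi'.integral_prod_left hi.integral_prod_left, ← integral_const_mul,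
    ← Real.norm_eq_abs]
  refine norm_integral_le_of_norm_le (hN.integral_prod_left.const_mul C) ?_
  have hc1 : ∀ {g : AmbientSpace n → ℝ} (_ : Continuous g) (x' : EuclideanSpace ℝ (Fin n)),
      IntegrableOn (fun t => g (x', t)) (Set.Ioo ε (ε + 1)) := fun {g} hg x' =>
    ((hg.comp (Continuous.prodMk_right x')).continuousOn.integrableOn_compact
      isCompact_Icc).mono_set Set.Ioo_subset_Icc_self
  filter_upwards [ae_restrict_mem measurableSet_ball] with x' hx'
  rw [← integral_sub (hc1 (g := fun x => ψ x.1 * θ x.2 * v (x.1, ε))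
      (by have := hv.continuous; fun_prop) x')
    (hc1 (g := fun x => ψ x.1 * θ x.2 * v x) (by have := hv.continuous; fun_prop) x')]
  set N := ∫ t in Set.Ioo ε (ε + 1), (thinCylinder n R ε δ).indicator 1 (x', t) *
    ‖fderiv ℝ v (x', t)‖ with hNdef
  have hNeq : N = ∫ t in Set.Ioo ε (ε + δ), ‖fderiv ℝ v (x', t)‖ := by
    have : ∀ t, (thinCylinder n R ε δ).indicator (1 : AmbientSpace n → ℝ) (x', t) *
        ‖fderiv ℝ v (x', t)‖ = (Set.Ioo ε (ε + δ)).indicator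
          (fun t => ‖fderiv ℝ v (x', t)‖) t := by
      intro t
      by_cases ht : t ∈ Set.Ioo ε (ε + δ)
      · rw [Set.indicator_of_mem (show (x', t) ∈ thinCylinder n R ε δ from ⟨hx', ht⟩),
          Set.indicator_of_mem ht]
        simp
      · rw [Set.indicator_of_notMem (show (x', t) ∉ thinCylinder n R ε δ from fun h => ht h.2),
          Set.indicator_of_notMem ht, zero_mul]
    rw [hNdef]
    simp only [this]
    rw [setIntegral_indicator measurableSet_Ioo, Set.inter_eq_right.2]
    exact Set.Ioo_subset_Ioo_right (by linarith)
  -- The fundamental theorem of calculus along the vertical segment from height `ε` to `t`.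
  have hdiff : ∀ t ∈ Set.Ioo ε (ε + δ), |v (x', ε) - v (x', t)| ≤ N := by
    intro t ht
    have hd : ∀ s : ℝ, HasDerivAt (fun s => v (x', s)) (fderiv ℝ v (x', s) (0, 1)) s := fun s =>
      ((hv.differentiable one_ne_zero _).hasFDerivAt).comp_hasDerivAt s
        ((hasDerivAt_const s x').prodMk (hasDerivAt_id s))
    have hc : Continuous fun s : ℝ => fderiv ℝ v (x', s) :=
      hfd.comp (Continuous.prodMk_right x')
    have h1 := intervalIntegral.integral_eq_sub_of_hasDerivAt (fun s _ => hd s)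
      ((hc.clm_apply continuous_const).intervalIntegrable ε t)
    rw [abs_sub_comm, ← h1, hNeq]
    have h3 : ‖((0, 1) : AmbientSpace n)‖ ≤ 1 := by simp [Prod.norm_def]
    calc |∫ s in ε..t, fderiv ℝ v (x', s) (0, 1)| ≤ ∫ s in ε..t, ‖fderiv ℝ v (x', s)‖ := by
          rw [← Real.norm_eq_abs]
          refine intervalIntegral.norm_integral_le_of_norm_le ht.1.le ?_
            (hc.norm.intervalIntegrable _ _)
          refine Eventually.of_forall fun s _ => ?_
          simpa using (fderiv ℝ v (x', s)).le_of_opNorm_le_of_le le_rfl h3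
      _ ≤ ∫ s in Set.Ioo ε (ε + δ), ‖fderiv ℝ v (x', s)‖ := by
          rw [intervalIntegral.integral_of_le ht.1.le, integral_Ioc_eq_integral_Ioo]
          refine setIntegral_mono_set ?_ (Eventually.of_forall fun _ => norm_nonneg _)
            (Set.Ioo_subset_Ioo_right ht.2.le).eventuallyLE
          exact (hc.norm.continuousOn.integrableOn_compact isCompact_Icc).mono_set
            Set.Ioo_subset_Icc_self
  have hθI : IntegrableOn θ (Set.Ioo ε (ε + 1)) :=
    (hθ.continuousOn.integrableOn_compact isCompact_Icc).mono_set Set.Ioo_subset_Icc_self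
  calc ‖∫ t in Set.Ioo ε (ε + 1), (ψ x' * θ t * v (x', ε) - ψ x' * θ t * v (x', t))‖
      ≤ ∫ t in Set.Ioo ε (ε + 1), C * N * θ t := by
        refine norm_integral_le_of_norm_le (hθI.const_mul _) (Eventually.of_forall fun t => ?_)
        rw [← mul_sub, norm_mul, norm_mul, Real.norm_of_nonneg (hθ0 t)]
        by_cases ht : t ∈ Set.Ioo ε (ε + δ)
        · calc ‖ψ x'‖ * θ t * ‖v (x', ε) - v (x', t)‖ ≤ C * θ t * N := by
                have := hθ0 t
                gcongr
                · exact hC x'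
                · exact hdiff t ht
            _ = _ := by ring
        · simp [hθs t ht]
    _ = C * N := by rw [integral_const_mul, hθi', mul_one]

/-- The trace on `x_N = ε` compared with an average over `x_N > ε`. -/
theorem LocallyApproximable.abs_integral_trace_sub_average_le (h : LocallyApproximable p u G)
    (hp : 1 ≤ p) (hε : 0 < ε) {ψ : EuclideanSpace ℝ (Fin n) → ℝ} (hψ : Continuous ψ) {C : ℝ}
    (hC : ∀ x, ‖ψ x‖ ≤ C) (hψR : ∀ x, x ∉ Metric.ball (0 : EuclideanSpace ℝ (Fin n)) R → ψ x = 0)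
    {θ : ℝ → ℝ} (hθ : Continuous θ) (hθ0 : ∀ t, 0 ≤ θ t) {δ : ℝ}
    (hδ1 : δ ≤ 1) (hθs : ∀ t, t ∉ Set.Ioo ε (ε + δ) → θ t = 0) (hθi : ∫ t, θ t = 1) :
    |(∫ x', ψ x' * sobolevTrace u G ε x') - ∫ x in halfSpace n, u x * (ψ x.1 * θ x.2)| ≤
      C * ∫ x in thinCylinder n R ε δ, ‖G x‖ := by
  obtain ⟨v, hv, hvp, hvp', hu, hG, tu, tG⟩ := h.exists_cylinder_approx hε R
  have hv1 : ∀ k, ContDiff ℝ 1 (v k) := fun k => (hv k).of_le (by simp)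
  have e1 : ∫ x', ψ x' * sobolevTrace u G ε x' =
      ∫ x' in Metric.ball 0 R, ψ x' * sobolevTrace u G ε x' :=
    (setIntegral_eq_integral_of_forall_compl_eq_zero fun x hx => by rw [hψR x hx, zero_mul]).symm
  have hcylz : ∀ x : AmbientSpace n, x ∉ unitCylinder n R ε → ψ x.1 * θ x.2 * u x = 0 := by
    intro x hx
    by_cases h1 : x.1 ∈ Metric.ball 0 R
    · rw [hθs x.2 fun h2 => hx ⟨h1, h2.1, h2.2.trans_le (by linarith)⟩]
      simp
    · rw [hψR _ h1]
      simp
  have e2 : ∫ x in halfSpace n, u x * (ψ x.1 * θ x.2) =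
      ∫ x in unitCylinder n R ε, ψ x.1 * θ x.2 * u x := by
    rw [setIntegral_eq_integral_of_forall_compl_eq_zero hcylz]
    simp only [mul_comm (u _)]
    refine setIntegral_eq_integral_of_forall_compl_eq_zero fun x hx => hcylz x fun h1 => hx ?_
    exact hε.trans h1.2.1
  obtain ⟨D, hD⟩ : ∃ D, ∀ t, ‖θ t‖ ≤ D := by
    refine HasCompactSupport.exists_bound_of_continuous ?_ hθ
    exact HasCompactSupport.intro isCompact_Icc fun t ht =>
      hθs t fun ht' => ht (Set.Ioo_subset_Icc_self ht')
  have hC0 : 0 ≤ C := (norm_nonneg _).trans (hC 0)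
  have t1 := tendsto_integral_mul_of_tendsto_eLpNorm hp (μ := volume.restrict (Metric.ball 0 R))
    (fun k => ?_) (memLp_sobolevTrace hp hu hG).1 hψ.aestronglyMeasurable hC
    (tendsto_eLpNorm_sobolevTrace hp hv hvp hvp' hu hG tu tG)
  · have t2 := tendsto_integral_mul_of_tendsto_eLpNorm hp hvp hu
      (φ := fun x : AmbientSpace n => ψ x.1 * θ x.2) (C := C * D)
      (Continuous.aestronglyMeasurable (by fun_prop)) (fun x => by
        rw [norm_mul]; gcongr; exacts [hC _, hD _]) tu
    have tG' : Tendsto (fun k => eLpNorm ((fun x => ‖fderiv ℝ (v k) x‖) - fun x => ‖G x‖) p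
        (volume.restrict (unitCylinder n R ε))) atTop (𝓝 0) :=
      tendsto_of_tendsto_of_tendsto_of_le_of_le tendsto_const_nhds tG (fun _ => zero_le)
        fun k => eLpNorm_mono fun x => by
          simpa using abs_norm_sub_norm_le (fderiv ℝ (v k) x) (G x)
    have t3 := tendsto_integral_mul_of_tendsto_eLpNorm hp (fun k => (hvp' k).norm) hG.norm
      (φ := (thinCylinder n R ε δ).indicator 1) (C := 1)
      ((measurable_one.indicator (measurableSet_thinCylinder R ε δ)).aestronglyMeasurable)
      (fun x => (norm_indicator_le_norm_self _ _).trans (by simp)) tG'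
    have e3 : ∫ x in unitCylinder n R ε, (thinCylinder n R ε δ).indicator 1 x * ‖G x‖ =
        ∫ x in thinCylinder n R ε δ, ‖G x‖ := by
      have : ∀ x, (thinCylinder n R ε δ).indicator (1 : AmbientSpace n → ℝ) x * ‖G x‖ =
          (thinCylinder n R ε δ).indicator (fun x => ‖G x‖) x := fun x => by
        by_cases hx : x ∈ thinCylinder n R ε δ <;> simp [hx]
      simp only [this]
      rw [setIntegral_indicator (measurableSet_thinCylinder R ε δ), Set.inter_eq_right.2]
      exact Set.prod_mono le_rfl (Set.Ioo_subset_Ioo_right (by linarith))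
    rw [e1, e2, ← e3]
    -- The estimate holds for the smooth approximations, and all three integrals converge.
    exact le_of_tendsto_of_tendsto (t1.sub t2).abs (t3.const_mul C) (Eventually.of_forall fun k =>
      abs_integral_sub_average_le hψ hC hθ hθ0 hδ1 hθs hθi (hv1 k))
  · have h1 := (memLp_sobolevTrace hp (hvp k) (hvp' k)).1
    have h2 : sobolevTrace (v k) (fderiv ℝ (v k)) ε = fun x' => v k (x', ε) :=
      funext fun x' => sobolevTrace_of_contDiff (hv1 k) ε x'
    rwa [h2] at h1

end TraceVersusAverage

/-! ### Averages near the boundary and the boundary measure -/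

section BoundaryValues

variable {n : ℕ}

/-- The function `h` with `h'' = θ`, `h 0 = 0`, `h' 0 = -1`, for an averaging weight `θ`. -/
theorem exists_secondPrimitive {θ : ℝ → ℝ} (hθ : Continuous θ) (hθ0 : ∀ t, 0 ≤ θ t) {b : ℝ}
    (hθs : ∀ t, t ∉ Set.Ioo 0 b → θ t = 0) (hθi : ∫ t, θ t = 1) :
    ∃ h s : ℝ → ℝ, h 0 = 0 ∧ s 0 = -1 ∧ (∀ t, HasDerivAt h (s t) t) ∧
      (∀ t, HasDerivAt s (θ t) t) ∧ (∀ t, b ≤ t → s t = 0) ∧ ∀ t, 0 ≤ t → |h t| ≤ min t b := by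
  -- This derivative of `h` increases from `-1` at `0` to `0` at `b`. Hence `|h| ≤ t`, and `h` is
  -- constant beyond `b`, which gives the bound `min t b`.
  set s : ℝ → ℝ := fun t => (∫ r in 0..t, θ r) - 1 with hs
  have hsd : ∀ t, HasDerivAt s (θ t) t := fun t =>
    (intervalIntegral.integral_hasDerivAt_right (hθ.intervalIntegrable _ _)
      (hθ.stronglyMeasurableAtFilter _ _) hθ.continuousAt).sub_const 1
  have hsc : Continuous s := continuous_iff_continuousAt.2 fun t => (hsd t).continuousAt
  have hb : 0 < b := by
    by_contra! hb
    have : θ = fun _ => 0 := funext fun t => hθs t fun ht => by linarith [ht.1, ht.2]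
    simp [this] at hθi
  have hsb : ∀ t, b ≤ t → s t = 0 := by
    intro t ht
    rw [hs]
    simp only
    rw [intervalIntegral.integral_of_le (hb.le.trans ht),
      setIntegral_eq_integral_of_forall_compl_eq_zero, hθi, sub_self]
    exact fun r hr => hθs r fun hr' => hr ⟨hr'.1, hr'.2.le.trans ht⟩
  have hmono : Monotone s := monotone_of_deriv_nonneg (fun t => (hsd t).differentiableAt)
    fun t => by rw [(hsd t).deriv]; exact hθ0 t
  have hs0 : s 0 = -1 := by simp [hs]
  have hsn : ∀ t, s t ≤ 0 := fun t => by
    rw [← hsb _ (le_max_right t b)]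
    exact hmono (le_max_left t b)
  have hd : ∀ t, HasDerivAt (fun t => ∫ r in 0..t, s r) (s t) t := fun t =>
    intervalIntegral.integral_hasDerivAt_right (hsc.intervalIntegrable _ _)
      (hsc.stronglyMeasurableAtFilter _ _) hsc.continuousAt
  have hle : ∀ t, 0 ≤ t → |∫ r in 0..t, s r| ≤ t := by
    intro t ht
    have := intervalIntegral.norm_integral_le_of_norm_le_const (a := 0) (b := t) (f := s) (C := 1)
      fun r hr => by
        rw [Set.uIoc_of_le ht] at hr
        rw [Real.norm_eq_abs, abs_of_nonpos (hsn r)]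
        linarith [hmono hr.1.le]
    simpa [abs_of_nonneg ht] using this
  refine ⟨fun t => ∫ r in 0..t, s r, s, by simp, hs0, hd, hsd, hsb, fun t ht => ?_⟩
  refine le_min (hle t ht) ?_
  rcases le_total t b with htb | htb
  · exact (hle t ht).trans htb
  · have h1 : ∫ r in b..t, s r = 0 := by
      rw [intervalIntegral.integral_congr (g := fun _ => 0), intervalIntegral.integral_zero]
      intro r hr
      rw [Set.uIcc_of_le htb] at hr
      exact hsb r hr.1
    have h2 := intervalIntegral.integral_add_adjacent_intervals
      (hsc.intervalIntegrable (μ := volume) 0 b) (hsc.intervalIntegrable b t)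
    simp only
    rw [← h2, h1, add_zero]
    exact hle b hb.le

theorem contDiff_two_of_hasDerivAt {f f' f'' : ℝ → ℝ} (h : ∀ t, HasDerivAt f (f' t) t)
    (h' : ∀ t, HasDerivAt f' (f'' t) t) (hc : Continuous f'') : ContDiff ℝ 2 f := by
  have e : deriv f = f' := funext fun t => (h t).deriv
  have e' : deriv f' = f'' := funext fun t => (h' t).deriv
  rw [show (2 : WithTop ℕ∞) = 1 + 1 by norm_num, contDiff_succ_iff_deriv, e]
  refine ⟨fun t => (h t).differentiableAt, by simp, ?_⟩
  rw [contDiff_one_iff_deriv, e']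
  exact ⟨fun t => (h' t).differentiableAt, hc⟩

/-- The factor in the variable `x_N` of the test function that compares averages near the boundary
with boundary values. -/
theorem exists_boundaryProfile : ∃ D : ℝ, 0 ≤ D ∧ ∀ (b : ℝ) (θ : ℝ → ℝ), b ≤ 1 → Continuous θ →
    (∀ t, 0 ≤ θ t) → (∀ t, t ∉ Set.Ioo 0 b → θ t = 0) → ∫ t, θ t = 1 →
    ∃ η : ℝ → ℝ, ContDiff ℝ 2 η ∧ (∀ t, 2 ≤ |t| → η t = 0) ∧ η 0 = 0 ∧ deriv η 0 = -1 ∧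
      (∀ t, 0 ≤ t → |η t| ≤ min t b) ∧ ∀ t, 0 < t → |iteratedDeriv 2 η t - θ t| ≤ D * b := by
  let ζ : ContDiffBump (0 : ℝ) := ⟨1, 2, by norm_num, by norm_num⟩
  have hζ : ContDiff ℝ 2 ζ := ζ.contDiff
  have hζ1 : Differentiable ℝ ζ := hζ.differentiable (by norm_num)
  have hζ' : ContDiff ℝ 1 (deriv ζ) := ContDiff.deriv' (n := 1) (by simpa [one_add_one_eq_two] using hζ)
  have hζ2 : Differentiable ℝ (deriv ζ) := hζ'.differentiable (by norm_num)
  obtain ⟨D, hD⟩ := (ζ.hasCompactSupport.deriv.deriv).exists_bound_of_continuous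
    (hζ'.continuous_deriv le_rfl)
  refine ⟨D, (norm_nonneg _).trans (hD 0), fun b θ hb hθ hθ0 hθs hθi => ?_⟩
  obtain ⟨h, s, h0, s0, hh, hs, hsb, hle⟩ := exists_secondPrimitive hθ hθ0 hθs hθi
  have hone : ∀ t, |t| ≤ 1 → ζ t = 1 := fun t ht =>
    ζ.one_of_mem_closedBall (by simpa using ht)
  have d1 : ∀ t, HasDerivAt (fun t => ζ t * h t) (deriv ζ t * h t + ζ t * s t) t := fun t =>
    (hζ1 t).hasDerivAt.mul (hh t)
  have d2 : ∀ t, HasDerivAt (fun t => deriv ζ t * h t + ζ t * s t)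
      (deriv (deriv ζ) t * h t + deriv ζ t * s t + (deriv ζ t * s t + ζ t * θ t)) t := fun t =>
    ((hζ2 t).hasDerivAt.mul (hh t)).add ((hζ1 t).hasDerivAt.mul (hs t))
  have hhc : Continuous h := continuous_iff_continuousAt.2 fun t => (hh t).continuousAt
  have hsc : Continuous s := continuous_iff_continuousAt.2 fun t => (hs t).continuousAt
  refine ⟨fun t => ζ t * h t, contDiff_two_of_hasDerivAt d1 d2 ?_, fun t ht => ?_, ?_, ?_,
    fun t ht => ?_, fun t ht => ?_⟩
  · have := hζ'.continuous
    have := hζ'.continuous_deriv le_rfl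
    have := hζ.continuous
    fun_prop
  · simp only
    rw [ζ.zero_of_le_dist (by simpa using ht), zero_mul]
  · simp [h0]
  · rw [(d1 0).deriv, h0, s0, hone 0 (by simp)]
    simp
  · rw [abs_mul, abs_of_nonneg ζ.nonneg]
    exact (mul_le_of_le_one_left (abs_nonneg _) ζ.le_one).trans (hle t ht)
  · have e1 : deriv (fun t => ζ t * h t) = fun t => deriv ζ t * h t + ζ t * s t :=
      funext fun t => (d1 t).deriv
    -- On `0 < t < 1` the cutoff is constant, and for `t ≥ 1 ≥ b` the factor `s` vanishes. Thus `η''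
    -- - θ` reduces to `ζ'' h`, of size `D b`.
    have e2 : deriv ζ t * s t = 0 := by
      rcases lt_or_ge t 1 with h1 | h1
      · have : (ζ : ℝ → ℝ) =ᶠ[𝓝 t] fun _ => 1 := by
          filter_upwards [Ioo_mem_nhds (by linarith : -1 < t) h1] with r hr
          exact hone r (abs_le.2 ⟨hr.1.le, hr.2.le⟩)
        rw [this.deriv_eq, deriv_const, zero_mul]
      · rw [hsb t (hb.trans h1), mul_zero]
    have e3 : ζ t * θ t = θ t := by
      by_cases h1 : t ≤ 1
      · rw [hone t (abs_le.2 ⟨by linarith, h1⟩), one_mul]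
      · rw [hθs t fun h2 => h1 (h2.2.le.trans hb), mul_zero]
    rw [iteratedDeriv_succ, iteratedDeriv_one, e1, (d2 t).deriv, e2, e3]
    simp only [add_zero, zero_add, add_sub_cancel_right]
    rw [abs_mul]
    exact mul_le_mul (hD t) ((hle t ht.le).trans (min_le_right _ _)) (abs_nonneg _)
      ((norm_nonneg _).trans (hD 0))

theorem laplacianProd_mul {ψ : EuclideanSpace ℝ (Fin n) → ℝ} (hψ : ContDiff ℝ 2 ψ)
    (η : ℝ → ℝ) (x : AmbientSpace n) :
    laplacianProd (fun x : AmbientSpace n => ψ x.1 * η x.2) x =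
      Laplacian.laplacian ψ x.1 * η x.2 + ψ x.1 * iteratedDeriv 2 η x.2 := by
  unfold laplacianProd
  have h1 : (fun y : EuclideanSpace ℝ (Fin n) => ψ y * η x.2) = η x.2 • ψ :=
    funext fun y => mul_comm _ _
  congr 1
  · rw [show (fun y : EuclideanSpace ℝ (Fin n) => ψ (y, x.2).1 * η (y, x.2).2) = η x.2 • ψ from h1,
      InnerProductSpace.laplacian_smul _ hψ.contDiffAt, smul_eq_mul, mul_comm]
  · change iteratedDeriv 2 (fun t => ψ x.1 * η t) x.2 = _
    exact iteratedDeriv_const_mul_field (n := 2) (x := x.2) (ψ x.1) η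

theorem continuous_laplacian {ψ : EuclideanSpace ℝ (Fin n) → ℝ} (hψ : ContDiff ℝ 2 ψ) :
    Continuous (Laplacian.laplacian ψ) := by
  rw [InnerProductSpace.laplacian_eq_iteratedFDeriv_stdOrthonormalBasis]
  have : Continuous (iteratedFDeriv ℝ 2 ψ) := hψ.continuous_iteratedFDeriv le_rfl
  fun_prop

theorem laplacian_eq_zero_of_notMem_tsupport {ψ : EuclideanSpace ℝ (Fin n) → ℝ}
    {x : EuclideanSpace ℝ (Fin n)} (hx : x ∉ tsupport ψ) : Laplacian.laplacian ψ x = 0 := by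
  have h1 : ψ =ᶠ[𝓝 x] fun _ => 0 := notMem_tsupport_iff_eventuallyEq.1 hx
  rw [(InnerProductSpace.laplacian_congr_nhds h1).eq_of_nhds]
  simp

theorem MemL1LocUpToBoundary.abs_integral_mul_le {u : AmbientSpace n → ℝ}
    (hu : MemL1LocUpToBoundary u) {w : AmbientSpace n → ℝ} (hw : Continuous w) {B R : ℝ}
    (hB : ∀ x ∈ halfSpace n, |w x| ≤ B) (hR : ∀ x, R ≤ ‖x‖ → w x = 0) :
    IntegrableOn (fun x => u x * w x) (halfSpace n) ∧
      |∫ x in halfSpace n, u x * w x| ≤ B * ∫ x in halfBall n R 0, |u x| := by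
  have hi : IntegrableOn u (halfBall n R 0) := hu.integrableOn_halfBall le_rfl
  have hz : ∀ x ∈ halfSpace n \ halfBall n R 0, u x * w x = 0 := fun x hx => by
    rw [hR x (not_lt.1 fun h => hx.2 ⟨h, hx.1⟩), mul_zero]
  have hae : ∀ᵐ x ∂volume.restrict (halfBall n R 0), ‖w x‖ ≤ B := by
    filter_upwards [ae_restrict_mem (isOpen_halfBall R 0).measurableSet] with x hx
    exact hB x hx.2
  have hiw : IntegrableOn (fun x => u x * w x) (halfBall n R 0) :=
    hi.mul_bdd hw.aestronglyMeasurable hae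
  refine ⟨hiw.of_forall_sdiff_eq_zero (isOpen_halfSpace n).measurableSet hz, ?_⟩
  rw [setIntegral_eq_of_subset_of_forall_sdiff_eq_zero (isOpen_halfSpace n).measurableSet
    (halfBall_subset_halfSpace le_rfl) hz, ← integral_const_mul, ← Real.norm_eq_abs]
  refine norm_integral_le_of_norm_le (hi.abs.const_mul B) ?_
  filter_upwards [hae] with x hx
  rw [norm_mul, mul_comm, Real.norm_eq_abs (u x)]
  gcongr

theorem LocalRadonMeasure.enorm_integral_le {X : Type*} [TopologicalSpace X] [T2Space X]
    [LocallyCompactSpace X] [MeasurableSpace X] [BorelSpace X] (μ : LocalRadonMeasure X)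
    (f : X → ℝ) : ‖μ.integral f‖ₑ ≤ ∫⁻ x, ‖f x‖ₑ ∂μ.abs := by
  rw [LocalRadonMeasure.abs, lintegral_add_measure]
  exact enorm_sub_le.trans
    (add_le_add (enorm_integral_le_lintegral_enorm _) (enorm_integral_le_lintegral_enorm _))

/-- `∫ min(x_N, b) d|μ|` over the part of the half-space in a ball. -/
noncomputable def boundaryMass (μ : LocalRadonMeasure (halfSpace n)) (R b : ℝ) : ENNReal :=
  ∫⁻ x in (Subtype.val : halfSpace n → AmbientSpace n) ⁻¹' Metric.ball 0 R,
    ENNReal.ofReal (min (x : AmbientSpace n).2 b) ∂μ.abs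

theorem LocalRadonMeasure.MemWeighted.lintegral_ball_lt_top {μ : LocalRadonMeasure (halfSpace n)}
    (hμ : μ.MemWeighted) (R : ℝ) :
    ∫⁻ x in (Subtype.val : halfSpace n → AmbientSpace n) ⁻¹' Metric.ball 0 R,
      ENNReal.ofReal (x : AmbientSpace n).2 ∂μ.abs < ⊤ := by
  refine hμ _ ?_
  rw [← Bornology.isBounded_image_subtype_val]
  exact Metric.isBounded_ball.subset (Set.image_preimage_subset _ _)

theorem boundaryMass_lt_top {μ : LocalRadonMeasure (halfSpace n)} (hμ : μ.MemWeighted) (R b : ℝ) :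
    boundaryMass μ R b < ⊤ :=
  (lintegral_mono fun _ => ENNReal.ofReal_le_ofReal (min_le_left _ _)).trans_lt
    (hμ.lintegral_ball_lt_top R)

/-- Dominated convergence with majorant `x_N`, integrable by the weighted condition; that condition
is what makes the measure invisible in the boundary limit. -/
theorem tendsto_boundaryMass {μ : LocalRadonMeasure (halfSpace n)} (hμ : μ.MemWeighted) (R : ℝ) :
    Tendsto (boundaryMass μ R) (𝓝[>] 0) (𝓝 0) := by
  have h := tendsto_lintegral_filter_of_dominated_convergence (l := 𝓝[>] (0 : ℝ))
    (μ := μ.abs.restrict ((Subtype.val : halfSpace n → AmbientSpace n) ⁻¹' Metric.ball 0 R))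
    (F := fun b x => ENNReal.ofReal (min (x : AmbientSpace n).2 b)) (f := fun _ => 0)
    (fun x => ENNReal.ofReal (x : AmbientSpace n).2)
    (Eventually.of_forall fun b => by fun_prop)
    (Eventually.of_forall fun b => Eventually.of_forall fun x =>
      ENNReal.ofReal_le_ofReal (min_le_left _ _))
    (hμ.lintegral_ball_lt_top R).ne (Eventually.of_forall fun x => ?_)
  · rw [lintegral_zero] at h
    exact h
  · have h1 : Continuous fun b : ℝ => ENNReal.ofReal (min (x : AmbientSpace n).2 b) :=
      ENNReal.continuous_ofReal.comp (by fun_prop)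
    have h2 := h1.tendsto 0
    have h3 : (0 : ℝ) ≤ (x : AmbientSpace n).2 := le_of_lt x.2
    simp only [min_eq_right h3, ENNReal.ofReal_zero] at h2
    exact h2.mono_left nhdsWithin_le_nhds

/-- Averages of a weak solution near the boundary are close to the boundary value. -/
theorem IsWeakSolution.exists_average_bound {μ : LocalRadonMeasure (halfSpace n)}
    (hμ : μ.MemWeighted) {ν : LocalRadonMeasure (EuclideanSpace ℝ (Fin n))}
    {u : AmbientSpace n → ℝ} (hu : IsWeakSolution (-μ) ν u) {ψ : EuclideanSpace ℝ (Fin n) → ℝ}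
    (hψ : ContDiff ℝ 2 ψ) (hψc : HasCompactSupport ψ) :
    ∃ m : ℝ → ℝ, Tendsto m (𝓝[>] 0) (𝓝 0) ∧ ∀ (b : ℝ) (θ : ℝ → ℝ), b ≤ 1 → Continuous θ →
      (∀ t, 0 ≤ θ t) → (∀ t, t ∉ Set.Ioo 0 b → θ t = 0) → ∫ t, θ t = 1 →
      |(∫ x in halfSpace n, u x * (ψ x.1 * θ x.2)) - ν.integral ψ| ≤ m b := by
  obtain ⟨D, hD0, hD⟩ := exists_boundaryProfile
  obtain ⟨C, hC⟩ := hψc.exists_bound_of_continuous hψ.continuous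
  have hC0 : 0 ≤ C := (norm_nonneg _).trans (hC 0)
  have hΔc := continuous_laplacian hψ
  have hΔz := fun x => laplacian_eq_zero_of_notMem_tsupport (ψ := ψ) (x := x)
  obtain ⟨L, hL⟩ := (HasCompactSupport.intro hψc fun x hx => hΔz x hx).exists_bound_of_continuous
    hΔc
  -- With the maximum norm, `‖x‖ ≥ R > 3` forces `‖x'‖ ≥ R` or `|x_N| ≥ 3`, so either the
  -- `ψ`-factors or the factors in `x_N`, including `iteratedDeriv 2 η`, vanish.
  obtain ⟨R, hR3, hR⟩ := hψc.isBounded.subset_ball_lt 3 0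
  have hψR : ∀ x, R ≤ ‖x‖ → x ∉ tsupport ψ := fun x hx h =>
    absurd (mem_ball_zero_iff.1 (hR h)) (not_lt.2 hx)
  set I := ∫ x in halfBall n R 0, |u x|
  refine ⟨fun b => C * (boundaryMass μ R b).toReal + (L * b + C * (D * b)) * I, ?_, ?_⟩
  · have h1 := (ENNReal.tendsto_toReal ENNReal.zero_ne_top).comp (tendsto_boundaryMass hμ R)
    have h2 : Tendsto (fun b : ℝ => (L * b + C * (D * b)) * I) (𝓝[>] 0) (𝓝 0) := by
      have : Continuous fun b : ℝ => (L * b + C * (D * b)) * I := by fun_prop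
      simpa using (this.tendsto 0).mono_left nhdsWithin_le_nhds
    simpa using (h1.const_mul C).add h2
  intro b θ hb hθ hθ0 hθs hθi
  obtain ⟨η, hη, hη2, hη0, hη1, hηle, hηθ⟩ := hD b θ hb hθ hθ0 hθs hθi
  have hη'c : Continuous (iteratedDeriv 2 η) := hη.continuous_iteratedDeriv 2 le_rfl
  have hη'z : ∀ t, 3 ≤ |t| → iteratedDeriv 2 η t = 0 := by
    intro t ht
    have h1 : η =ᶠ[𝓝 t] fun _ => 0 := by
      filter_upwards [continuous_abs.continuousAt.eventually_mem
        (Ioi_mem_nhds (show 2 < |t| by linarith))] with r hr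
      exact hη2 r (le_of_lt hr)
    rw [h1.iteratedDeriv_eq]
    simp
  have hψη : IsTestFunction fun x : AmbientSpace n => ψ x.1 * η x.2 := by
    refine ⟨(hψ.comp contDiff_fst).mul (hη.comp contDiff_snd), ?_, fun x' => by simp [hη0]⟩
    refine HasCompactSupport.intro (hψc.prod (isCompact_Icc (a := (-2 : ℝ)) (b := 2)))
      fun x hx => ?_
    by_cases h1 : x.1 ∈ tsupport ψ
    · have h2 : x.2 ∉ Set.Icc (-2 : ℝ) 2 := fun h2 => hx ⟨h1, h2⟩
      rw [hη2 x.2, mul_zero]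
      by_contra! h3
      exact h2 (abs_le.1 h3.le)
    · rw [image_eq_zero_of_notMem_tsupport h1, zero_mul]
  have hweak := hu.2 _ hψη
  have e1 : ν.integral (fun x' => deriv (fun t : ℝ => ψ x' * η t) 0) = -ν.integral ψ := by
    have : (fun x' => deriv (fun t : ℝ => ψ x' * η t) 0) = fun x' => -ψ x' := by
      ext x'
      rw [deriv_const_mul_field, hη1, mul_neg_one]
    rw [this]
    simp only [LocalRadonMeasure.integral, integral_neg]
    ring
  -- This is `Δ(ψη) - ψθ`: in the half-space its first term is at most `L b` because `|η| ≤ b`, its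
  -- second at most `C D b`.
  set w : AmbientSpace n → ℝ := fun x =>
    Laplacian.laplacian ψ x.1 * η x.2 + ψ x.1 * (iteratedDeriv 2 η x.2 - θ x.2) with hw
  have hout : ∀ x : AmbientSpace n, R ≤ ‖x‖ → R ≤ ‖x.1‖ ∨ 3 ≤ |x.2| := fun x hx => by
    rw [Prod.norm_def] at hx
    exact (le_max_iff.1 hx).imp_right fun h => hR3.le.trans h
  have hθ3 : ∀ t, 3 ≤ |t| → θ t = 0 := fun t ht => hθs t fun h => by
    rw [abs_of_pos h.1] at ht
    linarith [h.2]
  obtain ⟨E, hE⟩ := (HasCompactSupport.intro isCompact_Icc fun t ht =>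
    hθs t fun ht' => ht (Set.Ioo_subset_Icc_self ht')).exists_bound_of_continuous hθ
  obtain ⟨i1, -⟩ := hu.1.abs_integral_mul_le (w := fun x => ψ x.1 * θ x.2) (R := R)
    (B := C * E) (by have := hψ.continuous; fun_prop)
    (fun x _ => by
      rw [abs_mul]
      exact mul_le_mul (hC _) (hE _) (abs_nonneg _) hC0) (fun x hx => by
      rcases hout x hx with h | h
      · rw [image_eq_zero_of_notMem_tsupport (hψR _ h), zero_mul]
      · rw [hθ3 _ h, mul_zero])
  obtain ⟨i2, b2⟩ := hu.1.abs_integral_mul_le (w := w) (R := R) (B := L * b + C * (D * b))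
    (by have := hψ.continuous; have := hη.continuous; fun_prop) (fun x hx => by
      have h1 := (hηle x.2 (le_of_lt hx)).trans (min_le_right _ _)
      have h2 := hηθ x.2 hx
      refine (abs_add_le _ _).trans ?_
      rw [abs_mul, abs_mul]
      exact add_le_add (mul_le_mul (hL _) h1 (abs_nonneg _) ((norm_nonneg _).trans (hL 0)))
        (mul_le_mul (hC _) h2 (abs_nonneg _) hC0)) (fun x hx => by
      rcases hout x hx with h | h
      · simp only [hw]
        rw [image_eq_zero_of_notMem_tsupport (hψR _ h), hΔz _ (hψR _ h)]
        ring
      · simp only [hw]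
        rw [hθ3 _ h, hη'z _ h, hη2 _ (by linarith)]
        ring)
  have e2 : ∫ x in halfSpace n, u x * -laplacianProd (fun x : AmbientSpace n => ψ x.1 * η x.2) x =
      -((∫ x in halfSpace n, u x * (ψ x.1 * θ x.2)) + ∫ x in halfSpace n, u x * w x) := by
    rw [← integral_add i1 i2, ← integral_neg]
    congr 1
    ext x
    rw [laplacianProd_mul hψ η]
    simp only [hw]
    ring
  rw [e1, e2, LocalRadonMeasure.integral_neg] at hweak
  have hmass : |μ.integral fun x => ψ (x : AmbientSpace n).1 * η (x : AmbientSpace n).2| ≤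
      C * (boundaryMass μ R b).toReal := by
    have h1 := μ.enorm_integral_le fun x => ψ (x : AmbientSpace n).1 * η (x : AmbientSpace n).2
    have h2 : ∫⁻ x, ‖ψ (x : AmbientSpace n).1 * η (x : AmbientSpace n).2‖ₑ ∂μ.abs ≤
        ENNReal.ofReal C * boundaryMass μ R b := by
      have hΩ : MeasurableSet ((Subtype.val : halfSpace n → AmbientSpace n) ⁻¹'
          Metric.ball 0 R) := measurable_subtype_coe measurableSet_ball
      rw [boundaryMass, ← lintegral_const_mul' _ _ ENNReal.ofReal_ne_top, ← lintegral_indicator hΩ]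
      refine lintegral_mono fun x => ?_
      by_cases hx : (x : AmbientSpace n) ∈ Metric.ball 0 R
      · rw [Set.indicator_of_mem (show x ∈ Subtype.val ⁻¹' Metric.ball 0 R from hx),
          ← ENNReal.ofReal_mul hC0, Real.enorm_eq_ofReal_abs, abs_mul]
        refine ENNReal.ofReal_le_ofReal ?_
        exact mul_le_mul (hC _) (hηle _ (le_of_lt x.2)) (abs_nonneg _) hC0
      · rw [mem_ball_zero_iff, not_lt] at hx
        rcases hout _ hx with h | h
        · rw [image_eq_zero_of_notMem_tsupport (hψR _ h), zero_mul]
          simp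
        · rw [hη2 _ (by linarith), mul_zero]
          simp
    have h3 := ENNReal.toReal_mono
      (ENNReal.mul_ne_top ENNReal.ofReal_ne_top (boundaryMass_lt_top hμ R b).ne) (h1.trans h2)
    rwa [ENNReal.toReal_mul, ENNReal.toReal_ofReal hC0, toReal_enorm, Real.norm_eq_abs] at h3
  calc |(∫ x in halfSpace n, u x * (ψ x.1 * θ x.2)) - ν.integral ψ|
      = |(μ.integral fun x => ψ (x : AmbientSpace n).1 * η (x : AmbientSpace n).2) -
          ∫ x in halfSpace n, u x * w x| := by
        congr 1
        linarith
    _ ≤ _ := (abs_sub _ _).trans (add_le_add hmass b2)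

end BoundaryValues

/-! ### Passage to the limit `ε → 0⁺` -/

section BoundaryLimit

variable {n : ℕ} {u : AmbientSpace n → ℝ} {G : AmbientSpace n → AmbientSpace n →L[ℝ] ℝ} {p : ℝ≥0}

theorem exists_averagingWeight (ε : ℝ) {δ : ℝ} (hδ : 0 < δ) : ∃ θ : ℝ → ℝ, Continuous θ ∧
    (∀ t, 0 ≤ θ t) ∧ (∀ t, t ∉ Set.Ioo ε (ε + δ) → θ t = 0) ∧ ∫ t, θ t = 1 := by
  let f : ContDiffBump (ε + δ / 2) := ⟨δ / 4, δ / 2, by linarith, by linarith⟩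
  refine ⟨f.normed volume, f.continuous_normed, fun t => f.nonneg_normed t, fun t ht => ?_,
    f.integral_normed⟩
  by_contra h
  have h1 : t ∈ Function.support (f.normed volume) := h
  have h2 : f.rOut = δ / 2 := rfl
  rw [f.support_normed_eq, Real.ball_eq_Ioo, h2] at h1
  refine ht ⟨?_, ?_⟩
  · linarith [h1.1]
  · linarith [h1.2]

/-- For fixed `ε` the cylinders shrink to the empty set as their height tends to zero, so the
integral of `|G|` tends to zero. The height may depend on `ε` in an uncontrolled way. -/
theorem LocallyApproximable.exists_thinCylinder_integral_le (h : LocallyApproximable p u G)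
    (hp : 1 ≤ p) {ε : ℝ} (hε : 0 < ε) (R C : ℝ) :
    ∃ δ, 0 < δ ∧ δ ≤ ε ∧ δ ≤ 1 ∧ C * ∫ x in thinCylinder n R ε δ, ‖G x‖ ≤ ε := by
  obtain ⟨v, -, -, -, -, hG, -⟩ := h.exists_cylinder_approx hε R
  -- The height `1` is written as the term `k = 0` of the sequence `1 / (k + 1)`, the first of the
  -- nested cylinders.
  have hi : IntegrableOn (fun x => ‖G x‖) (thinCylinder n R ε (1 / ((0 : ℕ) + 1))) := by
    simpa [thinCylinder, unitCylinder, IntegrableOn] using (hG.integrable (by exact_mod_cast hp)).norm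
  have hanti : Antitone fun k : ℕ => thinCylinder n R ε (1 / ((k : ℝ) + 1)) := fun i j hij =>
    Set.prod_mono le_rfl (Set.Ioo_subset_Ioo_right (by
      have := Nat.one_div_le_one_div (α := ℝ) hij
      linarith))
  have hempty : ⋂ k : ℕ, thinCylinder n R ε (1 / ((k : ℝ) + 1)) = ∅ := by
    refine Set.eq_empty_of_forall_notMem fun x hx => ?_
    rw [Set.mem_iInter] at hx
    obtain ⟨k, hk⟩ := exists_nat_one_div_lt (sub_pos.2 (hx 0).2.1)
    linarith [(hx k).2.2]
  have hlim := (hanti.tendsto_setIntegral (μ := volume) (f := fun x => ‖G x‖)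
    (fun k => measurableSet_thinCylinder R ε _) (by exact_mod_cast hi)).const_mul C
  rw [hempty, setIntegral_empty, mul_zero] at hlim
  have h1 := tendsto_one_div_add_atTop_nhds_zero_nat (𝕜 := ℝ)
  obtain ⟨k, hk, hk'⟩ := ((hlim.eventually (eventually_le_nhds hε)).and
    (h1.eventually (eventually_le_nhds hε))).exists
  refine ⟨1 / ((k : ℝ) + 1), Nat.one_div_pos_of_nat, hk', ?_, hk⟩
  simpa using Nat.one_div_le_one_div (α := ℝ) (Nat.zero_le k)

/-- The traces of a weak solution converge weakly to its boundary value. -/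
theorem IsWeakSolution.tendsto_integral_sobolevTrace {μ : LocalRadonMeasure (halfSpace n)}
    (hμ : μ.MemWeighted) {ν : LocalRadonMeasure (EuclideanSpace ℝ (Fin n))}
    (hu : IsWeakSolution (-μ) ν u) (h : LocallyApproximable p u G) (hp : 1 ≤ p)
    {ψ : EuclideanSpace ℝ (Fin n) → ℝ} (hψ : ContDiff ℝ 2 ψ) (hψc : HasCompactSupport ψ) :
    Tendsto (fun ε : ℝ => ∫ x', ψ x' * sobolevTrace u G ε x') (𝓝[>] 0) (𝓝 (ν.integral ψ)) := by
  obtain ⟨m, hm, hmb⟩ := hu.exists_average_bound hμ hψ hψc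
  obtain ⟨C, hC⟩ := hψc.exists_bound_of_continuous hψ.continuous
  obtain ⟨R, -, hR⟩ := hψc.isBounded.subset_ball_lt 0 0
  have hψR : ∀ x, x ∉ Metric.ball (0 : EuclideanSpace ℝ (Fin n)) R → ψ x = 0 := fun x hx =>
    image_eq_zero_of_notMem_tsupport fun hx' => hx (hR hx')
  have t0 : Tendsto (fun ε : ℝ => ε) (𝓝[>] 0) (𝓝 0) := tendsto_id'.2 nhdsWithin_le_nhds
  have t2 : Tendsto (fun ε : ℝ => 2 * ε) (𝓝[>] 0) (𝓝[>] 0) := by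
    refine tendsto_nhdsWithin_iff.2 ⟨by simpa using t0.const_mul 2, ?_⟩
    filter_upwards [self_mem_nhdsWithin] with ε hε
    exact mul_pos two_pos (Set.mem_Ioi.1 hε)
  have t : Tendsto (fun ε => ε + m (2 * ε)) (𝓝[>] 0) (𝓝 0) := by
    simpa using t0.add (hm.comp t2)
  rw [tendsto_iff_norm_sub_tendsto_zero]
  refine squeeze_zero' (Eventually.of_forall fun _ => norm_nonneg _) ?_ t
  filter_upwards [Ioo_mem_nhdsGT (show (0 : ℝ) < 1 / 2 by norm_num)] with ε hε
  obtain ⟨δ, hδ0, hδε, hδ1, hδ⟩ := h.exists_thinCylinder_integral_le hp hε.1 R C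
  obtain ⟨θ, hθ, hθ0, hθs, hθi⟩ := exists_averagingWeight ε hδ0
  have h1 := h.abs_integral_trace_sub_average_le hp hε.1 hψ.continuous hC hψR hθ hθ0 hδ1 hθs hθi
  -- Since `δ ≤ ε`, the support `(ε, ε + δ)` lies in `(0, 2ε)`; `ε < 1/2` ensures `2ε ≤ 1`.
  have h2 := hmb (2 * ε) θ (by linarith [hε.2]) hθ hθ0 (fun t ht => hθs t fun ht' => ht
    ⟨hε.1.trans ht'.1, by linarith [ht'.2]⟩) hθi
  rw [Real.norm_eq_abs]
  exact (abs_sub_le _ _ _).trans (add_le_add (h1.trans hδ) h2)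

end BoundaryLimit

/-- The dimension of the half-space is `N = n + 1 ≥ 2`. A weak solution of `Δu = μ`, `u = ν` is a
weak solution of `-Δu = -μ`, `u = ν`. -/
theorem mainTheorem7 (n : ℕ) (hn : 1 ≤ n) (μ : LocalRadonMeasure (halfSpace n))
    (hμ : μ.MemWeighted) (ν : LocalRadonMeasure (EuclideanSpace ℝ (Fin n)))
    (u : EuclideanSpace ℝ (Fin n) × ℝ → ℝ) (hu : IsWeakSolution (-μ) ν u) :
    IsLimTrace u ν := by
  have hn' : (0 : ℝ) < n := by exact_mod_cast hn
  -- Any `p` with `1 < p < (n + 1) / n` would do; this one gives `p n = n + 1/2`.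
  set p : ℝ≥0 := 1 + 1 / (2 * n) with hp
  have hp1 : 1 < p := lt_add_of_pos_right _ (by positivity)
  have hpn : (p : ℝ) * n < n + 1 := by
    have : (p : ℝ) * n = n + 1 / 2 := by
      rw [hp]
      push_cast
      field_simp
    linarith
  obtain ⟨G, hG⟩ := hu.exists_gradient hn hμ hp1.le hpn
  exact ⟨p, hp1, hG.memW1Loc hp1.le, sobolevTrace u G,
    fun ε hε => hG.isSobolevTrace hp1.le hε,
    fun ψ hψ hψc => hu.tendsto_integral_sobolevTrace hμ hG hp1.le hψ hψc⟩
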